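/- Let $D\ge 2$, let $\mathbb X=\{a_1<\dots<a_D\}$ be a finite ordered alphabet, let $\mathbb X^*$ be the set of finite strings over $\mathbb X$, and let $X_i(x)=x_i$ be the coordinates on the space $\mathbb X^{\mathbb Z}$ of two-sided sequences with its product $\sigma$-field and the shift $T((x_i)_i)=(x_{i+1})_i$. Write $x_j^k=x_j\cdots x_k$. For a probability measure $P$ on $\mathbb X^{\mathbb Z}$ write $P(w)=P(X_1^{|w|}=w)$ and $P(a\mid w)=P(wa)/P(w)$ (with value $0$ if $P(w)=0$); $P$ is stationary ergodic if it is $T$-invariant and gives every $T$-invariant event probability $0$ or $1$. *Computability.* A real function $g$ of a finite object is computable if the sets of rationals below and above $g(\cdot)$ are computably enumerable (c.e.) uniformly in the argument; computability of a function with an additional argument $s\in\mathbb X^{\mathbb Z}$ is understood with $s$ as an oracle, uniformly in $s$. A probability measure $P$ on $\mathbb X^{\mathbb Z}$ is computable if $(\sigma,\tau)\mapsto P(X_{-|\sigma|+1}^{|\tau|}=\sigma\tau)$, $\sigma,\tau\in\mathbb X^*$, is computable. A sequence $s\in\mathbb X^{\mathbb Z}$ is a representation of $P$ if $P=\rho(s)$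 for some map $\rho$ from $\mathbb X^{\mathbb Z}$ to probability measures on $\mathbb X^{\mathbb Z}$ such that $(\sigma,\tau,s)\mapsto\rho(s)(X_{-|\sigma|+1}^{|\tau|}=\sigma\tau)$ is computable. *Randomness.* A Martin-Löf $(s,P)$-test is a sequence of events $U_i=\{x:\exists(\sigma,\tau)\in V_i,\ x_{-|\sigma|+1}^{|\tau|}=\sigma\tau\}$, $i\ge1$, where the sets $V_i\subset\mathbb X^*\times\mathbb X^*$ are uniformly c.e. with oracle $s$ and $P(U_i)\le 2^{-i}$ for all $i\ge 1$. A point $x$ is $1$-$P$-random if there is a representation $s$ of $P$ such that $x\notin\bigcap_{i\ge1}U_i$ for every Martin-Löf $(s,P)$-test $(U_i)_{i\ge 1}$. *Estimators and predictors.* A probability measure $R$ on $\mathbb X^{\mathbb Z}$ is a $1$-universal forward estimator if $R$ is computable and, for every stationary ergodic $P$ and every $1$-$P$-random point $x$, $$\lim_{n\to\infty}\frac1n\sum_{i=0}^{n-1}\sum_{a\in\mathbb X}\bigl|R(a\mid x_1^i)-P(a\mid x_1^i)\bigr|=0 .$$ The predictor $f_R:\mathbb X^*\to\mathbb X$ induced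 by $R$ maps $w$ to the least $a\in\mathbb X$ that maximizes $R(a\mid w)$. A predictor $f:\mathbb X^*\to\mathbb X$ is $1$-universal if it is computable and, for every stationary ergodic $P$ and every $1$-$P$-random point $x$, $$\lim_{n\to\infty}\frac1n\sum_{i=0}^{n-1}\mathbf 1\{x_{i+1}\ne f(x_1^i)\}=u_P:=\lim_{n\to\infty}\mathbf E_P\Bigl[1-\max_{a\in\mathbb X}P(X_0=a\mid X_{-n}^{-1})\Bigr],$$ where the limit that defines $u_P$ exists. **Theorem.** If $R$ is a $1$-universal forward estimator and the induced predictor $f_R$ is computable, then $f_R$ is a $1$-universal predictor. -/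

import Mathlib

namespace UniversalPrediction

open Filter Topology MeasureTheory

/-- Two-sided infinite sequences over the ordered alphabet `a₁ < ... < a_D`, modelled as `Fin D`. -/
abbrev BiSeq (D : ℕ) : Type := ℤ → Fin D

variable {D : ℕ}

/-- `block x j n` is the string `x_j x_{j+1} ... x_{j+n-1}` of length `n`. -/
def block (x : BiSeq D) (j : ℤ) (n : ℕ) : List (Fin D) :=
  (List.range n).map fun i => x (j + (i : ℤ))

/-- The shift `(x_i) ↦ (x_{i+1})`. -/
def shift (x : BiSeq D) : BiSeq D := fun i => x (i + 1)

/-- The set of points `x` with `x_{-|σ|+1} ... x_{|τ|} = στ`. -/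
def cylinder (σ τ : List (Fin D)) : Set (BiSeq D) :=
  {x | block x (-(σ.length : ℤ) + 1) (σ.length + τ.length) = σ ++ τ}

/-! ### Computability -/

/-- The rational number `(a - b) / (c + 1)` with code `(a, b, c)`; every rational has a code. -/
def ratOfCode (t : ℕ × ℕ × ℕ) : ℚ := ((t.1 : ℚ) - (t.2.1 : ℚ)) / ((t.2.2 : ℚ) + 1)

/-- `a ∈ W^s`, where `W` is a set of axioms `(w, a)`: the finite portion `w = s_{-k} ... s_k` of
the oracle `s` puts `a` into the enumerated set. -/
def OracleEnum {α : Type*} (W : List (Fin D) × α → Prop) (s : BiSeq D) (a : α) : Prop :=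
  ∃ k : ℕ, W (block s (-(k : ℤ)) (2 * k + 1), a)

/-- `A` is computably enumerable with oracle `s`: it is `W^s` for a c.e. set `W` of axioms. -/
def CEIn {α : Type*} [Primcodable α] (s : BiSeq D) (A : α → Prop) : Prop :=
  ∃ W : List (Fin D) × α → Prop, REPred W ∧ ∀ a, A a ↔ OracleEnum W s a

/-- `A s` is computably enumerable with oracle `s`, by one algorithm for all oracles `s`. -/
def UniformlyCE {α : Type*} [Primcodable α] (A : BiSeq D → α → Prop) : Prop :=
  ∃ W : List (Fin D) × α → Prop, REPred W ∧ ∀ s a, A s a ↔ OracleEnum W s a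

/-- A computable real function on a set of finite objects: rational lower bounds and rational upper
bounds of `f a` can be enumerated uniformly in `a`; equivalently, `f a` can be computed to any
prescribed precision. (For a single real this says exactly that its left cut is decidable. Demanding
a uniform decision of `q < f a`, also at `q = f a`, would leave some measures without any
representation.) -/
def ComputableReal {α : Type*} [Primcodable α] (f : α → ℝ) : Prop :=
  REPred (fun p : α × (ℕ × ℕ × ℕ) => (ratOfCode p.2 : ℝ) < f p.1) ∧
  REPred (fun p : α × (ℕ × ℕ × ℕ) => f p.1 < (ratOfCode p.2 : ℝ))

/-- A computable real function of a finite object `a` and an infinite sequence `s`: as above,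
by one algorithm that has the sequence `s` as an oracle. -/
def ComputableRealOracle {α : Type*} [Primcodable α] (f : α → BiSeq D → ℝ) : Prop :=
  UniformlyCE (fun s (p : α × (ℕ × ℕ × ℕ)) => (ratOfCode p.2 : ℝ) < f p.1 s) ∧
  UniformlyCE (fun s (p : α × (ℕ × ℕ × ℕ)) => f p.1 s < (ratOfCode p.2 : ℝ))

/-- A computable probability measure. -/
def ComputableMeasure (R : ProbabilityMeasure (BiSeq D)) : Prop :=
  ComputableReal fun p : List (Fin D) × List (Fin D) =>
    (R : Measure (BiSeq D)).real (cylinder p.1 p.2)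

/-- A representation function. -/
def IsRepresentationFunction (ρ : BiSeq D → ProbabilityMeasure (BiSeq D)) : Prop :=
  ComputableRealOracle fun (p : List (Fin D) × List (Fin D)) s =>
    (ρ s : Measure (BiSeq D)).real (cylinder p.1 p.2)

/-- The sequence `s` is a representation of the measure `P`. -/
def IsRepresentation (s : BiSeq D) (P : ProbabilityMeasure (BiSeq D)) : Prop :=
  ∃ ρ : BiSeq D → ProbabilityMeasure (BiSeq D), IsRepresentationFunction ρ ∧ ρ s = P

/-! ### Martin-Löf randomness -/

/-- The events `U 1, U 2, ...` are uniformly c.e. with oracle `s` (the index `0` is not used). -/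
def UniformlyCEEvents (s : BiSeq D) (U : ℕ → Set (BiSeq D)) : Prop :=
  ∃ V : ℕ → Set (List (Fin D) × List (Fin D)),
    (∀ i, 1 ≤ i → U i = {x | ∃ p ∈ V i, x ∈ cylinder p.1 p.2}) ∧
    CEIn s (fun q : ℕ × (List (Fin D) × List (Fin D)) => q.2 ∈ V q.1)

/-- Martin-Löf `(s, P)`-tests. -/
def IsMartinLofTest (s : BiSeq D) (P : ProbabilityMeasure (BiSeq D)) (U : ℕ → Set (BiSeq D)) : Prop :=
  UniformlyCEEvents s U ∧ ∀ n, 1 ≤ n → (P : Measure (BiSeq D)).real (U n) ≤ (2 : ℝ)⁻¹ ^ n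

/-- `1`-`(s, P)`-random points. -/
def IsOneRandomWith (s : BiSeq D) (P : ProbabilityMeasure (BiSeq D)) (x : BiSeq D) : Prop :=
  ∀ U : ℕ → Set (BiSeq D), IsMartinLofTest s P U → ¬ ∀ i, 1 ≤ i → x ∈ U i

/-- `1`-`P`-random points. -/
def IsOneRandom (P : ProbabilityMeasure (BiSeq D)) (x : BiSeq D) : Prop :=
  ∃ s : BiSeq D, IsRepresentation s P ∧ IsOneRandomWith s P x

/-! ### Estimation and prediction -/

/-- Stationary ergodic measures. -/
def StationaryErgodic (P : ProbabilityMeasure (BiSeq D)) : Prop :=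
  Ergodic (shift : BiSeq D → BiSeq D) (P : Measure (BiSeq D))

/-- The probability that the string `w` occurs at the positions `j, ..., j + |w| - 1`. -/
noncomputable def blockProb (P : ProbabilityMeasure (BiSeq D)) (j : ℤ) (w : List (Fin D)) : ℝ :=
  (P : Measure (BiSeq D)).real {x | block x j w.length = w}

/-- The conditional probability of the letter `a` at position `j + |w|`, given that `w` occurs at
the positions `j, ..., j + |w| - 1`; it is `0` if the condition has probability zero. -/
noncomputable def condProb (P : ProbabilityMeasure (BiSeq D)) (j : ℤ) (w : List (Fin D))
    (a : Fin D) : ℝ :=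
  blockProb P j (w ++ [a]) / blockProb P j w

/-- `R` is a `1`-universal forward estimator. -/
def IsOneUniversalForwardEstimator (R : ProbabilityMeasure (BiSeq D)) : Prop :=
  ComputableMeasure R ∧
  ∀ P : ProbabilityMeasure (BiSeq D), StationaryErgodic P → ∀ x : BiSeq D, IsOneRandom P x →
    Tendsto (fun n : ℕ => (1 / (n : ℝ)) * ∑ i ∈ Finset.range n, ∑ a : Fin D,
      |condProb R 1 (block x 1 i) a - condProb P 1 (block x 1 i) a|) atTop (𝓝 0)

/-- The least maximizer of `g`. -/
noncomputable def argmax [NeZero D] (g : Fin D → ℝ) : Fin D :=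
  open Classical in
  (Finset.univ.filter fun a => ∀ b, g b ≤ g a).min' (by
    obtain ⟨a, ha⟩ := Finite.exists_max g
    exact ⟨a, by simpa using ha⟩)

/-- The predictor induced by `R`. -/
noncomputable def inducedPredictor [NeZero D] (R : ProbabilityMeasure (BiSeq D)) :
    List (Fin D) → Fin D :=
  fun w => argmax (condProb R 1 w)

/-- `u` is the unpredictability rate of `P`, that is, the limit of the expectations of
`1 - max_a P(X_0 = a | X_{-n}, ..., X_{-1})`. -/
def IsUnpredictabilityRate (P : ProbabilityMeasure (BiSeq D)) (u : ℝ) : Prop :=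
  Tendsto (fun n : ℕ => ∫ x, (1 - ⨆ a : Fin D, condProb P (-(n : ℤ)) (block x (-(n : ℤ)) n) a)
    ∂(P : Measure (BiSeq D))) atTop (𝓝 u)

/-- `f` is a `1`-universal predictor; the existence of the unpredictability rate is included. -/
def IsOneUniversalPredictor (f : List (Fin D) → Fin D) : Prop :=
  Computable f ∧
  ∀ P : ProbabilityMeasure (BiSeq D), StationaryErgodic P →
    ∃ u : ℝ, IsUnpredictabilityRate P u ∧ ∀ x : BiSeq D, IsOneRandom P x →
      Tendsto (fun n : ℕ => (1 / (n : ℝ)) * ∑ i ∈ Finset.range n,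
        (if x ((i : ℤ) + 1) ≠ f (block x 1 i) then (1 : ℝ) else 0)) atTop (𝓝 u)

end UniversalPrediction

/-! ### Computably enumerable predicates -/

section REPred

variable {α β γ : Type*} [Primcodable α] [Primcodable β] [Primcodable γ]

/-! Write the error indicator at time `i` as `1 - max_a P(a ∣ x_1^i)`, plus the gap between this
maximum and the `P`-probability of the predicted letter, minus the excess of the actual hit over
that probability. The theorem follows once the averages of the three parts are known along a random
point.

The gap is at most twice the `ℓ¹` distance between the two conditional distributions, because the
predicted letter maximizes `R` (`maxCondProb_le_inducedPredictor_add`). Its average vanishes by the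
hypothesis on `R`, the only place where universality enters.

The excess is a bounded martingale difference. An exponential supermartingale bounds the probability
of a linear deviation geometrically, and for a computable predictor such deviations are enumerable
with the oracle, so they form a Martin-Löf test (`eventually_strSum_le`). Its average vanishes at
every random point.

The average of the maxima needs an effective form of Breiman's ergodic theorem. Given longer and
longer pasts the maximum converges almost surely, by Lévy's theorem, to some `G`; the claim is that
its averages along a random point converge to the mean of `G`. Levels of the maximum and of one
minus the maximum are enumerable, so a one-sided bound suffices: a random orbit visits an enumerable
open set with asymptotic frequency at most its probability (`eventually_frequency_le`). By the
maximal ergodic theorem the points whose visit frequency ever exceeds a larger bound form an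
enumerable open set of probability below one.

It remains that a random orbit leaves every enumerable open set `U` of probability below one
(`exists_iterate_notMem`). Cauchy-Schwarz and the mean ergodic theorem show that, given a finite
window, a long stay in `U` has conditional probability below some `r < 1` that does not depend on
the window. A suitable length of the stay can be found by enumeration. Iterating the refinement
yields a test whose levels have probability at most `r ^ m`. -/

theorem REPred.exists_primrec {p : α → Prop} (hp : REPred p) :
    ∃ b : α × ℕ → Bool, Primrec b ∧ ∀ a, p a ↔ ∃ n, b (a, n) = true := by
  obtain ⟨c, hc⟩ := Nat.Partrec.Code.exists_code.1 hp
  refine ⟨fun q => (Nat.Partrec.Code.evaln q.2 c (Encodable.encode q.1)).isSome, ?_, ?_⟩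
  · exact Primrec.option_isSome.comp (Nat.Partrec.Code.primrec_evaln.comp
      (Primrec.pair (Primrec.pair Primrec.snd (Primrec.const c))
        (Primrec.encode.comp Primrec.fst)))
  · intro a
    have h1 : p a ↔ (Nat.Partrec.Code.eval c (Encodable.encode a)).Dom := by
      rw [hc]; simp [Part.assert]
    rw [h1, Part.dom_iff_mem]
    constructor
    · rintro ⟨y, hy⟩
      obtain ⟨k, hk⟩ := Nat.Partrec.Code.evaln_complete.1 hy
      exact ⟨k, by simpa using Option.isSome_iff_exists.2 ⟨y, hk⟩⟩
    · rintro ⟨k, hk⟩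
      obtain ⟨y, hy⟩ := Option.isSome_iff_exists.1 hk
      exact ⟨y, Nat.Partrec.Code.evaln_complete.2 ⟨k, hy⟩⟩

/-- Unbounded search. Together with `REPred.exists_primrec` this is the normal form of an enumerable
predicate, and the closure properties below only have to recode the witness `n`. -/
theorem REPred.of_exists_computable {b : α × ℕ → Bool} (hb : Computable b) :
    REPred fun a => ∃ n, b (a, n) = true := by
  have h : Partrec fun a => Nat.rfind fun n => (Part.some (b (a, n)) : Part Bool) :=
    Partrec.rfind (Computable.partrec hb).to₂
  refine h.dom_re.of_eq fun a => ?_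
  refine (Nat.rfind_dom (p := fun n => Part.some (b (a, n)))).trans ?_
  constructor
  · rintro ⟨n, hn, -⟩
    exact ⟨n, (Part.mem_some_iff.1 hn).symm⟩
  · rintro ⟨n, hn⟩
    exact ⟨n, Part.mem_some_iff.2 hn.symm, fun _ => trivial⟩

theorem REPred.comp {p : β → Prop} (hp : REPred p) {f : α → β} (hf : Computable f) :
    REPred fun a => p (f a) := by
  obtain ⟨b, hb, h⟩ := hp.exists_primrec
  refine (REPred.of_exists_computable (b := fun q : α × ℕ => b (f q.1, q.2)) ?_).of_eq
    fun a => (h (f a)).symm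
  exact hb.to_comp.comp ((hf.comp Computable.fst).pair Computable.snd)

theorem REPred.and {p q : α → Prop} (hp : REPred p) (hq : REPred q) :
    REPred fun a => p a ∧ q a := by
  obtain ⟨b, hb, h⟩ := hp.exists_primrec
  obtain ⟨c, hc, h'⟩ := hq.exists_primrec
  refine (REPred.of_exists_computable
    (b := fun r : α × ℕ => b (r.1, r.2.unpair.1) && c (r.1, r.2.unpair.2)) ?_).of_eq fun a => ?_
  · have hu : Primrec fun r : α × ℕ => r.2.unpair := Primrec.unpair.comp Primrec.snd
    exact (Primrec.and.comp (hb.comp (Primrec.fst.pair (Primrec.fst.comp hu)))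
      (hc.comp (Primrec.fst.pair (Primrec.snd.comp hu)))).to_comp
  · rw [h, h']
    constructor
    · rintro ⟨n, hn⟩
      simp only [Bool.and_eq_true] at hn
      exact ⟨⟨_, hn.1⟩, ⟨_, hn.2⟩⟩
    · rintro ⟨⟨m, hm⟩, ⟨n, hn⟩⟩
      exact ⟨Nat.pair m n, by simp [hm, hn]⟩

theorem REPred.ex {p : α × β → Prop} (hp : REPred p) : REPred fun a => ∃ b, p (a, b) := by
  obtain ⟨c, hc, h⟩ := hp.exists_primrec
  refine (REPred.of_exists_computable (b := fun r : α × ℕ =>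
    ((Encodable.decode (α := β) r.2.unpair.1).map fun x => c ((r.1, x), r.2.unpair.2)).getD
      false) ?_).of_eq fun a => ?_
  · have hu : Primrec fun r : α × ℕ => r.2.unpair := Primrec.unpair.comp Primrec.snd
    refine (Primrec.option_getD.comp (Primrec.option_map
      (Primrec.decode.comp (Primrec.fst.comp hu)) ?_) (Primrec.const false)).to_comp
    exact hc.comp (((Primrec.fst.comp Primrec.fst).pair Primrec.snd).pair
      (Primrec.snd.comp (hu.comp Primrec.fst)))
  · constructor
    · rintro ⟨n, hn⟩
      rcases hd : Encodable.decode (α := β) n.unpair.1 with _ | x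
      · simp [hd] at hn
      · simp only [hd, Option.map_some, Option.getD_some] at hn
        exact ⟨x, (h _).2 ⟨_, hn⟩⟩
    · rintro ⟨x, hx⟩
      obtain ⟨n, hn⟩ := (h _).1 hx
      exact ⟨Nat.pair (Encodable.encode x) n, by simp [hn]⟩

theorem REPred.or {p q : α → Prop} (hp : REPred p) (hq : REPred q) :
    REPred fun a => p a ∨ q a := by
  obtain ⟨b, hb, h⟩ := hp.exists_primrec
  obtain ⟨c, hc, h'⟩ := hq.exists_primrec
  refine (REPred.of_exists_computable (b := fun r : α × ℕ => b r || c r)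
    (Primrec.or.comp hb hc).to_comp).of_eq fun a => ?_
  rw [h, h']
  simp [exists_or]

/-- A chain is certified by the list of its vertices, each with a stage at which the step to it is
confirmed; a fold checks the certificate. Reachability replaces recursion from here on: bounded
quantifiers, sums and counters are all expressed by chains. -/
theorem REPred.reflTransGen {R : α × (β × β) → Prop} (hR : REPred R) :
    REPred fun q : α × (β × β) =>
      Relation.ReflTransGen (fun x y => R (q.1, (x, y))) q.2.1 q.2.2 := by
  obtain ⟨c, hc, h⟩ := hR.exists_primrec
  let step : α → Option β × (β × ℕ) → Option β := fun a r =>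
    r.1.bind fun x => if c ((a, (x, r.2.1)), r.2.2) = true then some r.2.1 else none
  have hstep : Primrec₂ step := by
    refine Primrec.option_bind (Primrec.fst.comp Primrec.snd) ?_
    have h1 : Primrec fun z : (α × (Option β × (β × ℕ))) × β =>
        c ((z.1.1, (z.2, z.1.2.2.1)), z.1.2.2.2) :=
      hc.comp (((Primrec.fst.comp Primrec.fst).pair (Primrec.snd.pair
        (Primrec.fst.comp (Primrec.snd.comp (Primrec.snd.comp Primrec.fst))))).pair
        (Primrec.snd.comp (Primrec.snd.comp (Primrec.snd.comp Primrec.fst))))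
    exact Primrec.ite (Primrec.eq.comp h1 (Primrec.const true)) (Primrec.option_some.comp
      (Primrec.fst.comp (Primrec.snd.comp (Primrec.snd.comp Primrec.fst)))) (Primrec.const none)
  have key : ∀ (a : α) (x y : β), Relation.ReflTransGen (fun x y => R (a, (x, y))) x y ↔
      ∃ L : List (β × ℕ), L.foldl (fun o r => step a (o, r)) (some x) = some y := by
    intro a x y
    constructor
    · intro hxy
      induction hxy with
      | refl => exact ⟨[], rfl⟩
      | @tail y z _ hyz ih =>
        obtain ⟨L, hL⟩ := ih
        obtain ⟨n, hn⟩ := (h _).1 hyz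
        exact ⟨L ++ [(z, n)], by simp [List.foldl_append, hL, step, hn]⟩
    · rintro ⟨L, hL⟩
      induction L using List.reverseRecOn generalizing y with
      | nil =>
        obtain rfl : x = y := by simpa using hL
        exact .refl
      | append_singleton L r ih =>
        rw [List.foldl_append] at hL
        rcases ho : L.foldl (fun o r => step a (o, r)) (some x) with _ | z
        · simp [ho, step] at hL
        · simp only [ho, List.foldl_cons, List.foldl_nil, step, Option.bind_some] at hL
          split_ifs at hL with hz
          obtain rfl : r.1 = y := by simpa using hL
          exact (ih z ho).tail ((h _).2 ⟨_, hz⟩)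
  have hdec : PrimrecPred fun z : (α × (β × β)) × List (β × ℕ) =>
      z.2.foldl (fun o r => step z.1.1 (o, r)) (some z.1.2.1) = some z.1.2.2 := by
    refine Primrec.eq.comp (Primrec.list_foldl Primrec.snd (Primrec.option_some.comp
      (Primrec.fst.comp (Primrec.snd.comp Primrec.fst))) ?_) (Primrec.option_some.comp
      (Primrec.snd.comp (Primrec.snd.comp Primrec.fst)))
    exact hstep.comp (Primrec.fst.comp (Primrec.fst.comp Primrec.fst)) Primrec.snd
  exact (REPred.ex hdec.computablePred.to_re).of_eq fun q => (key q.1 q.2.1 q.2.2).symm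

end REPred

namespace UniversalPrediction

open Filter Topology MeasureTheory

variable {D : ℕ}

/-! ### Blocks of two-sided sequences and the shift. -/

theorem block_eq_map (x : BiSeq D) (j : ℤ) (n : ℕ) :
    block x j n = (List.range n).map fun i : ℕ => x (j + (i : ℤ)) := by
  simp [block, ← List.map_eq_flatMap, List.map_map, Function.comp_def]

@[simp] theorem length_block (x : BiSeq D) (j : ℤ) (n : ℕ) : (block x j n).length = n := by
  simp [block_eq_map]

theorem block_add (x : BiSeq D) (j : ℤ) (m n : ℕ) :
    block x j (m + n) = block x j m ++ block x (j + m) n := by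
  simp only [block_eq_map, List.range_add, List.map_append, List.map_map]
  congr 1
  refine List.map_congr_left fun i _ => ?_
  simp [Function.comp, add_assoc]

@[simp] theorem block_zero (x : BiSeq D) (j : ℤ) : block x j 0 = [] := rfl

theorem block_succ (x : BiSeq D) (j : ℤ) (n : ℕ) :
    block x j (n + 1) = block x j n ++ [x (j + n)] := by
  rw [block_add]; simp [block_eq_map]

theorem iterate_shift (x : BiSeq D) (n : ℕ) (i : ℤ) : shift^[n] x i = x (i + n) := by
  induction n generalizing x with
  | zero => simp
  | succ n ih => rw [Function.iterate_succ_apply, ih]; simp [shift]; congr 1; ring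

theorem block_iterate_shift (x : BiSeq D) (n : ℕ) (j : ℤ) (m : ℕ) :
    block (shift^[n] x) j m = block x (j + n) m := by
  simp only [block_eq_map]
  refine List.map_congr_left fun i _ => ?_
  rw [iterate_shift]; congr 1; ring

/-- The parts of a block are blocks. -/
theorem block_eq_append_iff (x : BiSeq D) (j : ℤ) (n : ℕ) (l u r : List (Fin D))
    (hn : l.length + (u.length + r.length) = n) :
    block x j n = l ++ (u ++ r) ↔ block x j l.length = l ∧
      block x (j + l.length) u.length = u ∧
        block x (j + l.length + u.length) r.length = r := by
  rw [← hn, block_add, block_add]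
  constructor
  · intro h
    obtain ⟨h1, h2⟩ := List.append_inj h (by simp)
    obtain ⟨h2, h3⟩ := List.append_inj h2 (by simp)
    exact ⟨h1, h2, h3⟩
  · rintro ⟨h1, h2, h3⟩
    rw [h1, h2, h3]

theorem exists_block_eq_append (x : BiSeq D) (j : ℤ) (n k m : ℕ) (h : k + m ≤ n) :
    ∃ l r, block x j n = l ++ (block x (j + k) m ++ r) ∧ l.length = k ∧
      l.length + (m + r.length) = n := by
  refine ⟨block x j k, block x (j + k + m) (n - k - m), ?_, by simp, by simp; omega⟩
  rw [← block_add, ← block_add]; congr 1; omega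

/-! ### The central part of a string -/

/-- `u` is what remains of `v` when equally long strings are deleted at both ends. -/
def IsCentral {α : Type*} (u v : List α) : Prop :=
  ∃ l r : List α, v = l ++ (u ++ r) ∧ l.length = r.length

theorem isCentral_block_iff (s : BiSeq D) (j : ℤ) (n : ℕ) (u : List (Fin D)) :
    IsCentral u (block s j n) ↔ ∃ k : ℕ, u.length + 2 * k = n ∧
      u = block s (j + k) u.length := by
  constructor
  · rintro ⟨l, r, h, hlr⟩
    have hlen := congrArg List.length h
    simp only [length_block, List.length_append] at hlen
    refine ⟨l.length, by omega, ?_⟩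
    exact ((block_eq_append_iff s j n l u r hlen.symm).1 h).2.1.symm
  · rintro ⟨k, hk, hu⟩
    obtain ⟨l, r, h, hl, hr⟩ := exists_block_eq_append s j n k u.length (by omega)
    exact ⟨l, r, by rw [h, ← hu], by omega⟩

theorem IsCentral.refl {α : Type*} (u : List α) : IsCentral u u := ⟨[], [], by simp, rfl⟩

theorem rePred_isCentral : REPred fun q : List (Fin D) × List (Fin D) => IsCentral q.1 q.2 := by
  have h : PrimrecPred fun z : ((List (Fin D) × List (Fin D)) × List (Fin D)) × List (Fin D) =>
      z.1.1.2 = z.1.2 ++ (z.1.1.1 ++ z.2) ∧ z.1.2.length = z.2.length := by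
    refine PrimrecPred.and ?_ ?_
    · exact Primrec.eq.comp (Primrec.snd.comp (Primrec.fst.comp Primrec.fst))
        (Primrec.list_append.comp (Primrec.snd.comp Primrec.fst) (Primrec.list_append.comp
          (Primrec.fst.comp (Primrec.fst.comp Primrec.fst)) Primrec.snd))
    · exact Primrec.eq.comp (Primrec.list_length.comp (Primrec.snd.comp Primrec.fst))
        (Primrec.list_length.comp Primrec.snd)
  exact h.computablePred.to_re.ex.ex

/-- The portion of the oracle `s` at the positions `-k, ..., k`. -/
abbrev seg (s : BiSeq D) (k : ℕ) : List (Fin D) := block s (-(k : ℤ)) (2 * k + 1)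

/-- Deleting equally long ends preserves the parity of the length, so a central part of the odd
string `seg s k` is again a segment around the origin and never empty. -/
theorem isCentral_seg_iff (s : BiSeq D) (k : ℕ) (u : List (Fin D)) :
    IsCentral u (seg s k) ↔ ∃ k' ≤ k, u = seg s k' := by
  rw [seg, isCentral_block_iff]
  constructor
  · rintro ⟨m, hm, hu⟩
    refine ⟨k - m, by omega, ?_⟩
    have h1 : u.length = 2 * (k - m) + 1 := by omega
    rw [seg, ← h1]
    convert hu using 2
    omega
  · rintro ⟨k', hk', rfl⟩
    refine ⟨k - k', by simp; omega, ?_⟩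
    simp only [seg, length_block]
    congr 1
    push_cast [Nat.cast_sub hk']
    ring

/-! ### Enumerability with an oracle -/

section CEIn

variable {α β : Type*} [Primcodable α] [Primcodable β] {s : BiSeq D}

/-- The axioms can be chosen such that longer portions of the oracle enumerate more. -/
theorem CEIn.exists_mono {A : α → Prop} (hA : CEIn s A) :
    ∃ W : List (Fin D) × α → Prop, REPred W ∧ (∀ a, A a ↔ ∃ k, W (seg s k, a)) ∧
      ∀ k k' a, k ≤ k' → W (seg s k, a) → W (seg s k', a) := by
  obtain ⟨W, hW, h⟩ := hA
  -- The new axioms accept a string as soon as some central part of it is an old axiom.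
  refine ⟨fun q => ∃ u, IsCentral u q.1 ∧ W (u, q.2), ?_, ?_, ?_⟩
  · exact REPred.ex (p := fun z : (List (Fin D) × α) × List (Fin D) =>
      IsCentral z.2 z.1.1 ∧ W (z.2, z.1.2))
      ((rePred_isCentral.comp (Computable.snd.pair (Computable.fst.comp Computable.fst))).and
        (hW.comp (Computable.snd.pair (Computable.snd.comp Computable.fst))))
  · intro a
    rw [h]
    constructor
    · rintro ⟨k, hk⟩
      exact ⟨k, seg s k, IsCentral.refl _, hk⟩
    · rintro ⟨k, u, hu, hW⟩
      obtain ⟨k', -, rfl⟩ := (isCentral_seg_iff s k u).1 hu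
      exact ⟨k', hW⟩
  · rintro k k' a hk ⟨u, hu, hW⟩
    obtain ⟨m, hm, rfl⟩ := (isCentral_seg_iff s k u).1 hu
    exact ⟨_, (isCentral_seg_iff s k' _).2 ⟨m, hm.trans hk, rfl⟩, hW⟩

theorem CEIn.of_iff {A B : α → Prop} (hA : CEIn s A) (h : ∀ a, A a ↔ B a) : CEIn s B := by
  obtain ⟨W, hW, h'⟩ := hA
  exact ⟨W, hW, fun a => (h a).symm.trans (h' a)⟩

theorem CEIn.of_rePred {A : α → Prop} (hA : REPred A) : CEIn s A :=
  ⟨fun q => A q.2, hA.comp Computable.snd, fun _ => ⟨fun h => ⟨0, h⟩, fun ⟨_, h⟩ => h⟩⟩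

theorem CEIn.of_primrecPred {A : α → Prop} (hA : PrimrecPred A) : CEIn s A :=
  .of_rePred hA.computablePred.to_re

theorem CEIn.comp {A : β → Prop} (hA : CEIn s A) {f : α → β} (hf : Computable f) :
    CEIn s fun a => A (f a) := by
  obtain ⟨W, hW, h⟩ := hA
  exact ⟨fun q => W (q.1, f q.2), hW.comp (Computable.fst.pair (hf.comp Computable.snd)),
    fun a => h (f a)⟩

theorem CEIn.and {A B : α → Prop} (hA : CEIn s A) (hB : CEIn s B) :
    CEIn s fun a => A a ∧ B a := by
  obtain ⟨W, hW, h, hm⟩ := hA.exists_mono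
  obtain ⟨W', hW', h', hm'⟩ := hB.exists_mono
  refine ⟨fun q => W q ∧ W' q, hW.and hW', fun a => ?_⟩
  simp only [h, h']
  constructor
  · rintro ⟨⟨k, hk⟩, ⟨k', hk'⟩⟩
    exact ⟨max k k', hm _ _ _ (le_max_left _ _) hk, hm' _ _ _ (le_max_right _ _) hk'⟩
  · rintro ⟨k, hk, hk'⟩
    exact ⟨⟨k, hk⟩, ⟨k, hk'⟩⟩

theorem CEIn.or {A B : α → Prop} (hA : CEIn s A) (hB : CEIn s B) :
    CEIn s fun a => A a ∨ B a := by
  obtain ⟨W, hW, h⟩ := hA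
  obtain ⟨W', hW', h'⟩ := hB
  refine ⟨fun q => W q ∨ W' q, hW.or hW', fun a => ?_⟩
  simp only [h, h']
  exact exists_or.symm

theorem CEIn.ex {A : α × β → Prop} (hA : CEIn s A) : CEIn s fun a => ∃ b, A (a, b) := by
  obtain ⟨W, hW, h⟩ := hA
  refine ⟨fun q => ∃ b, W (q.1, (q.2, b)), ?_, fun a => ?_⟩
  · exact REPred.ex (p := fun z : (List (Fin D) × α) × β => W (z.1.1, (z.1.2, z.2)))
      (hW.comp ((Computable.fst.comp Computable.fst).pair
        ((Computable.snd.comp Computable.fst).pair Computable.snd)))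
  · simp only [h, OracleEnum]
    exact exists_comm

/-- A chain consults finitely many segments of the oracle; by monotonicity the longest of them
serves all steps, which reduces the claim to `REPred.reflTransGen` with the segment as a parameter.
-/
theorem CEIn.reflTransGen {R : α × (β × β) → Prop} (hR : CEIn s R) :
    CEIn s fun q : α × (β × β) =>
      Relation.ReflTransGen (fun x y => R (q.1, (x, y))) q.2.1 q.2.2 := by
  obtain ⟨W, hW, h, hm⟩ := hR.exists_mono
  have h1 : REPred fun z : (List (Fin D) × α) × (β × β) => W (z.1.1, (z.1.2, z.2)) :=
    hW.comp ((Computable.fst.comp Computable.fst).pair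
        ((Computable.snd.comp Computable.fst).pair Computable.snd))
  refine ⟨_, h1.reflTransGen.comp (f := fun z : List (Fin D) × (α × (β × β)) =>
    ((z.1, z.2.1), z.2.2)) ((Computable.fst.pair (Computable.fst.comp Computable.snd)).pair
      (Computable.snd.comp Computable.snd)), ?_⟩
  rintro ⟨a, x, y⟩
  constructor
  · intro hxy
    dsimp only at hxy
    induction hxy with
    | refl => exact ⟨0, .refl⟩
    | tail _ hyz ih =>
      obtain ⟨k, hk⟩ := ih
      obtain ⟨k', hk'⟩ := (h _).1 hyz
      refine ⟨max k k', Relation.ReflTransGen.tail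
        (Relation.ReflTransGen.mono (fun u v huv => ?_) _ _ hk) (hm _ _ _ (le_max_right _ _) hk')⟩
      exact hm _ _ _ (le_max_left _ _) huv
  · rintro ⟨k, hk⟩
    exact Relation.ReflTransGen.mono (fun u v huv => (h _).2 ⟨k, huv⟩) _ _ hk

/-- A bounded universal quantifier is a chain of successor steps, each of which checks one instance.
This is how `CEIn.forall_lt` becomes a case of `CEIn.reflTransGen`. -/
theorem reflTransGen_count_iff {p : ℕ → Prop} (n : ℕ) :
    Relation.ReflTransGen (fun x y : ℕ => y = x + 1 ∧ p x) 0 n ↔ ∀ i < n, p i := by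
  constructor
  · intro h
    induction h with
    | refl => simp
    | tail _ hyz ih =>
      obtain ⟨rfl, hp⟩ := hyz
      intro i hi
      rcases Nat.lt_succ_iff_lt_or_eq.1 hi with hi | rfl
      exacts [ih i hi, hp]
  · intro h
    induction n with
    | zero => exact .refl
    | succ n ih => exact (ih fun i hi => h i (by omega)).tail ⟨rfl, h n (by omega)⟩

theorem CEIn.forall_lt {A : α × ℕ → Prop} (hA : CEIn s A) :
    CEIn s fun q : α × ℕ => ∀ i < q.2, A (q.1, i) := by
  have h1 : CEIn s fun z : α × (ℕ × ℕ) => z.2.2 = z.2.1 + 1 ∧ A (z.1, z.2.1) := by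
    refine .and (.of_primrecPred ?_) (hA.comp
      (Computable.fst.pair (Computable.fst.comp Computable.snd)))
    exact Primrec.eq.comp (Primrec.snd.comp Primrec.snd)
      (Primrec.succ.comp (Primrec.fst.comp Primrec.snd))
  refine (h1.reflTransGen.comp (f := fun q : α × ℕ => (q.1, ((0 : ℕ), q.2)))
    (Computable.fst.pair ((Computable.const 0).pair Computable.snd))).of_iff fun q => ?_
  exact reflTransGen_count_iff (p := fun i => A (q.1, i)) q.2

/-- Enumeration in stages that can be decided with the oracle. -/
theorem CEIn.exists_stage {A : α → Prop} (hA : CEIn s A) :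
    ∃ S : α × ℕ → Prop, CEIn s S ∧ CEIn s (fun q => ¬ S q) ∧ ∀ a, A a ↔ ∃ t, S (a, t) := by
  obtain ⟨W, hW, h⟩ := hA
  obtain ⟨b, hb, hb'⟩ := hW.exists_primrec
  have hu : Primrec fun z : List (Fin D) × (α × ℕ) => z.2.2.unpair :=
    Primrec.unpair.comp (Primrec.snd.comp Primrec.snd)
  have hbz : Primrec fun z : List (Fin D) × (α × ℕ) => b ((z.1, z.2.1), z.2.2.unpair.2) :=
    hb.comp ((Primrec.fst.pair (Primrec.fst.comp Primrec.snd)).pair (Primrec.snd.comp hu))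
  have hlen : PrimrecPred fun z : List (Fin D) × (α × ℕ) =>
      z.1.length = 2 * z.2.2.unpair.1 + 1 :=
    Primrec.eq.comp (Primrec.list_length.comp Primrec.fst)
      (Primrec.succ.comp (Primrec.nat_mul.comp (Primrec.const 2) (Primrec.fst.comp hu)))
  -- A stage `t` codes the radius of an oracle segment and a search bound. The length condition pins
  -- down which segment is read, so the outcomes `true` and `false` are both enumerable.
  have key : ∀ (c : Bool), CEIn s fun q : α × ℕ =>
      b ((seg s q.2.unpair.1, q.1), q.2.unpair.2) = c := by
    intro c
    refine ⟨fun z => z.1.length = 2 * z.2.2.unpair.1 + 1 ∧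
      b ((z.1, z.2.1), z.2.2.unpair.2) = c, ?_, ?_⟩
    · exact (hlen.and (Primrec.eq.comp hbz (Primrec.const c))).computablePred.to_re
    · rintro ⟨a, t⟩
      constructor
      · intro ht
        exact ⟨t.unpair.1, by simp, ht⟩
      · rintro ⟨k, hk, ht⟩
        obtain rfl : k = t.unpair.1 := by simp at hk; omega
        exact ht
  refine ⟨_, key true, (key false).of_iff fun q => by simp, fun a => ?_⟩
  rw [h]
  constructor
  · rintro ⟨k, hk⟩
    obtain ⟨n, hn⟩ := (hb' _).1 hk
    exact ⟨Nat.pair k n, by simpa using hn⟩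
  · rintro ⟨t, ht⟩
    exact ⟨_, (hb' _).2 ⟨_, ht⟩⟩

/-- Uniformization: from an enumerable relation one can select an enumerable function. -/
theorem CEIn.exists_uniformization {R : α × ℕ → Prop} (hR : CEIn s R) :
    ∃ F : α × ℕ → Prop, CEIn s F ∧ (∀ q, F q → R q) ∧
      (∀ a m n, F (a, m) → F (a, n) → m = n) ∧ ∀ a, (∃ n, R (a, n)) → ∃ n, F (a, n) := by
  obtain ⟨S, hS, hS', h⟩ := hR.exists_stage
  let g : α × ℕ → (α × ℕ) × ℕ := fun q => ((q.1, q.2.unpair.1), q.2.unpair.2)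
  have hg : Computable g := by
    have hu : Primrec fun z : α × ℕ => z.2.unpair := Primrec.unpair.comp Primrec.snd
    exact ((Primrec.fst.pair (Primrec.fst.comp hu)).pair (Primrec.snd.comp hu)).to_comp
  have hneg : CEIn s fun q : α × ℕ => ∀ i < q.2, ¬ S (g (q.1, i)) :=
    CEIn.forall_lt (A := fun q => ¬ S (g q)) (hS'.comp hg)
  -- The selected value belongs to the least code `t` of a value and a stage that succeeds.
  -- Minimality is enumerable because the stages are decidable with the oracle.
  let F : α × ℕ → Prop := fun q => ∃ t : ℕ,
    (S (g (q.1, t)) ∧ (∀ i < t, ¬ S (g (q.1, i)))) ∧ q.2 = t.unpair.1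
  refine ⟨F, ?_, ?_, ?_, ?_⟩
  · refine CEIn.ex (A := fun z : (α × ℕ) × ℕ => (S (g (z.1.1, z.2)) ∧
      (∀ i < z.2, ¬ S (g (z.1.1, i)))) ∧ z.1.2 = z.2.unpair.1) (.and (.and ?_ ?_) ?_)
    · exact hS.comp (hg.comp ((Computable.fst.comp Computable.fst).pair Computable.snd))
    · exact hneg.comp (f := fun z : (α × ℕ) × ℕ => (z.1.1, z.2))
        ((Computable.fst.comp Computable.fst).pair Computable.snd)
    · exact .of_primrecPred (Primrec.eq.comp (Primrec.snd.comp Primrec.fst)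
        (Primrec.fst.comp (Primrec.unpair.comp Primrec.snd)))
  · rintro ⟨a, n⟩ ⟨t, ⟨ht, -⟩, rfl⟩
    exact (h _).2 ⟨_, ht⟩
  · rintro a m n ⟨t, ⟨ht, ht'⟩, rfl⟩ ⟨t', ⟨hs, hs'⟩, rfl⟩
    rcases lt_trichotomy t t' with hlt | rfl | hlt
    · exact absurd ht (hs' t hlt)
    · rfl
    · exact absurd hs (ht' t' hlt)
  · rintro a ⟨n, hn⟩
    obtain ⟨t, ht⟩ := (h _).1 hn
    classical
    have hex : ∃ t, S (g (a, t)) := ⟨Nat.pair n t, by simpa [g] using ht⟩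
    exact ⟨_, Nat.find hex, ⟨Nat.find_spec hex, fun i hi => Nat.find_min hex hi⟩, rfl⟩

end CEIn

/-! ### Enumerable comparisons of block probabilities -/

theorem blockProb_nonneg (P : ProbabilityMeasure (BiSeq D)) (j : ℤ) (w : List (Fin D)) :
    0 ≤ blockProb P j w := measureReal_nonneg

theorem blockProb_le_one (P : ProbabilityMeasure (BiSeq D)) (j : ℤ) (w : List (Fin D)) :
    blockProb P j w ≤ 1 := measureReal_le_one

theorem cylinder_nil_left (w : List (Fin D)) : cylinder [] w = {x | block x 1 w.length = w} := by
  simp [cylinder]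

section Comparisons

variable {α β : Type*} [Primcodable α] [Primcodable β] {s : BiSeq D}
  {P : ProbabilityMeasure (BiSeq D)}

/-- Comparison with the fraction `A / B`, whose code is `(A, 0, B - 1)`, with the denominator
cleared. For `B = 0` the inequality fails and the code would be wrong, hence the extra condition `0
< B`. -/
theorem IsRepresentation.ceIn_nat_lt_mul (hs : IsRepresentation s P) :
    CEIn s fun q : (ℕ × ℕ) × List (Fin D) => (q.1.1 : ℝ) < q.1.2 * blockProb P 1 q.2 := by
  obtain ⟨ρ, ⟨⟨W, hW, h⟩, -⟩, rfl⟩ := hs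
  have h0 : CEIn s fun p : (List (Fin D) × List (Fin D)) × (ℕ × ℕ × ℕ) =>
    (ratOfCode p.2 : ℝ) < (ρ s : Measure (BiSeq D)).real (cylinder p.1.1 p.1.2) := ⟨W, hW, h s⟩
  have h1 := h0.comp (f := fun q : (ℕ × ℕ) × List (Fin D) =>
    ((([] : List (Fin D)), q.2), (q.1.1, 0, q.1.2 - 1)))
    (((Primrec.const []).pair Primrec.snd).pair ((Primrec.fst.comp Primrec.fst).pair
      ((Primrec.const 0).pair (Primrec.nat_sub.comp (Primrec.snd.comp Primrec.fst)
        (Primrec.const 1))))).to_comp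
  have h2 : PrimrecPred fun q : (ℕ × ℕ) × List (Fin D) => 0 < q.1.2 :=
    Primrec.nat_lt.comp (Primrec.const 0) (Primrec.snd.comp Primrec.fst)
  refine (CEIn.and (.of_primrecPred h2) h1).of_iff ?_
  rintro ⟨⟨A, B⟩, w⟩
  simp only [cylinder_nil_left, ratOfCode, blockProb]
  rcases B with _ | B
  · simp
  · simp only [Nat.zero_lt_succ, true_and, Nat.add_sub_cancel]
    push_cast
    rw [sub_zero, div_lt_iff₀ (by positivity), mul_comm]

theorem IsRepresentation.ceIn_mul_lt_nat (hs : IsRepresentation s P) :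
    CEIn s fun q : (ℕ × ℕ) × List (Fin D) => (q.1.2 : ℝ) * blockProb P 1 q.2 < q.1.1 := by
  obtain ⟨ρ, ⟨-, ⟨W, hW, h⟩⟩, rfl⟩ := hs
  have h0 : CEIn s fun p : (List (Fin D) × List (Fin D)) × (ℕ × ℕ × ℕ) =>
    (ρ s : Measure (BiSeq D)).real (cylinder p.1.1 p.1.2) < (ratOfCode p.2 : ℝ) := ⟨W, hW, h s⟩
  have h1 := h0.comp (f := fun q : (ℕ × ℕ) × List (Fin D) =>
    ((([] : List (Fin D)), q.2), (q.1.1, 0, q.1.2 - 1)))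
    (((Primrec.const []).pair Primrec.snd).pair ((Primrec.fst.comp Primrec.fst).pair
      ((Primrec.const 0).pair (Primrec.nat_sub.comp (Primrec.snd.comp Primrec.fst)
        (Primrec.const 1))))).to_comp
  have h2 : PrimrecPred fun q : (ℕ × ℕ) × List (Fin D) => 0 < q.1.2 :=
    Primrec.nat_lt.comp (Primrec.const 0) (Primrec.snd.comp Primrec.fst)
  have h3 : PrimrecPred fun q : (ℕ × ℕ) × List (Fin D) => q.1.2 = 0 ∧ 0 < q.1.1 :=
    (Primrec.eq.comp (Primrec.snd.comp Primrec.fst) (Primrec.const 0)).and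
      (Primrec.nat_lt.comp (Primrec.const 0) (Primrec.fst.comp Primrec.fst))
  refine (CEIn.or (.of_primrecPred h3) (CEIn.and (.of_primrecPred h2) h1)).of_iff ?_
  rintro ⟨⟨A, B⟩, w⟩
  simp only [cylinder_nil_left, ratOfCode, blockProb]
  rcases B with _ | B
  · simp
  · simp only [Nat.zero_lt_succ, true_and, Nat.add_sub_cancel, Nat.succ_ne_zero, false_and,
      false_or]
    push_cast
    rw [sub_zero, lt_div_iff₀ (by positivity), mul_comm]

theorem exists_nat_lt_ge_sub_one {r : ℝ} (hr : 0 < r) : ∃ y : ℕ, (y : ℝ) < r ∧ r - 1 ≤ y := by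
  refine ⟨⌈r⌉₊ - 1, ?_, ?_⟩
  · have h := Nat.ceil_lt_add_one hr.le
    have h' : 1 ≤ ⌈r⌉₊ := Nat.one_le_iff_ne_zero.2 (Nat.ceil_pos.2 hr).ne'
    push_cast [Nat.cast_sub h']
    linarith
  · have h := Nat.le_ceil r
    have h' : 1 ≤ ⌈r⌉₊ := Nat.one_le_iff_ne_zero.2 (Nat.ceil_pos.2 hr).ne'
    push_cast [Nat.cast_sub h']
    linarith

theorem exists_nat_gt_le_add_one {r : ℝ} (hr : 0 ≤ r) : ∃ y : ℕ, r < y ∧ (y : ℝ) ≤ r + 1 :=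
  ⟨⌊r⌋₊ + 1, by exact_mod_cast Nat.lt_floor_add_one r,
    by push_cast; linarith [Nat.floor_le hr]⟩

/-- To confirm `A p < B q`, search for a scale `c` and integers `x > c p` and `y < c q` with `A x ≤
B y`. Such comparisons express bounds of conditional probabilities without division. -/
theorem IsRepresentation.ceIn_mul_lt_mul (hs : IsRepresentation s P) :
    CEIn s fun q : (ℕ × ℕ) × (List (Fin D) × List (Fin D)) =>
      (q.1.1 : ℝ) * blockProb P 1 q.2.1 < q.1.2 * blockProb P 1 q.2.2 := by
  have h : CEIn s fun z : ((ℕ × ℕ) × (List (Fin D) × List (Fin D))) × (ℕ × (ℕ × ℕ)) =>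
      (((z.2.1 : ℝ) * blockProb P 1 z.1.2.1 < z.2.2.1) ∧
        ((z.2.2.2 : ℝ) < z.2.1 * blockProb P 1 z.1.2.2)) ∧
        (0 < z.1.1.2 ∧ z.1.1.1 * z.2.2.1 ≤ z.1.1.2 * z.2.2.2) := by
    have f1 : Primrec fun z : ((ℕ × ℕ) × (List (Fin D) × List (Fin D))) × (ℕ × (ℕ × ℕ)) =>
      z.1.1 := Primrec.fst.comp Primrec.fst
    have f2 : Primrec fun z : ((ℕ × ℕ) × (List (Fin D) × List (Fin D))) × (ℕ × (ℕ × ℕ)) =>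
      z.1.2 := Primrec.snd.comp Primrec.fst
    have f3 : Primrec fun z : ((ℕ × ℕ) × (List (Fin D) × List (Fin D))) × (ℕ × (ℕ × ℕ)) =>
      z.2.1 := Primrec.fst.comp Primrec.snd
    have f4 : Primrec fun z : ((ℕ × ℕ) × (List (Fin D) × List (Fin D))) × (ℕ × (ℕ × ℕ)) =>
      z.2.2 := Primrec.snd.comp Primrec.snd
    refine .and (.and ?_ ?_) (.of_primrecPred (.and ?_ ?_))
    · exact hs.ceIn_mul_lt_nat.comp (((Primrec.fst.comp f4).pair f3).pair
        (Primrec.fst.comp f2)).to_comp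
    · exact hs.ceIn_nat_lt_mul.comp (((Primrec.snd.comp f4).pair f3).pair
        (Primrec.snd.comp f2)).to_comp
    · exact Primrec.nat_lt.comp (Primrec.const 0) (Primrec.snd.comp f1)
    · exact Primrec.nat_le.comp (Primrec.nat_mul.comp (Primrec.fst.comp f1) (Primrec.fst.comp f4))
        (Primrec.nat_mul.comp (Primrec.snd.comp f1) (Primrec.snd.comp f4))
  refine h.ex.of_iff ?_
  rintro ⟨⟨A, B⟩, u, v⟩
  have hp := blockProb_nonneg P 1 u
  have hq := blockProb_nonneg P 1 v
  simp only
  set p := blockProb P 1 u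
  set q := blockProb P 1 v
  constructor
  · rintro ⟨⟨c, x, y⟩, ⟨h1, h2⟩, hB, h3⟩
    simp only at h1 h2 h3 hB
    have hB' : (0 : ℝ) < B := by exact_mod_cast hB
    have h3' : (A : ℝ) * x ≤ B * y := by exact_mod_cast h3
    have h4 : (A : ℝ) * (c * p) ≤ A * x := mul_le_mul_of_nonneg_left h1.le (by positivity)
    have h5 : (B : ℝ) * y < B * (c * q) := mul_lt_mul_of_pos_left h2 hB'
    have h6 : (c : ℝ) * (A * p) < c * (B * q) := by linarith
    exact lt_of_mul_lt_mul_left h6 (by positivity)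
  · intro hlt
    have hBq : 0 < (B : ℝ) * q := lt_of_le_of_lt (by positivity) hlt
    have hq' : 0 < q := by
      rcases hq.eq_or_lt with h0 | h0
      · rw [← h0] at hBq; simp at hBq
      · exact h0
    have hB : 0 < B := by
      rcases Nat.eq_zero_or_pos B with h0 | h0
      · rw [h0] at hBq; simp at hBq
      · exact h0
    -- Rounding `c p` up and `c q` down costs at most `A + B` in total, which this scale exceeds.
    obtain ⟨c, hc⟩ := exists_nat_gt ((A + B : ℝ) / (B * q - A * p))
    rw [div_lt_iff₀ (by linarith)] at hc
    have hc0 : (0 : ℝ) < c := by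
      by_contra hneg
      have : (c : ℝ) * (B * q - A * p) ≤ 0 :=
        mul_nonpos_of_nonpos_of_nonneg (not_lt.1 hneg) (by linarith)
      have : (0 : ℝ) ≤ A + B := by positivity
      linarith
    obtain ⟨x, hx, hx'⟩ := exists_nat_gt_le_add_one (r := c * p) (by positivity)
    obtain ⟨y, hy, hy'⟩ := exists_nat_lt_ge_sub_one (r := c * q) (by positivity)
    refine ⟨(c, x, y), ⟨hx, hy⟩, hB, ?_⟩
    have : (A : ℝ) * x ≤ B * y := by
      have h4 : (A : ℝ) * x ≤ A * (c * p + 1) := mul_le_mul_of_nonneg_left hx' (by positivity)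
      have h5 : (B : ℝ) * (c * q - 1) ≤ B * y := mul_le_mul_of_nonneg_left hy' (by positivity)
      linarith
    exact_mod_cast this

/-- Lower bounds of finite sums of block probabilities over enumerable index sets can be
enumerated. -/
theorem IsRepresentation.ceIn_nat_lt_mul_sum (hs : IsRepresentation s P) {S : α × β → Prop}
    (hS : CEIn s S) {F : α → Finset β} (hF : ∀ a b, S (a, b) ↔ b ∈ F a)
    {word : β → List (Fin D)} (hword : Computable word) :
    CEIn s fun q : (ℕ × ℕ) × α =>
      (q.1.1 : ℝ) < q.1.2 * ∑ b ∈ F q.2, blockProb P 1 (word b) := by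
  classical
  -- A state holds the first code still allowed and the accumulated integer lower bound at scale
  -- `c`. As the codes increase along a chain, no summand is counted twice.
  let R : (α × ℕ) × ((ℕ × ℕ) × (ℕ × ℕ)) → Prop := fun z => ∃ b : β × ℕ,
    (S (z.1.1, b.1) ∧ (b.2 : ℝ) < z.1.2 * blockProb P 1 (word b.1)) ∧
      (z.2.1.1 ≤ Encodable.encode b.1 ∧ z.2.2 = (Encodable.encode b.1 + 1, z.2.1.2 + b.2))
  have hR : CEIn s R := by
    have g1 : Primrec fun y : ((α × ℕ) × ((ℕ × ℕ) × (ℕ × ℕ))) × (β × ℕ) => y.1.1 :=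
      Primrec.fst.comp Primrec.fst
    have g2 : Primrec fun y : ((α × ℕ) × ((ℕ × ℕ) × (ℕ × ℕ))) × (β × ℕ) => y.1.2 :=
      Primrec.snd.comp Primrec.fst
    have g3 : Primrec fun y : ((α × ℕ) × ((ℕ × ℕ) × (ℕ × ℕ))) × (β × ℕ) => y.2.1 :=
      Primrec.fst.comp Primrec.snd
    have g4 : Primrec fun y : ((α × ℕ) × ((ℕ × ℕ) × (ℕ × ℕ))) × (β × ℕ) => y.2.2 :=
      Primrec.snd.comp Primrec.snd
    refine CEIn.ex (A := fun y : ((α × ℕ) × ((ℕ × ℕ) × (ℕ × ℕ))) × (β × ℕ) =>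
      (S (y.1.1.1, y.2.1) ∧ (y.2.2 : ℝ) < y.1.1.2 * blockProb P 1 (word y.2.1)) ∧
      (y.1.2.1.1 ≤ Encodable.encode y.2.1 ∧
        y.1.2.2 = (Encodable.encode y.2.1 + 1, y.1.2.1.2 + y.2.2)))
      (.and (.and ?_ ?_) (.of_primrecPred (.and ?_ ?_)))
    · exact hS.comp ((Primrec.fst.comp g1).pair g3).to_comp
    · exact hs.ceIn_nat_lt_mul.comp ((g4.pair (Primrec.snd.comp g1)).to_comp.pair
        (hword.comp g3.to_comp))
    · exact Primrec.nat_le.comp (Primrec.fst.comp (Primrec.fst.comp g2)) (Primrec.encode.comp g3)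
    · exact Primrec.eq.comp (Primrec.snd.comp g2)
        ((Primrec.succ.comp (Primrec.encode.comp g3)).pair
          (Primrec.nat_add.comp (Primrec.snd.comp (Primrec.fst.comp g2)) g4))
  have hT : CEIn s fun z : ((ℕ × ℕ) × α) × (ℕ × (ℕ × ℕ)) =>
      Relation.ReflTransGen (fun x y => R ((z.1.2, z.2.1), (x, y))) (0, 0) z.2.2 ∧
        z.1.1.1 * z.2.1 < z.1.1.2 * z.2.2.2 := by
    have g1 : Primrec fun z : ((ℕ × ℕ) × α) × (ℕ × (ℕ × ℕ)) => z.1.1 :=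
      Primrec.fst.comp Primrec.fst
    have g2 : Primrec fun z : ((ℕ × ℕ) × α) × (ℕ × (ℕ × ℕ)) => z.2.1 :=
      Primrec.fst.comp Primrec.snd
    have g3 : Primrec fun z : ((ℕ × ℕ) × α) × (ℕ × (ℕ × ℕ)) => z.2.2 :=
      Primrec.snd.comp Primrec.snd
    refine .and ?_ (.of_primrecPred ?_)
    · exact hR.reflTransGen.comp (f := fun z : ((ℕ × ℕ) × α) × (ℕ × (ℕ × ℕ)) =>
        ((z.1.2, z.2.1), (((0 : ℕ), (0 : ℕ)), z.2.2)))
        (((Primrec.snd.comp Primrec.fst).pair g2).pair ((Primrec.const (0, 0)).pair g3)).to_comp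
    · exact Primrec.nat_lt.comp (Primrec.nat_mul.comp (Primrec.fst.comp g1) g2)
        (Primrec.nat_mul.comp (Primrec.snd.comp g1) (Primrec.snd.comp g3))
  refine hT.ex.of_iff ?_
  rintro ⟨⟨A, B⟩, a⟩
  simp only
  have hnn : ∀ b, 0 ≤ blockProb P 1 (word b) := fun b => blockProb_nonneg _ _ _
  constructor
  · rintro ⟨⟨c, m, e⟩, hchain, hlt⟩
    simp only at hchain hlt
    have inv : ∀ y : ℕ × ℕ, Relation.ReflTransGen (fun x y => R ((a, c), (x, y))) (0, 0) y →
        (y.2 : ℝ) ≤ c * ∑ b ∈ (F a).filter (fun b => Encodable.encode b < y.1),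
          blockProb P 1 (word b) := by
      intro y hy
      induction hy with
      | refl => simp
      | @tail y z _ hyz ih =>
        obtain ⟨⟨b, x⟩, ⟨hb, hx⟩, hle, hz⟩ := hyz
        simp only at hb hx hle hz
        subst hz
        have hsub : insert b ((F a).filter (fun b => Encodable.encode b < y.1)) ⊆
            (F a).filter (fun b' => Encodable.encode b' < Encodable.encode b + 1) := by
          intro b' hb'
          rcases Finset.mem_insert.1 hb' with rfl | hb'
          · simp [(hF _ _).1 hb]
          · rw [Finset.mem_filter] at hb' ⊢
            exact ⟨hb'.1, by omega⟩
        have h1 := Finset.sum_le_sum_of_subset_of_nonneg hsub (f := fun b => blockProb P 1 (word b))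
          fun _ _ _ => hnn _
        rw [Finset.sum_insert (by simp [hle])] at h1
        have h2 := mul_le_mul_of_nonneg_left h1 (Nat.cast_nonneg (α := ℝ) c)
        push_cast
        linarith
    have h1 := inv _ hchain
    have h2 : ∑ b ∈ (F a).filter (fun b => Encodable.encode b < m), blockProb P 1 (word b) ≤
        ∑ b ∈ F a, blockProb P 1 (word b) :=
      Finset.sum_le_sum_of_subset_of_nonneg (Finset.filter_subset _ _) fun _ _ _ => hnn _
    have h3 : (e : ℝ) ≤ c * ∑ b ∈ F a, blockProb P 1 (word b) :=
      h1.trans (mul_le_mul_of_nonneg_left h2 (Nat.cast_nonneg _))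
    have h4 : (A : ℝ) * c < B * e := by exact_mod_cast hlt
    have h5 : (B : ℝ) * e ≤ B * (c * ∑ b ∈ F a, blockProb P 1 (word b)) :=
      mul_le_mul_of_nonneg_left h3 (Nat.cast_nonneg _)
    refine lt_of_mul_lt_mul_left (a := (c : ℝ)) ?_ (Nat.cast_nonneg _)
    linarith
  · intro hlt
    set σ := ∑ b ∈ F a, blockProb P 1 (word b) with hσ
    -- Each summand loses at most `1` at scale `c`, so the total loss is at most the cardinality of
    -- `F a`.
    obtain ⟨c, hc⟩ := exists_nat_gt ((B * (F a).card : ℝ) / (B * σ - A))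
    rw [div_lt_iff₀ (by linarith)] at hc
    have hc0 : (0 : ℝ) < c := by
      by_contra hneg
      have : (c : ℝ) * (B * σ - A) ≤ 0 :=
        mul_nonpos_of_nonpos_of_nonneg (not_lt.1 hneg) (by linarith)
      have : (0 : ℝ) ≤ B * (F a).card := by positivity
      linarith
    have inv : ∀ n : ℕ, ∃ m e : ℕ, m ≤ n ∧
        Relation.ReflTransGen (fun x y => R ((a, c), (x, y))) (0, 0) (m, e) ∧
        ∑ b ∈ (F a).filter (fun b => Encodable.encode b < n), (c * blockProb P 1 (word b) - 1)
          ≤ (e : ℝ) := by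
      intro n
      induction n with
      | zero => exact ⟨0, 0, le_rfl, .refl, by simp⟩
      | succ n ih =>
        obtain ⟨m, e, hm, hch, he⟩ := ih
        by_cases hb : ∃ b ∈ F a, Encodable.encode b = n
        · obtain ⟨b, hb, rfl⟩ := hb
          have hins : (F a).filter (fun b' => Encodable.encode b' < Encodable.encode b + 1) =
              insert b ((F a).filter (fun b' => Encodable.encode b' < Encodable.encode b)) := by
            ext b'
            simp only [Finset.mem_filter, Finset.mem_insert]
            constructor
            · rintro ⟨h1, h2⟩
              rcases Nat.lt_succ_iff_lt_or_eq.1 h2 with h2 | h2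
              · exact Or.inr ⟨h1, h2⟩
              · exact Or.inl (Encodable.encode_injective h2)
            · rintro (rfl | ⟨h1, h2⟩)
              · exact ⟨hb, by omega⟩
              · exact ⟨h1, by omega⟩
          rw [hins, Finset.sum_insert (by simp)]
          -- A summand of probability zero has to be skipped: no natural number lies strictly below
          -- it.
          rcases (hnn b).eq_or_lt with h0 | h0
          · exact ⟨m, e, by omega, hch, by rw [← h0]; linarith⟩
          · obtain ⟨x, hx, hx'⟩ := exists_nat_lt_ge_sub_one
              (r := c * blockProb P 1 (word b)) (by positivity)
            refine ⟨_, e + x, le_rfl, hch.tail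
              ⟨(b, x), ⟨(hF _ _).2 hb, hx⟩, hm, rfl⟩, ?_⟩
            push_cast
            linarith
        · push Not at hb
          refine ⟨m, e, by omega, hch, ?_⟩
          have : (F a).filter (fun b' => Encodable.encode b' < n + 1) =
              (F a).filter (fun b' => Encodable.encode b' < n) := by
            refine Finset.filter_congr fun b' hb' => ?_
            have := hb b' hb'
            omega
          rw [this]
          exact he
    obtain ⟨m, e, -, hch, he⟩ := inv ((F a).sup Encodable.encode + 1)
    rw [Finset.filter_true_of_mem (fun b hb => Nat.lt_succ_of_le (Finset.le_sup hb)),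
      Finset.sum_sub_distrib, ← Finset.mul_sum, ← hσ] at he
    simp only [Finset.sum_const, nsmul_eq_mul, mul_one] at he
    refine ⟨(c, m, e), hch, ?_⟩
    have h5 := mul_le_mul_of_nonneg_left he (Nat.cast_nonneg (α := ℝ) B)
    have : (A : ℝ) * c < B * e := by linarith
    exact_mod_cast this

end Comparisons

/-! ### Blocks and stationary measures -/

theorem measurableSet_block_eq (j : ℤ) (n : ℕ) (w : List (Fin D)) :
    MeasurableSet {x : BiSeq D | block x j n = w} := by
  induction n generalizing w with
  | zero => simp
  | succ n ih =>
    rcases List.eq_nil_or_concat w with rfl | ⟨u, a, rfl⟩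
    · simp only [block_succ]; simp
    · have : {x : BiSeq D | block x j (n + 1) = u ++ [a]} =
          {x | block x j n = u} ∩ {x | x (j + n) = a} := by
        ext x
        simp [block_succ, List.append_singleton_inj]
      rw [List.concat_eq_append, this]
      exact (ih u).inter (measurableSet_eq_fun (measurable_pi_apply (j + (n : ℤ))) measurable_const)

theorem measurableSet_block_mem (j : ℤ) (n : ℕ) (A : Set (List (Fin D))) :
    MeasurableSet {x : BiSeq D | block x j n ∈ A} := by
  have : {x : BiSeq D | block x j n ∈ A} = ⋃ w ∈ A, {x | block x j n = w} := by
    ext x; simp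
  rw [this]
  exact MeasurableSet.biUnion (Set.to_countable A) fun w _ => measurableSet_block_eq j n w

theorem measurableSet_cylinder (σ τ : List (Fin D)) : MeasurableSet (cylinder σ τ) :=
  measurableSet_block_eq _ _ _

theorem measurableSet_union_cylinder (V : List (Fin D) × List (Fin D) → Prop) :
    MeasurableSet {x : BiSeq D | ∃ p, V p ∧ x ∈ cylinder p.1 p.2} := by
  have : {x : BiSeq D | ∃ p, V p ∧ x ∈ cylinder p.1 p.2} =
      ⋃ p ∈ {p | V p}, cylinder p.1 p.2 := by
    ext x; simp
  rw [this]
  exact MeasurableSet.biUnion (Set.to_countable _) fun p _ => measurableSet_cylinder _ _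

theorem measure_block_eq {P : ProbabilityMeasure (BiSeq D)}
    (hP : MeasurePreserving shift (P : Measure (BiSeq D)) P) (j k : ℤ) (n : ℕ)
    (w : List (Fin D)) :
    (P : Measure (BiSeq D)) {x | block x j n = w} =
      (P : Measure (BiSeq D)) {x | block x k n = w} := by
  have h : ∀ (j : ℤ) (m : ℕ), (P : Measure (BiSeq D)) {x | block x (j + m) n = w} =
      (P : Measure (BiSeq D)) {x | block x j n = w} := by
    intro j m
    rw [← (hP.iterate m).measure_preimage (measurableSet_block_eq j n w).nullMeasurableSet]
    congr 1
    ext x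
    simp [block_iterate_shift]
  rcases le_total j k with hjk | hjk
  · obtain ⟨m, rfl⟩ := Int.le.dest hjk
    exact (h j m).symm
  · obtain ⟨m, rfl⟩ := Int.le.dest hjk
    exact h k m

theorem measureReal_block_eq {P : ProbabilityMeasure (BiSeq D)}
    (hP : MeasurePreserving shift (P : Measure (BiSeq D)) P) (j : ℤ) (n : ℕ)
    (w : List (Fin D)) (hw : w.length = n) :
    (P : Measure (BiSeq D)).real {x | block x j n = w} = blockProb P 1 w := by
  rw [blockProb, Measure.real, measure_block_eq hP j 1, hw, Measure.real]

/-! ### Tests -/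

section Tests

variable {s x : BiSeq D} {P : ProbabilityMeasure (BiSeq D)}

/-- A random point lies outside some level of a uniformly enumerable sequence of events whose
probabilities decrease geometrically. -/
theorem IsOneRandomWith.exists_notMem_of_le_geometric (hx : IsOneRandomWith s P x)
    {V : ℕ × (List (Fin D) × List (Fin D)) → Prop} (hV : CEIn s V) {C r : ℝ}
    (hr0 : 0 ≤ r) (hr : r < 1)
    (hbound : ∀ m, (P : Measure (BiSeq D)).real
      {y | ∃ p, V (m, p) ∧ y ∈ cylinder p.1 p.2} ≤ C * r ^ m) :
    ∃ m, ∀ p, V (m, p) → x ∉ cylinder p.1 p.2 := by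
  -- Passing to the levels `c * k + d` turns `C * r ^ m` into the bound `2⁻¹ ^ k` of a test: `r ^ c
  -- < 1 / 2`, and `r ^ d` absorbs `C`.
  obtain ⟨c, hc⟩ := exists_pow_lt_of_lt_one (show (0 : ℝ) < 2⁻¹ by norm_num) hr
  obtain ⟨d, hd⟩ : ∃ d : ℕ, C * r ^ d ≤ 1 := by
    have h := (tendsto_pow_atTop_nhds_zero_of_lt_one hr0 hr).const_mul C
    rw [mul_zero] at h
    exact (h.eventually (eventually_le_nhds zero_lt_one)).exists
  let U : ℕ → Set (BiSeq D) := fun k => {y | ∃ p, V (c * k + d, p) ∧ y ∈ cylinder p.1 p.2}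
  have hU : IsMartinLofTest s P U := by
    refine ⟨⟨fun k => {p | V (c * k + d, p)}, fun _ _ => rfl, ?_⟩, fun k _ => ?_⟩
    · exact hV.comp (f := fun q : ℕ × (List (Fin D) × List (Fin D)) => (c * q.1 + d, q.2))
        ((Primrec.nat_add.comp (Primrec.nat_mul.comp (Primrec.const c) Primrec.fst)
          (Primrec.const d)).pair Primrec.snd).to_comp
    · refine (hbound (c * k + d)).trans ?_
      have h1 : C * r ^ (c * k + d) = (r ^ c) ^ k * (C * r ^ d) := by
        rw [pow_add, pow_mul]; ring
      rw [h1]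
      calc (r ^ c) ^ k * (C * r ^ d) ≤ (r ^ c) ^ k * 1 :=
            mul_le_mul_of_nonneg_left hd (by positivity)
        _ = (r ^ c) ^ k := mul_one _
        _ ≤ (2⁻¹ : ℝ) ^ k := pow_le_pow_left₀ (by positivity) hc.le k
  by_contra hcon
  push Not at hcon
  refine hx U hU fun i _ => ?_
  obtain ⟨p, hp, hxp⟩ := hcon (c * i + d)
  exact ⟨p, hp, hxp⟩

/-- A single null cylinder, repeated at all levels, is already a test. Positivity of the windows of
a random point is needed whenever an enumeration is guaranteed to succeed only at strings of
positive probability. -/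
theorem IsOneRandomWith.measure_cylinder_ne_zero (hx : IsOneRandomWith s P x)
    {σ τ : List (Fin D)} (h : x ∈ cylinder σ τ) :
    (P : Measure (BiSeq D)) (cylinder σ τ) ≠ 0 := by
  intro h0
  have hV : CEIn s fun q : ℕ × (List (Fin D) × List (Fin D)) => q.2 = (σ, τ) :=
    .of_primrecPred (Primrec.eq.comp Primrec.snd (Primrec.const (σ, τ)))
  obtain ⟨m, hm⟩ := hx.exists_notMem_of_le_geometric hV (C := 0) (r := 0) le_rfl one_pos
    fun m => by simp [Measure.real, h0]
  exact hm (σ, τ) rfl h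

/-- The window of a point at the positions `1 - N, ..., N`. -/
abbrev window (y : BiSeq D) (N : ℕ) : List (Fin D) := block y (1 - (N : ℤ)) (2 * N)

theorem mem_cylinder_iff_window {σ τ : List (Fin D)} {N : ℕ} (hσ : σ.length = N)
    (hτ : τ.length = N) (y : BiSeq D) : y ∈ cylinder σ τ ↔ window y N = σ ++ τ := by
  simp only [cylinder, hσ, hτ, window, Set.mem_ofPred_eq, ← two_mul]
  rw [show -(N : ℤ) + 1 = 1 - N by ring]

theorem exists_cylinder_eq_window {v : List (Fin D)} {N : ℕ} (hv : v.length = 2 * N) :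
    ∃ σ τ, σ ++ τ = v ∧ σ.length = N ∧ τ.length = N :=
  ⟨v.take N, v.drop N, List.take_append_drop _ _, by simp; omega, by simp; omega⟩

theorem IsOneRandomWith.measure_window_ne_zero (hx : IsOneRandomWith s P x) (N : ℕ) :
    (P : Measure (BiSeq D)) {y | window y N = window x N} ≠ 0 := by
  obtain ⟨σ, τ, h, hσ, hτ⟩ := exists_cylinder_eq_window (v := window x N) (N := N) (by simp)
  have h1 := hx.measure_cylinder_ne_zero ((mem_cylinder_iff_window hσ hτ x).2 h.symm)
  convert h1 using 3
  ext y
  rw [mem_cylinder_iff_window hσ hτ, h]; rfl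

theorem block_eq_of_window_eq {x y : BiSeq D} {N : ℕ} (h : window y N = window x N) {j : ℤ}
    {n : ℕ} (hj : 1 - (N : ℤ) ≤ j) (hn : j + n ≤ N + 1) : block y j n = block x j n := by
  obtain ⟨k, rfl⟩ := Int.le.dest hj
  obtain ⟨l, r, h1, hl, hr⟩ := exists_block_eq_append x (1 - (N : ℤ)) (2 * N) k n (by omega)
  have h2 := (block_eq_append_iff y (1 - (N : ℤ)) (2 * N) l (block x (1 - (N : ℤ) + k) n) r
    (by simpa using hr)).1 (h.trans h1)
  simpa [hl] using h2.2.1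

theorem IsOneRandomWith.blockProb_pos (hx : IsOneRandomWith s P x) (n : ℕ) :
    0 < blockProb P 1 (block x 1 n) := by
  rw [blockProb, measureReal_def, ENNReal.toReal_pos_iff]
  refine ⟨?_, measure_lt_top _ _⟩
  rw [pos_iff_ne_zero]
  refine fun h0 => hx.measure_window_ne_zero n (measure_mono_null ?_ h0)
  intro y hy
  simpa using block_eq_of_window_eq hy (j := 1) (n := n) (by omega) (by omega)

end Tests

/-! ### Second moments of visit counts -/

section Ergodic

variable {Ω : Type*} [MeasurableSpace Ω] {μ : Measure Ω} [IsProbabilityMeasure μ] {T : Ω → Ω}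

open scoped InnerProductSpace

/-- The indicator function of `A` in `L²`. -/
noncomputable abbrev indL2 (μ : Measure Ω) [IsProbabilityMeasure μ] {A : Set Ω}
    (hA : MeasurableSet A) : Lp ℝ 2 μ :=
  indicatorConstLp 2 hA (measure_ne_top μ A) (1 : ℝ)

theorem inner_indL2 {A B : Set Ω} (hA : MeasurableSet A) (hB : MeasurableSet B) :
    ⟪indL2 μ hA, indL2 μ hB⟫_ℝ = μ.real (A ∩ B) := by
  exact L2.real_inner_indicatorConstLp_one_indicatorConstLp_one hA hB _ _

/-- The sum of the correlations of the first `n` visit times of `C`. -/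
noncomputable def visitCorr (μ : Measure Ω) (T : Ω → Ω) (C : Set Ω) (n : ℕ) : ℝ :=
  ∑ i ∈ Finset.range n, ∑ j ∈ Finset.range n, μ.real (T^[i] ⁻¹' C ∩ T^[j] ⁻¹' C)

/-- `visitCorr` is the second moment of the number of visits of `C` before time `n`. -/
theorem norm_sum_indL2_sq (hT : MeasurePreserving T μ μ) {C : Set Ω} (hC : MeasurableSet C)
    (n : ℕ) :
    ‖∑ i ∈ Finset.range n, indL2 μ (hC.preimage (hT.iterate i).measurable)‖ ^ 2 =
      visitCorr μ T C n := by
  rw [← real_inner_self_eq_norm_sq, visitCorr, sum_inner]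
  refine Finset.sum_congr rfl fun i _ => ?_
  rw [inner_sum]
  exact Finset.sum_congr rfl fun j _ => inner_indL2 _ _

/-- The probability to start in `C` and to stay in `U` for `n` steps. -/
theorem measureReal_inter_iInter_preimage_le (hT : MeasurePreserving T μ μ) {C U : Set Ω}
    (hC : MeasurableSet C) (hU : MeasurableSet U) (n : ℕ) :
    (n * μ.real (C ∩ ⋂ i < n, T^[i] ⁻¹' U)) ^ 2 ≤ μ.real U * visitCorr μ T C n := by
  have hmeas : ∀ i, MeasurableSet (T^[i] ⁻¹' U) := fun i =>
    hU.preimage (hT.iterate i).measurable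
  have hCm : ∀ i, MeasurableSet (T^[i] ⁻¹' C) := fun i =>
    hC.preimage (hT.iterate i).measurable
  -- By invariance the stay in `U` may be started at any time `j < n`. It then still lasts at time
  -- `n - 1`, the same time for all `j`.
  have h1 : ∀ j ∈ Finset.range n, μ.real (C ∩ ⋂ i < n, T^[i] ⁻¹' U) ≤
      μ.real (T^[n - 1] ⁻¹' U ∩ T^[j] ⁻¹' C) := by
    intro j hj
    rw [Finset.mem_range] at hj
    have h2 : T^[j] ⁻¹' (C ∩ ⋂ i < n, T^[i] ⁻¹' U) ⊆ T^[n - 1] ⁻¹' U ∩ T^[j] ⁻¹' C := by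
      rintro y ⟨hy1, hy2⟩
      refine ⟨?_, hy1⟩
      have h3 := Set.mem_iInter₂.1 hy2 (n - 1 - j) (by omega)
      rw [Set.mem_preimage, ← Function.iterate_add_apply] at h3
      rwa [show n - 1 - j + j = n - 1 by omega] at h3
    have h4 : MeasurableSet (C ∩ ⋂ i < n, T^[i] ⁻¹' U) :=
      hC.inter (MeasurableSet.iInter fun i => MeasurableSet.iInter fun _ => hmeas i)
    calc μ.real (C ∩ ⋂ i < n, T^[i] ⁻¹' U)
        = μ.real (T^[j] ⁻¹' (C ∩ ⋂ i < n, T^[i] ⁻¹' U)) := by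
          rw [measureReal_def, measureReal_def,
            (hT.iterate j).measure_preimage h4.nullMeasurableSet]
      _ ≤ _ := measureReal_mono h2
  -- Summing over `j` leaves one inner product, of the indicator of `U` at time `n - 1` with the
  -- visit count of `C`; Cauchy-Schwarz finishes the estimate.
  have h5 : n * μ.real (C ∩ ⋂ i < n, T^[i] ⁻¹' U) ≤
      ⟪indL2 μ (hmeas (n - 1)), ∑ j ∈ Finset.range n, indL2 μ (hCm j)⟫_ℝ := by
    rw [inner_sum]
    calc n * μ.real (C ∩ ⋂ i < n, T^[i] ⁻¹' U)
        = ∑ j ∈ Finset.range n, μ.real (C ∩ ⋂ i < n, T^[i] ⁻¹' U) := by simp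
      _ ≤ _ := Finset.sum_le_sum fun j hj => (h1 j hj).trans_eq (inner_indL2 _ _).symm
  have h6 := h5.trans (real_inner_le_norm _ _)
  calc (n * μ.real (C ∩ ⋂ i < n, T^[i] ⁻¹' U)) ^ 2
      ≤ (‖indL2 μ (hmeas (n - 1))‖ * ‖∑ j ∈ Finset.range n, indL2 μ (hCm j)‖) ^ 2 :=
        pow_le_pow_left₀ (by positivity) h6 2
    _ = μ.real U * visitCorr μ T C n := by
        rw [mul_pow, norm_sum_indL2_sq hT hC, ← real_inner_self_eq_norm_sq, inner_indL2,
          Set.inter_self, measureReal_def, measureReal_def,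
          (hT.iterate _).measure_preimage hU.nullMeasurableSet]

/-- By the mean ergodic theorem the averages of the shifted indicators converge in `L²` to an
invariant function. Ergodicity makes it a constant `c`, and pairing with `1` gives `c = μ.real C`.
The quotient in question is the squared norm of the average. -/
theorem tendsto_visitCorr (hT : Ergodic T μ) {C : Set Ω} (hC : MeasurableSet C) :
    Tendsto (fun n : ℕ => visitCorr μ T C n / (n : ℝ) ^ 2) atTop (𝓝 (μ.real C ^ 2)) := by
  have hmp := hT.toMeasurePreserving
  let f : Lp ℝ 2 μ →L[ℝ] Lp ℝ 2 μ :=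
    (Lp.compMeasurePreservingₗᵢ ℝ T hmp).toContinuousLinearMap
  have hf : ‖f‖ ≤ 1 := LinearIsometry.norm_toContinuousLinearMap_le _
  have hlim := f.tendsto_birkhoffAverage_orthogonalProjection hf (indL2 μ hC)
  set p : Lp ℝ 2 μ := ((f.eqLocus (1 : Lp ℝ 2 μ →L[ℝ] Lp ℝ 2 μ)).orthogonalProjectionOnto
    (indL2 μ hC) : Lp ℝ 2 μ) with hp
  have hiter : ∀ i, f^[i] (indL2 μ hC) = indL2 μ (hC.preimage (hmp.iterate i).measurable) := by
    intro i
    have h := congrFun (Lp.compMeasurePreserving_iterate (E := ℝ) (p := 2) hmp i) (indL2 μ hC)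
    exact h
  have havg : ∀ n : ℕ, birkhoffAverage ℝ f _root_.id n (indL2 μ hC) =
      (n : ℝ)⁻¹ • ∑ i ∈ Finset.range n, indL2 μ (hC.preimage (hmp.iterate i).measurable) := by
    intro n
    simp only [birkhoffAverage, birkhoffSum, id, hiter]
  have hfix : f p = p := by
    have h : p ∈ f.eqLocus (1 : Lp ℝ 2 μ →L[ℝ] Lp ℝ 2 μ) := Submodule.coe_mem _
    simpa using h
  obtain ⟨c, hc⟩ := hT.ae_eq_const_of_ae_eq_comp_ae (Lp.aestronglyMeasurable p) (by
    have h := Lp.coeFn_compMeasurePreserving p hmp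
    have h' : Lp.compMeasurePreserving T hmp p = p := hfix
    rw [h'] at h
    exact h.symm)
  have hone : ⟪indL2 μ MeasurableSet.univ, p⟫_ℝ = c := by
    rw [L2.inner_indicatorConstLp_one, setIntegral_univ, integral_congr_ae hc]
    simp
  have hpp : ‖p‖ ^ 2 = c ^ 2 := by
    rw [← real_inner_self_eq_norm_sq, L2.inner_def]
    rw [integral_congr_ae (g := fun _ => c ^ 2) (hc.mono fun x hx => by
      simp [hx])]
    simp
  have hconst : c = μ.real C := by
    have h1 : Tendsto (fun n => ⟪indL2 μ MeasurableSet.univ,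
        birkhoffAverage ℝ f _root_.id n (indL2 μ hC)⟫_ℝ) atTop (𝓝 c) := by
      rw [← hone]
      exact tendsto_const_nhds.inner hlim
    refine tendsto_nhds_unique h1 (tendsto_const_nhds.congr' ?_)
    filter_upwards [eventually_gt_atTop 0] with n hn
    rw [havg, inner_smul_right, inner_sum]
    simp only [inner_indL2, Set.univ_inter]
    rw [Finset.sum_congr rfl fun i _ => show μ.real (T^[i] ⁻¹' C) = μ.real C by
      rw [measureReal_def, measureReal_def, (hmp.iterate i).measure_preimage hC.nullMeasurableSet]]
    simp
    field_simp
  rw [← hconst, ← hpp]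
  refine (hlim.norm.pow 2).congr fun n => ?_
  rw [havg, norm_smul, mul_pow, norm_sum_indL2_sq hmp hC, norm_inv, inv_pow, div_eq_inv_mul]
  simp

end Ergodic

/-! ### The maximal ergodic theorem -/

section MaximalErgodic

variable {Ω : Type*} {T : Ω → Ω}

/-- `max (0, S₁, ..., Sₙ)` for the partial sums `Sₖ` of `F` along the orbit. -/
noncomputable def maxBirkhoffSum (T : Ω → Ω) (F : Ω → ℝ) : ℕ → Ω → ℝ
  | 0 => fun _ => 0
  | n + 1 => fun y => max 0 (F y + maxBirkhoffSum T F n (T y))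

variable {F : Ω → ℝ}

theorem maxBirkhoffSum_nonneg (n : ℕ) (y : Ω) : 0 ≤ maxBirkhoffSum T F n y := by
  cases n with
  | zero => exact le_rfl
  | succ n => exact le_max_left _ _

theorem maxBirkhoffSum_le_succ (n : ℕ) (y : Ω) :
    maxBirkhoffSum T F n y ≤ maxBirkhoffSum T F (n + 1) y := by
  induction n generalizing y with
  | zero => exact maxBirkhoffSum_nonneg 1 y
  | succ n ih => exact max_le_max le_rfl (add_le_add le_rfl (ih (T y)))

theorem birkhoffSum_le_maxBirkhoffSum (n : ℕ) (y : Ω) :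
    birkhoffSum T F n y ≤ maxBirkhoffSum T F n y := by
  induction n generalizing y with
  | zero => simp [maxBirkhoffSum]
  | succ n ih =>
    rw [birkhoffSum_succ']
    exact (add_le_add le_rfl (ih (T y))).trans (le_max_right _ _)

variable [MeasurableSpace Ω] {μ : Measure Ω}

theorem integrable_maxBirkhoffSum (hT : MeasurePreserving T μ μ) (hF : Integrable F μ) (n : ℕ) :
    Integrable (maxBirkhoffSum T F n) μ := by
  induction n with
  | zero => exact integrable_zero _ _ _
  | succ n ih =>
    exact (integrable_zero _ _ _).sup (hF.add ((hT.integrable_comp ih.aestronglyMeasurable).2 ih))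

theorem measurable_maxBirkhoffSum (hT : Measurable T) (hF : Measurable F) (n : ℕ) :
    Measurable (maxBirkhoffSum T F n) := by
  induction n with
  | zero => exact measurable_const
  | succ n ih => exact measurable_const.max (hF.add (ih.comp hT))

/-- Garsia's argument: `M - M ∘ T` is at most `F` where `M > 0` and at most `0` elsewhere, while its
integral vanishes by invariance. -/
theorem setIntegral_maxBirkhoffSum_pos_nonneg (hT : MeasurePreserving T μ μ)
    (hF : Integrable F μ) (hFm : Measurable F) (n : ℕ) :
    0 ≤ ∫ y in {y | 0 < maxBirkhoffSum T F n y}, F y ∂μ := by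
  set M := maxBirkhoffSum T F n with hM
  have hMi : Integrable M μ := integrable_maxBirkhoffSum hT hF n
  have hMT : Integrable (fun y => M (T y)) μ :=
    (hT.integrable_comp hMi.aestronglyMeasurable).2 hMi
  have hmeas : MeasurableSet {y | 0 < M y} :=
    measurableSet_lt measurable_const (measurable_maxBirkhoffSum hT.measurable hFm n)
  have hInt : ∫ y, M (T y) ∂μ = ∫ y, M y ∂μ := by
    conv_rhs => rw [← hT.map_eq]
    rw [integral_map hT.measurable.aemeasurable]
    rw [hT.map_eq]; exact hMi.aestronglyMeasurable
  have h1 : ∫ y, (M y - M (T y)) ∂μ ≤ ∫ y, {y | 0 < M y}.indicator F y ∂μ := by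
    refine integral_mono (hMi.sub hMT) (hF.indicator hmeas) fun y => ?_
    by_cases hy : 0 < M y
    · rw [Set.indicator_of_mem (show y ∈ {y | 0 < M y} from hy)]
      cases n with
      | zero => simp [hM, maxBirkhoffSum] at hy
      | succ n =>
        have h2 : M y = F y + maxBirkhoffSum T F n (T y) := by
          rcases max_choice 0 (F y + maxBirkhoffSum T F n (T y)) with h | h
          · exact absurd h hy.ne'
          · exact h
        have h3 := maxBirkhoffSum_le_succ (T := T) (F := F) n (T y)
        simp only [← hM] at h3
        linarith
    · rw [Set.indicator_of_notMem (show y ∉ {y | 0 < M y} from hy)]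
      have h2 : 0 ≤ M (T y) := maxBirkhoffSum_nonneg n (T y)
      linarith [not_lt.1 hy]
  rw [integral_sub hMi hMT, hInt, sub_self] at h1
  rwa [integral_indicator hmeas] at h1

theorem integral_nonneg_of_ae_exists_birkhoffSum_pos (hT : MeasurePreserving T μ μ)
    (hF : Integrable F μ) (hFm : Measurable F) (h : ∀ᵐ y ∂μ, ∃ n, 0 < birkhoffSum T F n y) :
    0 ≤ ∫ y, F y ∂μ := by
  let A : ℕ → Set Ω := fun n => {y | 0 < maxBirkhoffSum T F n y}
  have hA : ∀ n, MeasurableSet (A n) := fun n =>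
    measurableSet_lt measurable_const (measurable_maxBirkhoffSum hT.measurable hFm n)
  have hmono : Monotone A := monotone_nat_of_le_succ fun n y hy =>
    lt_of_lt_of_le hy (maxBirkhoffSum_le_succ n y)
  have hlim := tendsto_setIntegral_of_monotone hA hmono hF.integrableOn
  have huniv : (⋃ n, A n) =ᵐ[μ] Set.univ := by
    rw [eventuallyEq_univ]
    filter_upwards [h] with y hy
    obtain ⟨n, hn⟩ := hy
    exact Set.mem_iUnion.2 ⟨n, lt_of_lt_of_le hn (birkhoffSum_le_maxBirkhoffSum n y)⟩
  rw [setIntegral_congr_set huniv, setIntegral_univ] at hlim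
  exact ge_of_tendsto' hlim fun n => setIntegral_maxBirkhoffSum_pos_nonneg hT hF hFm n

/-- With positive probability the relative frequency of visits never exceeds a given bound above
the probability. -/
theorem measureReal_exists_frequency_gt_lt_one [IsProbabilityMeasure μ]
    (hT : MeasurePreserving T μ μ) {O : Set Ω} (hO : MeasurableSet O) {q : ℝ}
    (hq : μ.real O < q) :
    μ.real {y | ∃ n : ℕ, q * n < ∑ i ∈ Finset.range n, O.indicator (fun _ => (1 : ℝ)) (T^[i] y)}
      < 1 := by
  set U := {y | ∃ n : ℕ, q * n <
    ∑ i ∈ Finset.range n, O.indicator (fun _ => (1 : ℝ)) (T^[i] y)} with hU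
  have hindm : Measurable (O.indicator fun _ => (1 : ℝ)) := measurable_const.indicator hO
  have hUm : MeasurableSet U := by
    have : U = ⋃ n : ℕ, {y | q * n <
        ∑ i ∈ Finset.range n, O.indicator (fun _ => (1 : ℝ)) (T^[i] y)} := by
      ext y; simp [hU]
    rw [this]
    exact MeasurableSet.iUnion fun n => measurableSet_lt measurable_const
      (Finset.measurable_sum _ fun i _ => hindm.comp (hT.iterate i).measurable)
  refine lt_of_le_of_ne measureReal_le_one fun h1 => ?_
  have hae : ∀ᵐ y ∂μ, y ∈ U :=
    (mem_ae_iff_prob_eq_one hUm).2 ((ENNReal.toReal_eq_one_iff _).1 h1)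
  -- If almost every point exceeded the frequency `q` at some time, the sums of `F` would become
  -- positive almost everywhere and its integral `μ.real O - q` could not be negative.
  let F : Ω → ℝ := fun y => O.indicator (fun _ => (1 : ℝ)) y - q
  have hi : Integrable (O.indicator fun _ => (1 : ℝ)) μ := (integrable_const 1).indicator hO
  have h2 : 0 ≤ ∫ y, F y ∂μ := by
    refine integral_nonneg_of_ae_exists_birkhoffSum_pos hT (hi.sub (integrable_const q))
      (hindm.sub measurable_const) ?_
    filter_upwards [hae] with y hy
    obtain ⟨n, hn⟩ := hy
    refine ⟨n, ?_⟩
    simp only [birkhoffSum, F, Finset.sum_sub_distrib, Finset.sum_const, Finset.card_range,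
      nsmul_eq_mul]
    linarith
  rw [integral_sub hi (integrable_const q), integral_indicator hO] at h2
  simp at h2
  linarith

end MaximalErgodic

/-! ### Strings of a fixed length and rational approximation. -/

/-- The finite set of the strings of length `n`. -/
noncomputable def words (D n : ℕ) : Finset (List (Fin D)) :=
  (List.finite_length_eq (Fin D) n).toFinset

@[simp] theorem mem_words {n : ℕ} {w : List (Fin D)} : w ∈ words D n ↔ w.length = n := by
  simp [words]

theorem measureReal_block_mem (P : ProbabilityMeasure (BiSeq D)) (j : ℤ) (n : ℕ)
    (A : List (Fin D) → Prop) [DecidablePred A] :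
    (P : Measure (BiSeq D)).real {y | A (block y j n)} =
      ∑ v ∈ (words D n).filter A, (P : Measure (BiSeq D)).real {y | block y j n = v} := by
  rw [← measureReal_biUnion_finset]
  · congr 1
    ext y
    simp
  · intro v _ v' _ hvv
    exact Set.disjoint_left.2 fun y hy hy' => hvv (hy.symm.trans hy')
  · exact fun v _ => measurableSet_block_eq j n v

theorem exists_nat_div_btwn {a r : ℝ} (hr : 0 < r) (ha : a < r) :
    ∃ A B : ℕ, 0 < B ∧ a < (A : ℝ) / B ∧ (A : ℝ) / B < r := by
  obtain ⟨q, hq, hqr⟩ := exists_rat_btwn (max_lt ha hr)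
  have hq0 : 0 < q := by exact_mod_cast (le_max_right a 0).trans_lt hq
  have hnum : ((q.num.toNat : ℕ) : ℤ) = q.num := Int.toNat_of_nonneg (Rat.num_pos.2 hq0).le
  have hqe : ((q.num.toNat : ℕ) : ℝ) / (q.den : ℕ) = q := by
    have h : ((q.num.toNat : ℕ) : ℝ) = (q.num : ℝ) := by
      exact_mod_cast congrArg (Int.cast : ℤ → ℝ) hnum
    rw [h, Rat.cast_def]
  exact ⟨q.num.toNat, q.den, q.pos, by rw [hqe]; exact (le_max_left a 0).trans_lt hq,
    by rw [hqe]; exact hqr⟩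

/-! ### Enumerable bounds of the second moments of frequencies -/

/-- A string other than `w`, but of the same length, occurs in `v` after `i` letters. -/
def OtherAt (w v : List (Fin D)) (i : ℕ) : Prop :=
  ∃ l u r : List (Fin D), v = l ++ (u ++ r) ∧ l.length = i ∧ u.length = w.length ∧ u ≠ w

theorem otherAt_block_iff (w : List (Fin D)) (y : BiSeq D) {i n : ℕ} (hi : i + w.length ≤ n) :
    OtherAt w (block y 1 n) i ↔ block y (1 + i) w.length ≠ w := by
  constructor
  · rintro ⟨l, u, r, h, rfl, hu, hne⟩
    have hlen := congrArg List.length h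
    simp only [length_block, List.length_append] at hlen
    have h2 := ((block_eq_append_iff y 1 n l u r hlen.symm).1 h).2.1
    rw [hu] at h2
    rwa [h2]
  · intro hne
    obtain ⟨l, r, h, hl, -⟩ := exists_block_eq_append y 1 n i w.length hi
    exact ⟨l, _, r, h, hl, by simp, hne⟩

theorem rePred_otherAt : REPred fun q : (List (Fin D) × List (Fin D)) × ℕ =>
    OtherAt q.1.1 q.1.2 q.2 := by
  have h : PrimrecPred fun z : ((((List (Fin D) × List (Fin D)) × ℕ) × List (Fin D)) ×
      List (Fin D)) × List (Fin D) =>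
      z.1.1.1.1.2 = z.1.1.2 ++ (z.1.2 ++ z.2) ∧ z.1.1.2.length = z.1.1.1.2 ∧
        z.1.2.length = z.1.1.1.1.1.length ∧ z.1.2 ≠ z.1.1.1.1.1 := by
    have g1 : Primrec fun z : ((((List (Fin D) × List (Fin D)) × ℕ) × List (Fin D)) ×
      List (Fin D)) × List (Fin D) => z.1.1.1 :=
      Primrec.fst.comp (Primrec.fst.comp Primrec.fst)
    have gl : Primrec fun z : ((((List (Fin D) × List (Fin D)) × ℕ) × List (Fin D)) ×
      List (Fin D)) × List (Fin D) => z.1.1.2 :=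
      Primrec.snd.comp (Primrec.fst.comp Primrec.fst)
    have gu : Primrec fun z : ((((List (Fin D) × List (Fin D)) × ℕ) × List (Fin D)) ×
      List (Fin D)) × List (Fin D) => z.1.2 := Primrec.snd.comp Primrec.fst
    have gw := Primrec.fst.comp (Primrec.fst.comp g1)
    refine .and ?_ (.and ?_ (.and ?_ (.not ?_)))
    · exact Primrec.eq.comp (Primrec.snd.comp (Primrec.fst.comp g1))
        (Primrec.list_append.comp gl (Primrec.list_append.comp gu Primrec.snd))
    · exact Primrec.eq.comp (Primrec.list_length.comp gl) (Primrec.snd.comp g1)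
    · exact Primrec.eq.comp (Primrec.list_length.comp gu) (Primrec.list_length.comp gw)
    · exact Primrec.eq.comp gu gw
  exact h.computablePred.to_re.ex.ex.ex

section SecondMoment

variable {s : BiSeq D} {P : ProbabilityMeasure (BiSeq D)}

open Classical in
/-- Pairs of times before `n` and strings that do not contain `w` at both times. -/
noncomputable def missIndex (a : List (Fin D) × ℕ) : Finset ((ℕ × ℕ) × List (Fin D)) :=
  ((Finset.range a.2 ×ˢ Finset.range a.2) ×ˢ words D (a.2 + a.1.length)).filter fun b =>
    OtherAt a.1 b.2 b.1.1 ∨ OtherAt a.1 b.2 b.1.2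

theorem ceIn_mem_missIndex : CEIn s fun q : (List (Fin D) × ℕ) × ((ℕ × ℕ) × List (Fin D)) =>
    q.2 ∈ missIndex q.1 := by
  have gw : Primrec fun q : (List (Fin D) × ℕ) × ((ℕ × ℕ) × List (Fin D)) => q.1.1 :=
    Primrec.fst.comp Primrec.fst
  have gn : Primrec fun q : (List (Fin D) × ℕ) × ((ℕ × ℕ) × List (Fin D)) => q.1.2 :=
    Primrec.snd.comp Primrec.fst
  have gi : Primrec fun q : (List (Fin D) × ℕ) × ((ℕ × ℕ) × List (Fin D)) => q.2.1.1 :=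
    Primrec.fst.comp (Primrec.fst.comp Primrec.snd)
  have gj : Primrec fun q : (List (Fin D) × ℕ) × ((ℕ × ℕ) × List (Fin D)) => q.2.1.2 :=
    Primrec.snd.comp (Primrec.fst.comp Primrec.snd)
  have gv : Primrec fun q : (List (Fin D) × ℕ) × ((ℕ × ℕ) × List (Fin D)) => q.2.2 :=
    Primrec.snd.comp Primrec.snd
  have h1 : PrimrecPred fun q : (List (Fin D) × ℕ) × ((ℕ × ℕ) × List (Fin D)) =>
      (q.2.1.1 < q.1.2 ∧ q.2.1.2 < q.1.2) ∧ q.2.2.length = q.1.2 + q.1.1.length :=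
    .and (.and (Primrec.nat_lt.comp gi gn) (Primrec.nat_lt.comp gj gn))
      (Primrec.eq.comp (Primrec.list_length.comp gv)
        (Primrec.nat_add.comp gn (Primrec.list_length.comp gw)))
  have h2 : CEIn s fun q : (List (Fin D) × ℕ) × ((ℕ × ℕ) × List (Fin D)) =>
      OtherAt q.1.1 q.2.2 q.2.1.1 ∨ OtherAt q.1.1 q.2.2 q.2.1.2 :=
    .or (.of_rePred (rePred_otherAt.comp ((gw.pair gv).pair gi).to_comp))
      (.of_rePred (rePred_otherAt.comp ((gw.pair gv).pair gj).to_comp))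
  refine (CEIn.and (.of_primrecPred h1) h2).of_iff fun q => ?_
  simp [missIndex]

/-- Upper bounds of `visitCorr` are wanted, but only lower bounds of sums are enumerated; therefore
the complementary events are summed. Strings of length `n + w.length` show all positions at which
`w` can start before time `n`. -/
theorem sum_missIndex (w : List (Fin D)) (n : ℕ) :
    ∑ b ∈ missIndex (w, n), blockProb P 1 b.2 =
      (n : ℝ) ^ 2 - visitCorr (P : Measure (BiSeq D)) shift {y | block y 1 w.length = w} n := by
  classical
  have h1 : ∀ i ∈ Finset.range n, ∀ j ∈ Finset.range n,
      ∑ v ∈ words D (n + w.length), (if OtherAt w v i ∨ OtherAt w v j then blockProb P 1 v else 0)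
        = 1 - (P : Measure (BiSeq D)).real
          (shift^[i] ⁻¹' {y | block y 1 w.length = w} ∩
            shift^[j] ⁻¹' {y | block y 1 w.length = w}) := by
    intro i hi j hj
    rw [Finset.mem_range] at hi hj
    rw [← Finset.sum_filter]
    have h2 := measureReal_block_mem P 1 (n + w.length) (fun v => OtherAt w v i ∨ OtherAt w v j)
    have h3 : ∀ v ∈ (words D (n + w.length)).filter (fun v => OtherAt w v i ∨ OtherAt w v j),
        (P : Measure (BiSeq D)).real {y | block y 1 (n + w.length) = v} = blockProb P 1 v := by
      intro v hv
      rw [Finset.mem_filter, mem_words] at hv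
      rw [blockProb, hv.1]
    rw [Finset.sum_congr rfl h3] at h2
    have hset : ∀ k : ℕ, shift^[k] ⁻¹' {y : BiSeq D | block y 1 w.length = w} =
        {y | block y (1 + k) w.length = w} := by
      intro k; ext y; simp [block_iterate_shift]
    rw [← h2, hset, hset, ← probReal_compl_eq_one_sub
      ((measurableSet_block_eq _ _ _).inter (measurableSet_block_eq _ _ _))]
    congr 1
    ext y
    simp only [Set.mem_ofPred_eq, Set.mem_compl_iff, Set.mem_inter_iff]
    rw [otherAt_block_iff w y (by omega), otherAt_block_iff w y (by omega)]
    tauto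
  rw [missIndex, Finset.sum_filter, Finset.sum_product, Finset.sum_product]
  simp only
  rw [Finset.sum_congr rfl fun i hi => Finset.sum_congr rfl fun j hj => h1 i hi j hj]
  simp only [Finset.sum_sub_distrib, visitCorr]
  simp
  ring

/-- An enumerable relation between a string `w` and times `n` such that up to time `n` the
second moment of the frequency of `w` is at most `(k + 1) / k` times the squared probability. -/
theorem exists_ceIn_visitCorr_le (hs : IsRepresentation s P) (hP : StationaryErgodic P) {k : ℕ}
    (hk : 0 < k) :
    ∃ N : List (Fin D) × ℕ → Prop, CEIn s N ∧
      (∀ w n, N (w, n) → 0 < n ∧ k * visitCorr (P : Measure (BiSeq D)) shift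
        {y | block y 1 w.length = w} n ≤ (k + 1) * n ^ 2 * blockProb P 1 w ^ 2) ∧
      ∀ w, 0 < blockProb P 1 w → ∃ n, N (w, n) := by
  have hsum := hs.ceIn_nat_lt_mul_sum (ceIn_mem_missIndex (s := s)) (F := missIndex)
    (fun _ _ => Iff.rfl) (word := Prod.snd) Computable.snd
  -- Here `A / B` is a lower bound of `n ^ 2 - visitCorr` and `b / c` one of the probability of `w`.
  -- The last inequality is `k (n² - A/B) ≤ (k+1) n² (b/c)²` without denominators. The alternative
  -- `(0, 1)` provides the bound `0`, which is not strict when the sum vanishes.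
  let R : (List (Fin D) × ℕ) × ((ℕ × ℕ) × (ℕ × ℕ)) → Prop := fun z =>
    (z.2.1 = (0, 1) ∨ (z.2.1.1 : ℝ) < z.2.1.2 * ∑ b ∈ missIndex z.1, blockProb P 1 b.2) ∧
    ((z.2.2.1 : ℝ) < z.2.2.2 * blockProb P 1 z.1.1) ∧ (0 < z.1.2 ∧
      k * (z.1.2 * z.1.2) * (z.2.1.2 * (z.2.2.2 * z.2.2.2)) ≤
      k * (z.2.1.1 * (z.2.2.2 * z.2.2.2)) +
        (k + 1) * (z.1.2 * z.1.2) * (z.2.2.1 * z.2.2.1 * z.2.1.2))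
  have hR : CEIn s R := by
    have gw : Primrec fun z : (List (Fin D) × ℕ) × ((ℕ × ℕ) × (ℕ × ℕ)) => z.1.1 :=
      Primrec.fst.comp Primrec.fst
    have gn : Primrec fun z : (List (Fin D) × ℕ) × ((ℕ × ℕ) × (ℕ × ℕ)) => z.1.2 :=
      Primrec.snd.comp Primrec.fst
    have gAB : Primrec fun z : (List (Fin D) × ℕ) × ((ℕ × ℕ) × (ℕ × ℕ)) => z.2.1 :=
      Primrec.fst.comp Primrec.snd
    have gbc : Primrec fun z : (List (Fin D) × ℕ) × ((ℕ × ℕ) × (ℕ × ℕ)) => z.2.2 :=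
      Primrec.snd.comp Primrec.snd
    have gA := Primrec.fst.comp gAB
    have gB := Primrec.snd.comp gAB
    have gb := Primrec.fst.comp gbc
    have gc := Primrec.snd.comp gbc
    have gnn := Primrec.nat_mul.comp gn gn
    have gcc := Primrec.nat_mul.comp gc gc
    refine .and (.or (.of_primrecPred ?_) ?_) (.and ?_ (.of_primrecPred (.and ?_ ?_)))
    · exact Primrec.eq.comp gAB (Primrec.const (0, 1))
    · exact hsum.comp (gAB.pair Primrec.fst).to_comp
    · exact hs.ceIn_nat_lt_mul.comp (gbc.pair gw).to_comp
    · exact Primrec.nat_lt.comp (Primrec.const 0) gn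
    · exact Primrec.nat_le.comp
        (Primrec.nat_mul.comp (Primrec.nat_mul.comp (Primrec.const k) gnn)
          (Primrec.nat_mul.comp gB gcc))
        (Primrec.nat_add.comp (Primrec.nat_mul.comp (Primrec.const k)
          (Primrec.nat_mul.comp gA gcc))
          (Primrec.nat_mul.comp (Primrec.nat_mul.comp (Primrec.const (k + 1)) gnn)
            (Primrec.nat_mul.comp (Primrec.nat_mul.comp gb gb) gB)))
  refine ⟨fun q => ∃ z, R (q, z), hR.ex, ?_, ?_⟩
  · rintro w n ⟨⟨⟨A, B⟩, b, c⟩, hAB, hbc, hn, hle⟩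
    simp only [sum_missIndex] at hAB hbc hn hle
    refine ⟨hn, ?_⟩
    set vc := visitCorr (P : Measure (BiSeq D)) shift {y | block y 1 w.length = w} n
    have hvc : vc ≤ (n : ℝ) ^ 2 := by
      have h := sum_missIndex (P := P) w n
      have h' : 0 ≤ ∑ b ∈ missIndex (w, n), blockProb P 1 b.2 :=
        Finset.sum_nonneg fun _ _ => blockProb_nonneg _ _ _
      linarith
    have hA : 0 < B ∧ (A : ℝ) ≤ B * ((n : ℝ) ^ 2 - vc) := by
      rcases hAB with hAB | hAB
      · obtain ⟨rfl, rfl⟩ := Prod.mk.inj hAB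
        exact ⟨one_pos, by push_cast; linarith⟩
      · refine ⟨Nat.pos_of_ne_zero ?_, hAB.le⟩
        rintro rfl
        have : (0 : ℝ) ≤ A := Nat.cast_nonneg _
        push_cast at hAB
        linarith
    have hc : 0 < c := by
      refine Nat.pos_of_ne_zero ?_
      rintro rfl
      have : (0 : ℝ) ≤ b := Nat.cast_nonneg _
      push_cast at hbc
      linarith
    have hle' : (k : ℝ) * (n * n) * (B * (c * c)) ≤
        k * (A * (c * c)) + (k + 1) * (n * n) * (b * b * B) := by exact_mod_cast hle
    have hB' : (0 : ℝ) < B := by exact_mod_cast hA.1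
    have hc' : (0 : ℝ) < c := by exact_mod_cast hc
    have h1 : (k : ℝ) * (A * (c * c)) ≤ k * (B * ((n : ℝ) ^ 2 - vc) * (c * c)) := by
      have := hA.2
      gcongr
    have h2 : (k + 1 : ℝ) * (n * n) * (b * b * B) ≤
        (k + 1) * (n * n) * ((c * blockProb P 1 w) * (c * blockProb P 1 w) * B) := by
      have hbc' := hbc.le
      have h0 : 0 ≤ c * blockProb P 1 w := mul_nonneg hc'.le (blockProb_nonneg _ _ _)
      gcongr
    have h3 : (B * (c * c) : ℝ) * (k * vc) ≤
        (B * (c * c)) * ((k + 1) * n ^ 2 * blockProb P 1 w ^ 2) := by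
      nlinarith
    exact le_of_mul_le_mul_left h3 (by positivity)
  · intro w hw
    have hlim := tendsto_visitCorr hP (measurableSet_block_eq 1 w.length w)
    have hk' : (0 : ℝ) < k := by exact_mod_cast hk
    set p := blockProb P 1 w with hp
    have hlt : (P : Measure (BiSeq D)).real {y | block y 1 w.length = w} ^ 2 <
        (k + 1) / k * p ^ 2 := by
      rw [show (P : Measure (BiSeq D)).real {y | block y 1 w.length = w} = p from rfl]
      have h1 : (1 : ℝ) < (k + 1) / k := by rw [lt_div_iff₀ hk']; linarith
      have h2 : 0 < p ^ 2 := by positivity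
      nlinarith
    obtain ⟨n, hn, hn0⟩ := ((hlim.eventually (eventually_lt_nhds hlt)).and
      (eventually_gt_atTop 0)).exists
    have hn' : (0 : ℝ) < n := by exact_mod_cast hn0
    set vc := visitCorr (P : Measure (BiSeq D)) shift {y | block y 1 w.length = w} n with hvc
    have hvc0 : 0 ≤ vc := Finset.sum_nonneg fun _ _ => Finset.sum_nonneg fun _ _ =>
      measureReal_nonneg
    -- For large `n` the mean ergodic theorem leaves room below `p` for a fraction `b / c` whose
    -- square exceeds this quotient.
    have hsq : k * vc / ((k + 1) * n ^ 2) < p ^ 2 := by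
      rw [div_lt_iff₀ (by positivity)] at hn ⊢
      have h3 : (k + 1) / k * p ^ 2 * n ^ 2 = p ^ 2 * ((k + 1) * n ^ 2) / k := by
        field_simp
      rw [h3, lt_div_iff₀ hk'] at hn
      linarith
    obtain ⟨b, c, hc, hb, hbp⟩ := exists_nat_div_btwn hw ((Real.sqrt_lt' hw).2 hsq)
    have hc' : (0 : ℝ) < c := by exact_mod_cast hc
    have hb2 : k * vc / ((k + 1) * n ^ 2) < ((b : ℝ) / c) ^ 2 := by
      rwa [Real.sqrt_lt' (lt_of_le_of_lt (Real.sqrt_nonneg _) hb)] at hb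
    rw [div_lt_iff₀ (by positivity)] at hb2
    rw [div_lt_iff₀ hc'] at hbp
    have hsumeq := sum_missIndex (P := P) w n
    have hS0 : 0 ≤ (n : ℝ) ^ 2 - vc := by
      rw [← hsumeq]; exact Finset.sum_nonneg fun _ _ => blockProb_nonneg _ _ _
    obtain ⟨A, B, hAB, hB, hfin⟩ : ∃ A B : ℕ,
        ((A, B) = (0, 1) ∨ (A : ℝ) < B * ((n : ℝ) ^ 2 - vc)) ∧ 0 < B ∧
        (k : ℝ) * (n * n) ≤ k * (A / B) + (k + 1) * n ^ 2 * (b / c) ^ 2 := by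
      rcases hS0.eq_or_lt with h0 | h0
      · refine ⟨0, 1, Or.inl rfl, one_pos, ?_⟩
        have : vc = (n : ℝ) ^ 2 := by linarith
        rw [this] at hb2
        simp only [Nat.cast_zero, zero_div, mul_zero, zero_add]
        nlinarith
      · have h4 : (n : ℝ) ^ 2 - (k + 1) * n ^ 2 * (b / c) ^ 2 / k < (n : ℝ) ^ 2 - vc := by
          have : vc < (k + 1) * n ^ 2 * (b / c) ^ 2 / k := by
            rw [lt_div_iff₀ hk']; linarith
          linarith
        obtain ⟨A, B, hB, h5, h6⟩ := exists_nat_div_btwn h0 h4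
        have hB' : (0 : ℝ) < B := by exact_mod_cast hB
        refine ⟨A, B, Or.inr ?_, hB, ?_⟩
        · rw [div_lt_iff₀ hB'] at h6; linarith
        · have h7 := mul_le_mul_of_nonneg_left h5.le hk'.le
          rw [mul_sub, mul_div_cancel₀ _ hk'.ne'] at h7
          linarith
    refine ⟨n, ((A, B), (b, c)), ?_, ?_, hn0, ?_⟩
    · simp only [sum_missIndex]
      exact hAB
    · show (b : ℝ) < c * p
      linarith
    · have hB' : (0 : ℝ) < B := by exact_mod_cast hB
      have h8 := mul_le_mul_of_nonneg_right hfin (show (0 : ℝ) ≤ B * (c * c) by positivity)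
      have h9 : (k * ((A : ℝ) / B) + (k + 1) * n ^ 2 * (b / c) ^ 2) * (B * (c * c)) =
          k * (A * (c * c)) + (k + 1) * (n * n) * (b * b * B) := by
        field_simp
      rw [h9] at h8
      have h10 : ((k * (n * n) * (B * (c * c)) : ℕ) : ℝ) ≤
          ((k * (A * (c * c)) + (k + 1) * (n * n) * (b * b * B) : ℕ) : ℝ) := by
        push_cast; exact h8
      exact_mod_cast h10

end SecondMoment

/-! ### Orbits of random points leave enumerable open sets of probability below one -/

/-- Stationarity lets a window around the origin be replaced by the same string at positions from
`1` on, for which the second moments were bounded. -/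
theorem visitCorr_preimage_iterate {Ω : Type*} [MeasurableSpace Ω] {μ : Measure Ω} {T : Ω → Ω}
    (hT : MeasurePreserving T μ μ) {C : Set Ω} (hC : MeasurableSet C) (m n : ℕ) :
    visitCorr μ T (T^[m] ⁻¹' C) n = visitCorr μ T C n := by
  refine Finset.sum_congr rfl fun i _ => Finset.sum_congr rfl fun j _ => ?_
  rw [measureReal_def, measureReal_def, ← (hT.iterate m).measure_preimage
    ((hC.preimage (hT.iterate i).measurable).inter
      (hC.preimage (hT.iterate j).measurable)).nullMeasurableSet]
  congr 2
  ext y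
  simp only [Set.mem_inter_iff, Set.mem_preimage, ← Function.iterate_add_apply]
  rw [add_comm m i, add_comm m j]

/-- The union of the cylinders in `V`. -/
def cylUnion (V : List (Fin D) × List (Fin D) → Prop) : Set (BiSeq D) :=
  {y | ∃ p, V p ∧ y ∈ cylinder p.1 p.2}

/-- The window `v` witnesses that the point is in `cylUnion V` after `i` shifts. -/
def Witness (V : List (Fin D) × List (Fin D) → Prop) (v : List (Fin D)) (i : ℕ) : Prop :=
  ∃ (p : List (Fin D) × List (Fin D)) (l r : List (Fin D)), V p ∧
    -- The equation of lengths puts the border between `p.1` and `p.2` exactly `i` places to the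
    -- right of the centre of `v`.
    (v = l ++ ((p.1 ++ p.2) ++ r) ∧ 2 * (l.length + p.1.length) = v.length + 2 * i)

theorem ceIn_witness {s : BiSeq D} {V : List (Fin D) × List (Fin D) → Prop} (hV : CEIn s V) :
    CEIn s fun q : List (Fin D) × ℕ => Witness V q.1 q.2 := by
  have h : CEIn s fun z : (((List (Fin D) × ℕ) × (List (Fin D) × List (Fin D))) × List (Fin D)) ×
      List (Fin D) => V z.1.1.2 ∧ (z.1.1.1.1 = z.1.2 ++ ((z.1.1.2.1 ++ z.1.1.2.2) ++ z.2) ∧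
        2 * (z.1.2.length + z.1.1.2.1.length) = z.1.1.1.1.length + 2 * z.1.1.1.2) := by
    have gq : Primrec fun z : (((List (Fin D) × ℕ) × (List (Fin D) × List (Fin D))) ×
      List (Fin D)) × List (Fin D) => z.1.1.1 := Primrec.fst.comp (Primrec.fst.comp Primrec.fst)
    have gp : Primrec fun z : (((List (Fin D) × ℕ) × (List (Fin D) × List (Fin D))) ×
      List (Fin D)) × List (Fin D) => z.1.1.2 := Primrec.snd.comp (Primrec.fst.comp Primrec.fst)
    have gl : Primrec fun z : (((List (Fin D) × ℕ) × (List (Fin D) × List (Fin D))) ×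
      List (Fin D)) × List (Fin D) => z.1.2 := Primrec.snd.comp Primrec.fst
    refine .and (hV.comp gp.to_comp) (.of_primrecPred (.and ?_ ?_))
    · exact Primrec.eq.comp (Primrec.fst.comp gq) (Primrec.list_append.comp gl
        (Primrec.list_append.comp (Primrec.list_append.comp (Primrec.fst.comp gp)
          (Primrec.snd.comp gp)) Primrec.snd))
    · exact Primrec.eq.comp (Primrec.nat_mul.comp (Primrec.const 2) (Primrec.nat_add.comp
        (Primrec.list_length.comp gl) (Primrec.list_length.comp (Primrec.fst.comp gp))))
        (Primrec.nat_add.comp (Primrec.list_length.comp (Primrec.fst.comp gq))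
          (Primrec.nat_mul.comp (Primrec.const 2) (Primrec.snd.comp gq)))
  exact h.ex.ex.ex

theorem iterate_shift_mem_of_witness {V : List (Fin D) × List (Fin D) → Prop} {y : BiSeq D}
    {N i : ℕ} (h : Witness V (window y N) i) : shift^[i] y ∈ cylUnion V := by
  obtain ⟨p, l, r, hp, hv, hlen⟩ := h
  have hl := congrArg List.length hv
  simp only [length_block, List.length_append] at hl hlen
  have h1 := ((block_eq_append_iff y _ _ l (p.1 ++ p.2) r (by simp; omega)).1 hv).2.1
  refine ⟨p, hp, ?_⟩
  show block _ _ _ = _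
  rw [block_iterate_shift]
  rw [List.length_append] at h1
  convert h1 using 2
  omega

/-- Membership depends on finitely many letters. Since all larger windows also witness it, finitely
many times `i` can share one window. -/
theorem exists_witness_of_iterate_shift_mem {V : List (Fin D) × List (Fin D) → Prop}
    {y : BiSeq D} {i : ℕ} (h : shift^[i] y ∈ cylUnion V) :
    ∃ N₀, ∀ N ≥ N₀, Witness V (window y N) i := by
  obtain ⟨p, hp, hy⟩ := h
  replace hy : block _ _ _ = _ := hy
  rw [block_iterate_shift] at hy
  refine ⟨p.1.length + p.2.length + i, fun N hN => ?_⟩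
  obtain ⟨l, r, h1, hl, -⟩ := exists_block_eq_append y (1 - (N : ℤ)) (2 * N)
    (N + i - p.1.length) (p.1.length + p.2.length) (by omega)
  refine ⟨p, l, r, hp, ?_, ?_⟩
  · rw [window, h1, ← hy]
    congr 3
    omega
  · rw [length_block, hl]; omega

theorem exists_forall_witness {V : List (Fin D) × List (Fin D) → Prop}
    {y : BiSeq D} {n : ℕ} (h : ∀ i < n, shift^[i] y ∈ cylUnion V) :
    ∃ N, ∀ i < n, Witness V (window y N) i := by
  choose! N₀ hN₀ using fun i hi => exists_witness_of_iterate_shift_mem (h i hi)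
  refine ⟨(Finset.range n).sup N₀, fun i hi => hN₀ i hi _ ?_⟩
  exact Finset.le_sup (f := N₀) (Finset.mem_range.2 hi)

theorem isCentral_window_iff (y : BiSeq D) (N : ℕ) (u : List (Fin D)) :
    IsCentral u (window y N) ↔ ∃ M ≤ N, u = window y M := by
  rw [window, isCentral_block_iff]
  constructor
  · rintro ⟨k, hk, hu⟩
    refine ⟨N - k, by omega, ?_⟩
    have h1 : u.length = 2 * (N - k) := by omega
    rw [window, ← h1]
    convert hu using 2
    omega
  · rintro ⟨M, hM, rfl⟩
    refine ⟨N - M, by simp; omega, ?_⟩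
    rw [window, length_block]
    congr 1
    omega

/-- The points with window `v`. -/
def windowSet (v : List (Fin D)) : Set (BiSeq D) := {y | ∃ N, window y N = v}

theorem mem_windowSet_iff {v : List (Fin D)} {N : ℕ} (hv : v.length = 2 * N) (y : BiSeq D) :
    y ∈ windowSet v ↔ window y N = v := by
  constructor
  · rintro ⟨M, rfl⟩
    simp only [length_block] at hv
    rw [show N = M by omega]
  · exact fun h => ⟨N, h⟩

theorem windowSet_eq {v : List (Fin D)} {N : ℕ} (hv : v.length = 2 * N) :
    windowSet v = {y | window y N = v} := Set.ext fun y => mem_windowSet_iff hv y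

theorem measurableSet_windowSet (v : List (Fin D)) : MeasurableSet (windowSet v) := by
  have : windowSet v = ⋃ N : ℕ, {y | window y N = v} := by ext y; simp [windowSet]
  rw [this]
  exact MeasurableSet.iUnion fun N => measurableSet_block_eq _ _ _

/-! ### Refining a window so that only a fraction of its probability survives. -/

section Escape

variable {s : BiSeq D} {P : ProbabilityMeasure (BiSeq D)}

/-- The test `S` is met at the code `j` by the part of `v` of length `2 * j.unpair.1`. -/
def AtCode (S : (List (Fin D) × ℕ) × ℕ → Prop) (q : (List (Fin D) × ℕ) × ℕ) : Prop :=
  ∃ u, (IsCentral u q.1.1 ∧ u.length = 2 * q.2.unpair.1) ∧ S ((u, q.1.2), q.2.unpair.2)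

theorem ceIn_atCode {S : (List (Fin D) × ℕ) × ℕ → Prop} (hS : CEIn s S) :
    CEIn s (AtCode S) := by
  have gu : Primrec fun z : ((List (Fin D) × ℕ) × ℕ) × List (Fin D) => z.1.2.unpair :=
    Primrec.unpair.comp (Primrec.snd.comp Primrec.fst)
  have gv : Primrec fun z : ((List (Fin D) × ℕ) × ℕ) × List (Fin D) => z.1.1.1 :=
    Primrec.fst.comp (Primrec.fst.comp Primrec.fst)
  have gn : Primrec fun z : ((List (Fin D) × ℕ) × ℕ) × List (Fin D) => z.1.1.2 :=
    Primrec.snd.comp (Primrec.fst.comp Primrec.fst)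
  have h1 : CEIn s fun z : ((List (Fin D) × ℕ) × ℕ) × List (Fin D) => IsCentral z.2 z.1.1.1 :=
    .of_rePred (rePred_isCentral.comp
      (f := fun z : ((List (Fin D) × ℕ) × ℕ) × List (Fin D) => (z.2, z.1.1.1))
      (Primrec.snd.pair gv).to_comp)
  have h2 : PrimrecPred fun z : ((List (Fin D) × ℕ) × ℕ) × List (Fin D) =>
      z.2.length = 2 * z.1.2.unpair.1 :=
    Primrec.eq.comp (Primrec.list_length.comp Primrec.snd)
      (Primrec.nat_mul.comp (Primrec.const 2) (Primrec.fst.comp gu))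
  have h3 : CEIn s fun z : ((List (Fin D) × ℕ) × ℕ) × List (Fin D) =>
      S ((z.2, z.1.1.2), z.1.2.unpair.2) :=
    hS.comp ((Primrec.snd.pair gn).pair (Primrec.snd.comp gu)).to_comp
  exact ((h1.and (.of_primrecPred h2)).and h3).ex

/-- Code `j` asks about a window of radius `j.unpair.1 ≤ j`, so every window of radius at least `j`
gives the same answer. This makes the first successful code a property of the point alone. -/
theorem atCode_window_iff (S : (List (Fin D) × ℕ) × ℕ → Prop) (y : BiSeq D) {M n j : ℕ}
    (hj : j ≤ M) :
    AtCode S ((window y M, n), j) ↔ S ((window y j.unpair.1, n), j.unpair.2) := by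
  constructor
  · rintro ⟨u, ⟨hu, hl⟩, h⟩
    obtain ⟨m, -, rfl⟩ := (isCentral_window_iff y M u).1 hu
    simp only [length_block] at hl
    rwa [show m = j.unpair.1 by omega] at h
  · intro h
    exact ⟨_, ⟨(isCentral_window_iff y M _).2
      ⟨_, (Nat.unpair_left_le j).trans hj, rfl⟩, by simp⟩, h⟩

/-- For every `n`, the points with a window in `G (·, n)` can be partitioned enumerably by windows
that extend a given window `w`. -/
theorem exists_first_window {G : List (Fin D) × ℕ → Prop} (hG : CEIn s G) :
    ∃ First : (List (Fin D) × ℕ) × List (Fin D) → Prop, CEIn s First ∧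
      (∀ w n v, First ((w, n), v) → IsCentral w v) ∧
      (∀ y w n M N, First ((w, n), window y M) → First ((w, n), window y N) → M = N) ∧
      (∀ y w n M, First ((w, n), window y M) → ∃ K, G (window y K, n)) ∧
      ∀ y n N, (∃ K, G (window y K, n)) → ∃ M, First ((window y N, n), window y M) := by
  obtain ⟨S, hS, hS', hSG⟩ := hG.exists_stage
  have hMiss : CEIn s fun q : (List (Fin D) × ℕ) × ℕ =>
      ∀ j < q.2, AtCode (fun q => ¬ S q) (q.1, j) := (ceIn_atCode hS').forall_lt
  -- The number `j` is the least code of a radius and a stage that confirm `G`. Extending `w` by `j`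
  -- letters on both sides lets `v` show all codes up to `j`, and the length of `v` in turn
  -- determines `j`; hence at most one window of a point qualifies.
  let First : (List (Fin D) × ℕ) × List (Fin D) → Prop := fun q => ∃ j : ℕ,
    (IsCentral q.1.1 q.2 ∧ q.2.length = q.1.1.length + 2 * j) ∧
      (AtCode S ((q.2, q.1.2), j) ∧ ∀ i < j, AtCode (fun q => ¬ S q) ((q.2, q.1.2), i))
  have hFirst : CEIn s First := by
    have gw : Primrec fun z : ((List (Fin D) × ℕ) × List (Fin D)) × ℕ => z.1.1.1 :=
      Primrec.fst.comp (Primrec.fst.comp Primrec.fst)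
    have gn : Primrec fun z : ((List (Fin D) × ℕ) × List (Fin D)) × ℕ => z.1.1.2 :=
      Primrec.snd.comp (Primrec.fst.comp Primrec.fst)
    have gv : Primrec fun z : ((List (Fin D) × ℕ) × List (Fin D)) × ℕ => z.1.2 :=
      Primrec.snd.comp Primrec.fst
    have h1 : CEIn s fun z : ((List (Fin D) × ℕ) × List (Fin D)) × ℕ =>
        IsCentral z.1.1.1 z.1.2 := .of_rePred (rePred_isCentral.comp
          (f := fun z : ((List (Fin D) × ℕ) × List (Fin D)) × ℕ => (z.1.1.1, z.1.2))
          (gw.pair gv).to_comp)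
    have h2 : PrimrecPred fun z : ((List (Fin D) × ℕ) × List (Fin D)) × ℕ =>
        z.1.2.length = z.1.1.1.length + 2 * z.2 :=
      Primrec.eq.comp (Primrec.list_length.comp gv) (Primrec.nat_add.comp
        (Primrec.list_length.comp gw) (Primrec.nat_mul.comp (Primrec.const 2) Primrec.snd))
    have h3 : CEIn s fun z : ((List (Fin D) × ℕ) × List (Fin D)) × ℕ =>
        AtCode S ((z.1.2, z.1.1.2), z.2) :=
      (ceIn_atCode hS).comp (f := fun z : ((List (Fin D) × ℕ) × List (Fin D)) × ℕ =>
        ((z.1.2, z.1.1.2), z.2)) ((gv.pair gn).pair Primrec.snd).to_comp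
    have h4 : CEIn s fun z : ((List (Fin D) × ℕ) × List (Fin D)) × ℕ =>
        ∀ i < z.2, AtCode (fun q => ¬ S q) ((z.1.2, z.1.1.2), i) :=
      hMiss.comp (f := fun z : ((List (Fin D) × ℕ) × List (Fin D)) × ℕ =>
        ((z.1.2, z.1.1.2), z.2)) ((gv.pair gn).pair Primrec.snd).to_comp
    exact ((h1.and (.of_primrecPred h2)).and (h3.and h4)).ex
  refine ⟨First, hFirst, ?_, ?_, ?_, ?_⟩
  · rintro w n v ⟨j, ⟨h, -⟩, -⟩
    exact h
  · rintro y w n M N ⟨i, ⟨-, hi⟩, hHi, hMi⟩ ⟨j, ⟨-, hj⟩, hHj, hMj⟩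
    simp only [length_block] at hi hj
    have hHi' := (atCode_window_iff S y (by omega)).1 hHi
    have hHj' := (atCode_window_iff S y (by omega)).1 hHj
    rcases lt_trichotomy i j with hlt | rfl | hlt
    · exact absurd hHi' ((atCode_window_iff (fun q => ¬ S q) y (by omega)).1 (hMj i hlt))
    · omega
    · exact absurd hHj' ((atCode_window_iff (fun q => ¬ S q) y (by omega)).1 (hMi j hlt))
  · rintro y w n M ⟨j, ⟨-, hj⟩, hHj, -⟩
    simp only [length_block] at hj
    exact ⟨_, (hSG _).2 ⟨_, (atCode_window_iff S y (by omega)).1 hHj⟩⟩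
  · rintro y n N ⟨K, hK⟩
    obtain ⟨t, ht⟩ := (hSG _).1 hK
    classical
    have hex : ∃ j : ℕ, S ((window y j.unpair.1, n), j.unpair.2) :=
      ⟨Nat.pair K t, by simpa using ht⟩
    refine ⟨N + Nat.find hex, Nat.find hex, ⟨?_, ?_⟩, ?_, ?_⟩
    · exact (isCentral_window_iff _ _ _).2 ⟨N, by omega, rfl⟩
    · simp only [length_block]; ring
    · exact (atCode_window_iff S y (by omega)).2 (Nat.find_spec hex)
    · exact fun i hi => (atCode_window_iff (fun q => ¬ S q) y (by omega)).2 (Nat.find_min hex hi)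

/-- One refinement step: to every window `w` belong windows `v` that extend `w`, define disjoint
events, cover all points of `windowSet w` whose orbit stays in the open set, but capture only a
fraction `r` of the probability of `windowSet w`. -/
theorem exists_refinement (hs : IsRepresentation s P) (hP : StationaryErgodic P)
    {V : List (Fin D) × List (Fin D) → Prop} (hV : CEIn s V)
    (hU : (P : Measure (BiSeq D)).real (cylUnion V) < 1) :
    ∃ r : ℝ, 0 ≤ r ∧ r < 1 ∧ ∃ Next : List (Fin D) × List (Fin D) → Prop, CEIn s Next ∧
      (∀ w v, Next (w, v) → IsCentral w v) ∧
      (∀ y w M N, Next (w, window y M) → Next (w, window y N) → M = N) ∧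
      (∀ w N, w.length = 2 * N → (P : Measure (BiSeq D)).real
        {y | ∃ M, Next (w, window y M)} ≤ r * (P : Measure (BiSeq D)).real (windowSet w)) ∧
      ∀ y N, (∀ i, shift^[i] y ∈ cylUnion V) →
        (P : Measure (BiSeq D)) {z | window z N = window y N} ≠ 0 →
        ∃ M, Next (window y N, window y M) := by
  have hmp : MeasurePreserving shift (P : Measure (BiSeq D)) P := hP.toMeasurePreserving
  have hUm : MeasurableSet (cylUnion V) := measurableSet_union_cylinder V
  set u := (P : Measure (BiSeq D)).real (cylUnion V) with hu
  have hu0 : 0 ≤ u := measureReal_nonneg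
  -- This choice makes `u * ((k + 1) / k) < 1`; the square root of that product will be the fraction
  -- `r`.
  obtain ⟨k, hk⟩ := exists_nat_gt (u / (1 - u))
  rw [div_lt_iff₀ (by linarith)] at hk
  have hk0 : (0 : ℝ) < k := by
    by_contra h
    have : (k : ℝ) * (1 - u) ≤ 0 :=
      mul_nonpos_of_nonpos_of_nonneg (not_lt.1 h) (by linarith)
    linarith
  have hkn : 0 < k := by exact_mod_cast hk0
  have hr1 : u * ((k + 1) / k) < 1 := by
    rw [← mul_div_assoc, div_lt_one hk0]; linarith
  have hr0 : 0 ≤ u * ((k + 1) / k) := by positivity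
  obtain ⟨N, hN, hNs, hNc⟩ := exists_ceIn_visitCorr_le hs hP hkn
  obtain ⟨F, hF, hFN, hFu, hFc⟩ := hN.exists_uniformization
  have hG : CEIn s fun q : List (Fin D) × ℕ => ∀ i < q.2, Witness V q.1 i :=
    (ceIn_witness hV).forall_lt
  obtain ⟨First, hFirst, hcent, huniq, hsound, hcompl⟩ := exists_first_window hG
  -- One time `n` is selected for each `w`, since windows obtained from different times could
  -- overlap.
  let Next : List (Fin D) × List (Fin D) → Prop := fun q =>
    ∃ n, F (q.1, n) ∧ First ((q.1, n), q.2)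
  have hNext : CEIn s Next := by
    have gw : Primrec fun z : (List (Fin D) × List (Fin D)) × ℕ => z.1.1 :=
      Primrec.fst.comp Primrec.fst
    have gv : Primrec fun z : (List (Fin D) × List (Fin D)) × ℕ => z.1.2 :=
      Primrec.snd.comp Primrec.fst
    have h1 : CEIn s fun z : (List (Fin D) × List (Fin D)) × ℕ => F (z.1.1, z.2) :=
      hF.comp (gw.pair Primrec.snd).to_comp
    have h2 : CEIn s fun z : (List (Fin D) × List (Fin D)) × ℕ => First ((z.1.1, z.2), z.1.2) :=
      hFirst.comp ((gw.pair Primrec.snd).pair gv).to_comp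
    exact (h1.and h2).ex
  refine ⟨√(u * ((k + 1) / k)), Real.sqrt_nonneg _, ?_, Next, hNext, ?_, ?_, ?_, ?_⟩
  · rw [Real.sqrt_lt' one_pos]; simpa using hr1
  · rintro w v ⟨n, -, h⟩
    exact hcent w n v h
  · rintro y w M N ⟨m, hm, hM⟩ ⟨n, hn, hN⟩
    obtain rfl := hFu w m n hm hn
    exact huniq y w m M N hM hN
  · intro w N hw
    by_cases hex : ∃ n, F (w, n)
    · obtain ⟨n, hn⟩ := hex
      obtain ⟨hn0, hvc⟩ := hNs w n (hFN _ hn)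
      have hn0' : (0 : ℝ) < n := by exact_mod_cast hn0
      have hsub : {y | ∃ M, Next (w, window y M)} ⊆
          windowSet w ∩ ⋂ i < n, shift^[i] ⁻¹' cylUnion V := by
        rintro y ⟨M, m, hm, hM⟩
        obtain rfl := hFu w m n hm hn
        obtain ⟨K, -, hK⟩ := (isCentral_window_iff y M w).1 (hcent _ _ _ hM)
        obtain ⟨L, hL⟩ := hsound y w m M hM
        exact ⟨⟨K, hK.symm⟩, Set.mem_iInter₂.2 fun i hi =>
          iterate_shift_mem_of_witness (hL i hi)⟩
      have h2 := measureReal_inter_iInter_preimage_le hmp (measurableSet_windowSet w) hUm n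
      have h3 : visitCorr (P : Measure (BiSeq D)) shift (windowSet w) n =
          visitCorr (P : Measure (BiSeq D)) shift {y | block y 1 w.length = w} n := by
        rw [← visitCorr_preimage_iterate hmp (measurableSet_windowSet w) N n]
        congr 1
        ext y
        rw [windowSet_eq hw]
        simp [block_iterate_shift, hw]
      have h4 : (P : Measure (BiSeq D)).real (windowSet w) = blockProb P 1 w := by
        rw [windowSet_eq hw]; exact measureReal_block_eq hmp _ _ _ hw
      rw [h3] at h2
      refine (measureReal_mono hsub).trans ?_
      rw [h4]
      set p := blockProb P 1 w
      set a := (P : Measure (BiSeq D)).real (windowSet w ∩ ⋂ i < n, shift^[i] ⁻¹' cylUnion V)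
      set vc := visitCorr (P : Measure (BiSeq D)) shift {y | block y 1 w.length = w} n
      have hp0 : 0 ≤ p := blockProb_nonneg _ _ _
      have ha0 : 0 ≤ a := measureReal_nonneg
      have h5 : vc ≤ (k + 1) / k * (n ^ 2 * p ^ 2) := by
        rw [div_mul_eq_mul_div, le_div_iff₀ hk0]; linarith
      -- The factor `n ^ 2` cancels: Cauchy-Schwarz bounds the left side by `u * vc`, and `vc` is at
      -- most `(k + 1) / k` times `(n * p) ^ 2`.
      have h6 : (n * a) ^ 2 ≤ (n * (√(u * ((k + 1) / k)) * p)) ^ 2 := by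
        rw [mul_pow (n : ℝ) (_ * p), mul_pow _ p, Real.sq_sqrt hr0]
        refine h2.trans ((mul_le_mul_of_nonneg_left h5 hu0).trans_eq ?_)
        ring
      have h7 := abs_le_of_sq_le_sq' h6 (by positivity) |>.2
      exact le_of_mul_le_mul_left h7 hn0'
    · have : {y | ∃ M, Next (w, window y M)} = ∅ := by
        refine Set.eq_empty_of_forall_notMem ?_
        rintro y ⟨M, m, hm, -⟩
        exact hex ⟨m, hm⟩
      rw [this, measureReal_empty]
      positivity
  · intro y N hy hpos
    have hp : 0 < blockProb P 1 (window y N) := by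
      rw [← measureReal_block_eq hmp (1 - (N : ℤ)) (2 * N) _ (by simp), measureReal_def]
      exact ENNReal.toReal_pos hpos (measure_ne_top _ _)
    obtain ⟨n, hn⟩ := hFc _ (hNc _ hp)
    obtain ⟨K, hK⟩ := exists_forall_witness (n := n) fun i _ => hy i
    obtain ⟨M, hM⟩ := hcompl y n N ⟨K, hK⟩
    exact ⟨M, n, hn, hM⟩

end Escape

/-! ### Iterated refinement as a test, and the frequency bound. -/

section EscapeOrbit

variable {s x : BiSeq D} {P : ProbabilityMeasure (BiSeq D)}

/-- The windows that are reached after `m` steps of `Next` from the empty window. -/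
def ReachedIn (Next : List (Fin D) × List (Fin D) → Prop) (m : ℕ) (v : List (Fin D)) : Prop :=
  Relation.ReflTransGen (fun a b : List (Fin D) × ℕ => Next (a.1, b.1) ∧ b.2 = a.2 + 1)
    ([], 0) (v, m)

theorem ceIn_reachedIn {Next : List (Fin D) × List (Fin D) → Prop} (h : CEIn s Next) :
    CEIn s fun q : ℕ × List (Fin D) => ReachedIn Next q.1 q.2 := by
  have h1 : CEIn s fun z : Unit × ((List (Fin D) × ℕ) × (List (Fin D) × ℕ)) =>
      Next (z.2.1.1, z.2.2.1) ∧ z.2.2.2 = z.2.1.2 + 1 := by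
    have g1 : Primrec fun z : Unit × ((List (Fin D) × ℕ) × (List (Fin D) × ℕ)) => z.2.1 :=
      Primrec.fst.comp Primrec.snd
    have g2 : Primrec fun z : Unit × ((List (Fin D) × ℕ) × (List (Fin D) × ℕ)) => z.2.2 :=
      Primrec.snd.comp Primrec.snd
    refine .and ?_ (.of_primrecPred ?_)
    · exact h.comp (f := fun z : Unit × ((List (Fin D) × ℕ) × (List (Fin D) × ℕ)) =>
        (z.2.1.1, z.2.2.1)) ((Primrec.fst.comp g1).pair (Primrec.fst.comp g2)).to_comp
    · exact Primrec.eq.comp (Primrec.snd.comp g2) (Primrec.succ.comp (Primrec.snd.comp g1))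
  exact h1.reflTransGen.comp (f := fun q : ℕ × List (Fin D) =>
    ((), ((([] : List (Fin D)), 0), (q.2, q.1))))
    ((Primrec.const ()).pair ((Primrec.const ([], 0)).pair
      (Primrec.snd.pair Primrec.fst))).to_comp

variable {Next : List (Fin D) × List (Fin D) → Prop}

theorem reachedIn_zero_iff {v : List (Fin D)} : ReachedIn Next 0 v ↔ v = [] := by
  constructor
  · intro h
    rcases Relation.ReflTransGen.cases_tail h with h | ⟨b, -, -, hb⟩
    · exact (Prod.mk.inj h).1
    · simp at hb
  · rintro rfl
    exact .refl

theorem reachedIn_succ_iff {m : ℕ} {v : List (Fin D)} :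
    ReachedIn Next (m + 1) v ↔ ∃ w, ReachedIn Next m w ∧ Next (w, v) := by
  constructor
  · intro h
    rcases Relation.ReflTransGen.cases_tail h with h | ⟨⟨w, m'⟩, hw, hn, hb⟩
    · simp at h
    · obtain rfl : m = m' := by simpa using hb
      exact ⟨w, hw, hn⟩
  · rintro ⟨w, hw, hn⟩
    exact Relation.ReflTransGen.tail hw ⟨hn, rfl⟩

theorem ReachedIn.exists_length (hcent : ∀ w v, Next (w, v) → IsCentral w v) {m : ℕ}
    {v : List (Fin D)} (h : ReachedIn Next m v) : ∃ N, v.length = 2 * N := by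
  induction m generalizing v with
  | zero => exact ⟨0, by simp [reachedIn_zero_iff.1 h]⟩
  | succ m ih =>
    obtain ⟨w, hw, hn⟩ := reachedIn_succ_iff.1 h
    obtain ⟨N, hN⟩ := ih hw
    obtain ⟨l, r, rfl, hlr⟩ := hcent w v hn
    exact ⟨N + l.length, by simp; omega⟩

-- Disjointness turns the sum over the successors of `w` into the probability of one event, at most
-- `r` times that of `windowSet w`; each step thus gains a factor `r`. A string reached in several
-- ways is only overcounted on the larger side.
open Classical in
theorem tsum_reachedIn_le {r : ℝ} (hr : 0 ≤ r) (hcent : ∀ w v, Next (w, v) → IsCentral w v)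
    (huniq : ∀ y w M N, Next (w, window y M) → Next (w, window y N) → M = N)
    (hle : ∀ w N, w.length = 2 * N → (P : Measure (BiSeq D)).real
        {y | ∃ M, Next (w, window y M)} ≤ r * (P : Measure (BiSeq D)).real (windowSet w))
    (m : ℕ) :
    ∑' v, (if ReachedIn Next m v then (P : Measure (BiSeq D)) (windowSet v) else 0) ≤
      ENNReal.ofReal r ^ m := by
  have hstep : ∀ w N, w.length = 2 * N →
      ∑' v, (if Next (w, v) then (P : Measure (BiSeq D)) (windowSet v) else 0) ≤
        ENNReal.ofReal r * (P : Measure (BiSeq D)) (windowSet w) := by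
    intro w N hw
    let E : List (Fin D) → Set (BiSeq D) := fun v => if Next (w, v) then windowSet v else ∅
    have hE : ∀ v, (if Next (w, v) then (P : Measure (BiSeq D)) (windowSet v) else 0) =
        (P : Measure (BiSeq D)) (E v) := by
      intro v
      by_cases h : Next (w, v) <;> simp [E, h]
    simp only [hE]
    rw [← measure_iUnion]
    · have hsub : (⋃ v, E v) ⊆ {y | ∃ M, Next (w, window y M)} := by
        refine Set.iUnion_subset fun v y hy => ?_
        by_cases h : Next (w, v)
        · simp only [E, h, if_true] at hy
          obtain ⟨M, rfl⟩ := hy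
          exact ⟨M, h⟩
        · simp [E, h] at hy
      refine (measure_mono hsub).trans ?_
      have h1 := ENNReal.ofReal_le_ofReal (hle w N hw)
      rwa [ENNReal.ofReal_mul hr, measureReal_def, measureReal_def,
        ENNReal.ofReal_toReal (measure_ne_top _ _),
        ENNReal.ofReal_toReal (measure_ne_top _ _)] at h1
    · intro v v' hvv
      refine Set.disjoint_left.2 fun y hy hy' => hvv ?_
      by_cases h : Next (w, v)
      · by_cases h' : Next (w, v')
        · simp only [E, h, h', if_true] at hy hy'
          obtain ⟨M, rfl⟩ := hy
          obtain ⟨M', rfl⟩ := hy'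
          rw [huniq y w M M' h h']
        · simp [E, h'] at hy'
      · simp [E, h] at hy
    · intro v
      by_cases h : Next (w, v)
      · simpa [E, h] using measurableSet_windowSet v
      · simp [E, h]
  induction m with
  | zero =>
    rw [tsum_eq_single []]
    · rw [if_pos (reachedIn_zero_iff.2 rfl), pow_zero]
      exact prob_le_one
    · intro v hv
      simp [reachedIn_zero_iff, hv]
  | succ m ih =>
    calc ∑' v, (if ReachedIn Next (m + 1) v then (P : Measure (BiSeq D)) (windowSet v) else 0)
        ≤ ∑' v, ∑' w, (if ReachedIn Next m w then
            (if Next (w, v) then (P : Measure (BiSeq D)) (windowSet v) else 0) else 0) := by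
          refine ENNReal.tsum_le_tsum fun v => ?_
          split_ifs with h
          · obtain ⟨w, hw, hn⟩ := reachedIn_succ_iff.1 h
            refine le_trans ?_ (ENNReal.le_tsum w)
            simp [hw, hn]
          · exact zero_le
      _ = ∑' w, ∑' v, (if ReachedIn Next m w then
            (if Next (w, v) then (P : Measure (BiSeq D)) (windowSet v) else 0) else 0) :=
          ENNReal.tsum_comm
      _ ≤ ∑' w, ENNReal.ofReal r *
            (if ReachedIn Next m w then (P : Measure (BiSeq D)) (windowSet w) else 0) := by
          refine ENNReal.tsum_le_tsum fun w => ?_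
          split_ifs with h
          · obtain ⟨N, hN⟩ := h.exists_length hcent
            exact hstep w N hN
          · simp
      _ ≤ ENNReal.ofReal r ^ (m + 1) := by
          rw [ENNReal.tsum_mul_left, pow_succ']
          gcongr

/-- The orbit of a random point leaves every enumerable open set of probability below one. -/
theorem IsOneRandomWith.exists_iterate_notMem (hx : IsOneRandomWith s P x)
    (hs : IsRepresentation s P) (hP : StationaryErgodic P)
    {V : List (Fin D) × List (Fin D) → Prop} (hV : CEIn s V)
    (hU : (P : Measure (BiSeq D)).real (cylUnion V) < 1) :
    ∃ i, shift^[i] x ∉ cylUnion V := by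
  classical
  obtain ⟨r, hr0, hr1, Next, hNext, hcent, huniq, hle, hcov⟩ := exists_refinement hs hP hV hU
  by_contra hcon
  push Not at hcon
  have hV' : CEIn s fun q : ℕ × (List (Fin D) × List (Fin D)) =>
      q.2.1.length = q.2.2.length ∧ ReachedIn Next q.1 (q.2.1 ++ q.2.2) := by
    have g1 : Primrec fun q : ℕ × (List (Fin D) × List (Fin D)) => q.2.1 :=
      Primrec.fst.comp Primrec.snd
    have g2 : Primrec fun q : ℕ × (List (Fin D) × List (Fin D)) => q.2.2 :=
      Primrec.snd.comp Primrec.snd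
    refine .and (.of_primrecPred ?_) ?_
    · exact Primrec.eq.comp (Primrec.list_length.comp g1) (Primrec.list_length.comp g2)
    · exact (ceIn_reachedIn hNext).comp (f := fun q : ℕ × (List (Fin D) × List (Fin D)) =>
        (q.1, q.2.1 ++ q.2.2)) (Primrec.fst.pair (Primrec.list_append.comp g1 g2)).to_comp
  obtain ⟨m, hm⟩ := hx.exists_notMem_of_le_geometric hV' (C := 1) hr0 hr1 fun m => by
    have hsub : {y : BiSeq D | ∃ p : List (Fin D) × List (Fin D), (p.1.length = p.2.length ∧
        ReachedIn Next m (p.1 ++ p.2)) ∧ y ∈ cylinder p.1 p.2} ⊆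
        ⋃ v, (if ReachedIn Next m v then windowSet v else ∅) := by
      rintro y ⟨p, ⟨hp, hreach⟩, hy⟩
      refine Set.mem_iUnion.2 ⟨p.1 ++ p.2, ?_⟩
      rw [if_pos hreach]
      exact ⟨p.1.length, (mem_cylinder_iff_window rfl hp.symm y).1 hy⟩
    have h1 : (P : Measure (BiSeq D)) {y : BiSeq D | ∃ p : List (Fin D) × List (Fin D),
        (p.1.length = p.2.length ∧ ReachedIn Next m (p.1 ++ p.2)) ∧ y ∈ cylinder p.1 p.2} ≤
        ENNReal.ofReal r ^ m := by
      refine (measure_mono hsub).trans ((measure_iUnion_le _).trans ?_)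
      refine le_trans (le_of_eq (tsum_congr fun v => ?_))
        (tsum_reachedIn_le (P := P) hr0 hcent huniq hle m)
      by_cases h : ReachedIn Next m v <;> simp [h]
    rw [one_mul, measureReal_def]
    refine ENNReal.toReal_le_of_le_ofReal (by positivity) ?_
    rwa [ENNReal.ofReal_pow hr0]
  -- If the orbit never left the set, the point would have a window at every level, as its windows
  -- have positive probability and can always be refined.
  have hreach : ∀ m, ∃ N, ReachedIn Next m (window x N) := by
    intro m
    induction m with
    | zero => exact ⟨0, reachedIn_zero_iff.2 rfl⟩
    | succ m ih =>
      obtain ⟨N, hN⟩ := ih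
      obtain ⟨M, hM⟩ := hcov x N hcon (hx.measure_window_ne_zero N)
      exact ⟨M, reachedIn_succ_iff.2 ⟨_, hN, hM⟩⟩
  obtain ⟨N, hN⟩ := hreach m
  obtain ⟨σ, τ, h, hσ, hτ⟩ := exists_cylinder_eq_window (v := window x N) (N := N) (by simp)
  exact hm (σ, τ) ⟨hσ.trans hτ.symm, by rwa [h]⟩ ((mem_cylinder_iff_window hσ hτ x).2 h.symm)

/-! ### Frequencies of visits along random orbits -/

/-- One step of counting the visits that the window `v` witnesses. -/
def CountStep (V : List (Fin D) × List (Fin D) → Prop) (v : List (Fin D)) (a b : ℕ × ℕ) : Prop :=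
  b.1 = a.1 + 1 ∧ (b.2 = a.2 ∨ b.2 = a.2 + 1 ∧ Witness V v a.1)

/-- Windows that witness a frequency of visits above `A / B`. -/
def FrequentVisits (V : List (Fin D) × List (Fin D) → Prop) (A B : ℕ)
    (p : List (Fin D) × List (Fin D)) : Prop :=
  p.1.length = p.2.length ∧ ∃ c : ℕ × ℕ,
    Relation.ReflTransGen (CountStep V (p.1 ++ p.2)) (0, 0) c ∧ A * c.1 < B * c.2

theorem ceIn_frequentVisits {V : List (Fin D) × List (Fin D) → Prop} (hV : CEIn s V) (A B : ℕ) :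
    CEIn s (FrequentVisits V A B) := by
  have h1 : CEIn s fun z : List (Fin D) × ((ℕ × ℕ) × (ℕ × ℕ)) =>
      CountStep V z.1 z.2.1 z.2.2 := by
    have g1 : Primrec fun z : List (Fin D) × ((ℕ × ℕ) × (ℕ × ℕ)) => z.2.1 :=
      Primrec.fst.comp Primrec.snd
    have g2 : Primrec fun z : List (Fin D) × ((ℕ × ℕ) × (ℕ × ℕ)) => z.2.2 :=
      Primrec.snd.comp Primrec.snd
    refine .and (.of_primrecPred ?_) (.or (.of_primrecPred ?_) (.and (.of_primrecPred ?_) ?_))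
    · exact Primrec.eq.comp (Primrec.fst.comp g2) (Primrec.succ.comp (Primrec.fst.comp g1))
    · exact Primrec.eq.comp (Primrec.snd.comp g2) (Primrec.snd.comp g1)
    · exact Primrec.eq.comp (Primrec.snd.comp g2) (Primrec.succ.comp (Primrec.snd.comp g1))
    · exact (ceIn_witness hV).comp (f := fun z : List (Fin D) × ((ℕ × ℕ) × (ℕ × ℕ)) =>
        (z.1, z.2.1.1)) (Primrec.fst.pair (Primrec.fst.comp g1)).to_comp
  have h2 : CEIn s fun z : (List (Fin D) × List (Fin D)) × (ℕ × ℕ) =>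
      Relation.ReflTransGen (CountStep V (z.1.1 ++ z.1.2)) (0, 0) z.2 :=
    h1.reflTransGen.comp (f := fun z : (List (Fin D) × List (Fin D)) × (ℕ × ℕ) =>
      (z.1.1 ++ z.1.2, (((0 : ℕ), (0 : ℕ)), z.2)))
      ((Primrec.list_append.comp (Primrec.fst.comp Primrec.fst)
        (Primrec.snd.comp Primrec.fst)).pair ((Primrec.const (0, 0)).pair Primrec.snd)).to_comp
  have h3 : PrimrecPred fun z : (List (Fin D) × List (Fin D)) × (ℕ × ℕ) =>
      A * z.2.1 < B * z.2.2 :=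
    Primrec.nat_lt.comp (Primrec.nat_mul.comp (Primrec.const A) (Primrec.fst.comp Primrec.snd))
      (Primrec.nat_mul.comp (Primrec.const B) (Primrec.snd.comp Primrec.snd))
  have h4 : PrimrecPred fun p : List (Fin D) × List (Fin D) => p.1.length = p.2.length :=
    Primrec.eq.comp (Primrec.list_length.comp Primrec.fst) (Primrec.list_length.comp Primrec.snd)
  exact (CEIn.of_primrecPred h4).and (h2.and (.of_primrecPred h3)).ex

/-- Counting may overlook visits, so a count is only a lower bound; but a sufficiently large window
witnesses all visits before time `n`. The event is thereby open and enumerable although visits are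
only semidecidable. -/
theorem cylUnion_frequentVisits (V : List (Fin D) × List (Fin D) → Prop) {A B : ℕ} (hB : 0 < B) :
    cylUnion (FrequentVisits V A B) = {y | ∃ n : ℕ, (A : ℝ) / B * n <
      ∑ i ∈ Finset.range n, (cylUnion V).indicator (fun _ => (1 : ℝ)) (shift^[i] y)} := by
  classical
  have hB' : (0 : ℝ) < B := by exact_mod_cast hB
  ext y
  constructor
  · rintro ⟨p, ⟨hp, ⟨n, κ⟩, hch, hlt⟩, hy⟩
    have hw := (mem_cylinder_iff_window rfl hp.symm y).1 hy
    rw [← hw] at hch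
    have inv : ∀ c : ℕ × ℕ, Relation.ReflTransGen (CountStep V (window y p.1.length)) (0, 0) c →
        (c.2 : ℝ) ≤ ∑ i ∈ Finset.range c.1,
          (cylUnion V).indicator (fun _ => (1 : ℝ)) (shift^[i] y) := by
      intro c hc
      induction hc with
      | refl => simp
      | @tail b c _ hbc ih =>
        obtain ⟨h1, h2⟩ := hbc
        rw [h1, Finset.sum_range_succ]
        rcases h2 with h2 | ⟨h2, hW⟩
        · rw [h2]
          have : 0 ≤ (cylUnion V).indicator (fun _ => (1 : ℝ)) (shift^[b.1] y) :=
            Set.indicator_nonneg (fun _ _ => zero_le_one) _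
          linarith
        · rw [h2, Set.indicator_of_mem (iterate_shift_mem_of_witness hW)]
          push_cast
          linarith
    refine ⟨n, ?_⟩
    have h3 := inv _ hch
    simp only at h3
    rw [div_mul_eq_mul_div, div_lt_iff₀ hB']
    have h4 : (A : ℝ) * n < B * κ := by exact_mod_cast hlt
    nlinarith
  · rintro ⟨n, hn⟩
    have hN : ∀ i, ∃ N₀, ∀ N ≥ N₀, shift^[i] y ∈ cylUnion V → Witness V (window y N) i := by
      intro i
      by_cases h : shift^[i] y ∈ cylUnion V
      · obtain ⟨N₀, h₀⟩ := exists_witness_of_iterate_shift_mem h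
        exact ⟨N₀, fun N hN _ => h₀ N hN⟩
      · exact ⟨0, fun _ _ h' => absurd h' h⟩
    choose N₀ hN₀ using hN
    set N := (Finset.range n).sup N₀ with hNdef
    obtain ⟨σ, τ, h, hσ, hτ⟩ := exists_cylinder_eq_window (v := window y N) (N := N) (by simp)
    refine ⟨(σ, τ), ⟨hσ.trans hτ.symm, ?_⟩, (mem_cylinder_iff_window hσ hτ y).2 h.symm⟩
    simp only [h]
    have key : ∀ m ≤ n, ∃ κ : ℕ,
        Relation.ReflTransGen (CountStep V (window y N)) (0, 0) (m, κ) ∧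
        (κ : ℝ) = ∑ i ∈ Finset.range m,
          (cylUnion V).indicator (fun _ => (1 : ℝ)) (shift^[i] y) := by
      intro m hm
      induction m with
      | zero => exact ⟨0, .refl, by simp⟩
      | succ m ih =>
        obtain ⟨κ, hκ, hκ'⟩ := ih (by omega)
        by_cases hmem : shift^[m] y ∈ cylUnion V
        · refine ⟨κ + 1, hκ.tail ⟨rfl, Or.inr ⟨rfl, hN₀ m N ?_ hmem⟩⟩, ?_⟩
          · exact Finset.le_sup (f := N₀) (Finset.mem_range.2 (by omega))
          · rw [Finset.sum_range_succ, ← hκ', Set.indicator_of_mem hmem]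
            push_cast; ring
        · refine ⟨κ, hκ.tail ⟨rfl, Or.inl rfl⟩, ?_⟩
          rw [Finset.sum_range_succ, ← hκ', Set.indicator_of_notMem hmem, add_zero]
    obtain ⟨κ, hκ, hκ'⟩ := key n le_rfl
    refine ⟨(n, κ), hκ, ?_⟩
    rw [← hκ', div_mul_eq_mul_div, div_lt_iff₀ hB'] at hn
    have : (A : ℝ) * n < B * κ := by linarith
    exact_mod_cast this

/-- The frequency with which the orbit of a random point visits an enumerable open set is
asymptotically at most the probability of that set. -/
theorem IsOneRandomWith.eventually_frequency_le (hx : IsOneRandomWith s P x)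
    (hs : IsRepresentation s P) (hP : StationaryErgodic P)
    {V : List (Fin D) × List (Fin D) → Prop} (hV : CEIn s V) {q : ℝ}
    (hq : (P : Measure (BiSeq D)).real (cylUnion V) < q) :
    ∀ᶠ n : ℕ in atTop, ∑ i ∈ Finset.range n,
      (cylUnion V).indicator (fun _ => (1 : ℝ)) (shift^[i] x) ≤ q * n := by
  have hq0 : 0 < q := measureReal_nonneg.trans_lt hq
  obtain ⟨A, B, hB, hA, hAq⟩ := exists_nat_div_btwn hq0 hq
  have hfreq := measureReal_exists_frequency_gt_lt_one hP.toMeasurePreserving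
    (measurableSet_union_cylinder V) hA
  rw [← show cylUnion V = {y | ∃ p, V p ∧ y ∈ cylinder p.1 p.2} from rfl,
    ← cylUnion_frequentVisits V hB] at hfreq
  -- From time `j` on, no initial stretch of the orbit has a frequency above `A / B`. The first `j`
  -- times are absorbed by the slack `q - A / B`.
  obtain ⟨j, hj⟩ := hx.exists_iterate_notMem hs hP (ceIn_frequentVisits hV A B) hfreq
  rw [cylUnion_frequentVisits V hB] at hj
  have hj' : ∀ n : ℕ, ∑ i ∈ Finset.range n,
      (cylUnion V).indicator (fun _ => (1 : ℝ)) (shift^[j + i] x) ≤ (A : ℝ) / B * n := by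
    intro n
    by_contra hcon
    refine hj ⟨n, ?_⟩
    rw [not_le] at hcon
    simpa only [← Function.iterate_add_apply, add_comm] using hcon
  have hlim : Tendsto (fun n : ℕ => (q - (A : ℝ) / B) * n) atTop atTop :=
    tendsto_natCast_atTop_atTop.const_mul_atTop (by linarith)
  filter_upwards [hlim.eventually_ge_atTop (j : ℝ)] with n hn
  have hind0 : ∀ y, 0 ≤ (cylUnion V).indicator (fun _ => (1 : ℝ)) y :=
    fun y => Set.indicator_nonneg (fun _ _ => zero_le_one) _
  have hind1 : ∀ y, (cylUnion V).indicator (fun _ => (1 : ℝ)) y ≤ 1 :=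
    fun y => Set.indicator_le' (fun _ _ => le_rfl) (fun _ _ => zero_le_one) y
  calc ∑ i ∈ Finset.range n, (cylUnion V).indicator (fun _ => (1 : ℝ)) (shift^[i] x)
      ≤ ∑ i ∈ Finset.range (j + n), (cylUnion V).indicator (fun _ => (1 : ℝ)) (shift^[i] x) :=
        Finset.sum_le_sum_of_subset_of_nonneg
          (Finset.range_subset_range.2 (by omega)) fun _ _ _ => hind0 _
    _ = ∑ i ∈ Finset.range j, (cylUnion V).indicator (fun _ => (1 : ℝ)) (shift^[i] x) +
        ∑ i ∈ Finset.range n, (cylUnion V).indicator (fun _ => (1 : ℝ)) (shift^[j + i] x) :=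
        Finset.sum_range_add _ _ _
    _ ≤ j + (A : ℝ) / B * n := by
        refine add_le_add ?_ (hj' n)
        calc _ ≤ ∑ i ∈ Finset.range j, (1 : ℝ) := Finset.sum_le_sum fun _ _ => hind1 _
          _ = j := by simp
    _ ≤ q * n := by linarith

end EscapeOrbit

/-! ### Convergence of conditional probabilities -/

section CondProb

variable {P : ProbabilityMeasure (BiSeq D)}

theorem block_append_singleton_iff (x : BiSeq D) (j : ℤ) (w : List (Fin D)) (a : Fin D) :
    block x j (w ++ [a]).length = w ++ [a] ↔ block x j w.length = w ∧ x (j + w.length) = a := by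
  rw [List.length_append, List.length_singleton, block_succ]
  simp [List.append_singleton_inj]

theorem blockProb_append_le (j : ℤ) (w : List (Fin D)) (a : Fin D) :
    blockProb P j (w ++ [a]) ≤ blockProb P j w :=
  measureReal_mono fun _ hx => ((block_append_singleton_iff _ _ _ _).1 hx).1

theorem condProb_nonneg (j : ℤ) (w : List (Fin D)) (a : Fin D) : 0 ≤ condProb P j w a :=
  div_nonneg (blockProb_nonneg _ _ _) (blockProb_nonneg _ _ _)

theorem condProb_le_one (j : ℤ) (w : List (Fin D)) (a : Fin D) : condProb P j w a ≤ 1 :=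
  div_le_one_of_le₀ (blockProb_append_le _ _ _) (blockProb_nonneg _ _ _)

theorem blockProb_mul_condProb (j : ℤ) (w : List (Fin D)) (a : Fin D) :
    blockProb P j w * condProb P j w a = blockProb P j (w ++ [a]) := by
  rcases (blockProb_nonneg P j w).eq_or_lt with h | h
  · have h1 := blockProb_append_le (P := P) j w a
    have h2 := blockProb_nonneg P j (w ++ [a])
    rw [← h] at h1 ⊢
    linarith
  · exact mul_div_cancel₀ _ h.ne'

theorem condProb_eq_of_stationary (hP : MeasurePreserving shift (P : Measure (BiSeq D)) P)
    (j : ℤ) (w : List (Fin D)) (a : Fin D) : condProb P j w a = condProb P 1 w a := by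
  unfold condProb
  rw [← measureReal_block_eq hP j w.length w rfl, ← measureReal_block_eq hP j _ (w ++ [a]) rfl]
  rfl

/-- The probability of the most probable letter after `w`. -/
noncomputable def maxCondProb (P : ProbabilityMeasure (BiSeq D)) (w : List (Fin D)) : ℝ :=
  ⨆ a : Fin D, condProb P 1 w a

theorem condProb_le_maxCondProb (w : List (Fin D)) (a : Fin D) :
    condProb P 1 w a ≤ maxCondProb P w :=
  le_ciSup (f := fun a => condProb P 1 w a) (Set.finite_range _).bddAbove a

theorem maxCondProb_nonneg (w : List (Fin D)) : 0 ≤ maxCondProb P w :=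
  Real.iSup_nonneg fun a => condProb_nonneg 1 w a

theorem maxCondProb_le_one (w : List (Fin D)) : maxCondProb P w ≤ 1 :=
  Real.iSup_le (fun a => condProb_le_one 1 w a) zero_le_one

theorem measurable_comp_block {β : Type*} [MeasurableSpace β] (φ : List (Fin D) → β) (j : ℤ)
    (n : ℕ) : Measurable fun x : BiSeq D => φ (block x j n) := by
  intro A _
  exact measurableSet_block_mem j n {w | φ w ∈ A}

/-- The σ-fields generated by the past `n` letters. -/
def pastFiltration (D : ℕ) : Filtration ℕ (inferInstance : MeasurableSpace (BiSeq D)) where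
  seq n := MeasurableSpace.comap (fun x : BiSeq D => block x (-(n : ℤ)) n) ⊤
  mono' := by
    refine monotone_nat_of_le_succ fun n => ?_
    rintro _ ⟨A, -, rfl⟩
    -- The longer past has one more letter at its left end, so its tail is the shorter past.
    refine ⟨List.tail ⁻¹' A, trivial, ?_⟩
    ext x
    have h : block x (-((n + 1 : ℕ) : ℤ)) (n + 1) =
        block x (-((n + 1 : ℕ) : ℤ)) 1 ++ block x (-(n : ℤ)) n := by
      rw [add_comm n 1, block_add]
      congr 2
      push_cast
      ring
    simp only [Set.mem_preimage, h]
    simp [block_eq_map]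
  le' n := by
    rintro _ ⟨A, -, rfl⟩
    exact measurableSet_block_mem _ _ A

/-- Elementary conditional probabilities are identified with conditional expectations so that Lévy's
upward theorem applies to them. -/
theorem condProb_ae_eq_condExp (n : ℕ) (a : Fin D) :
    (fun x => condProb P (-(n : ℤ)) (block x (-(n : ℤ)) n) a) =ᵐ[(P : Measure (BiSeq D))]
      (P : Measure (BiSeq D))[{x : BiSeq D | x 0 = a}.indicator (fun _ => (1 : ℝ)) |
        pastFiltration D n] := by
  classical
  have hmeas0 : MeasurableSet {x : BiSeq D | x 0 = a} :=
    measurableSet_eq_fun (measurable_pi_apply 0) measurable_const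
  have hInt : Integrable (fun x => condProb P (-(n : ℤ)) (block x (-(n : ℤ)) n) a)
      (P : Measure (BiSeq D)) := by
    refine Integrable.of_bound (measurable_comp_block
      (fun w => condProb P (-(n : ℤ)) w a) _ _).aestronglyMeasurable 1 (ae_of_all _ fun x => ?_)
    rw [Real.norm_of_nonneg (condProb_nonneg _ _ _)]
    exact condProb_le_one _ _ _
  have hInt' : Integrable ({x : BiSeq D | x 0 = a}.indicator fun _ => (1 : ℝ))
      (P : Measure (BiSeq D)) := (integrable_const _).indicator hmeas0
  refine ae_eq_condExp_of_forall_setIntegral_eq ((pastFiltration D).le n) hInt'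
    (fun _ _ _ => hInt.integrableOn) ?_ ?_
  · rintro _ ⟨A, -, rfl⟩ -
    have hset : (fun x : BiSeq D => block x (-(n : ℤ)) n) ⁻¹' A =
        ⋃ v ∈ (words D n).filter (· ∈ A), {x | block x (-(n : ℤ)) n = v} := by
      ext x
      simp
    have hdisj : Set.Pairwise (↑((words D n).filter (· ∈ A)))
        (Function.onFun Disjoint fun v => {x : BiSeq D | block x (-(n : ℤ)) n = v}) := by
      intro v _ v' _ hvv
      exact Set.disjoint_left.2 fun y hy hy' => hvv (hy.symm.trans hy')
    rw [hset, integral_biUnion_finset _ (fun v _ => measurableSet_block_eq _ _ v) hdisj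
      (fun v _ => hInt.integrableOn), integral_biUnion_finset _
      (fun v _ => measurableSet_block_eq _ _ v) hdisj (fun v _ => hInt'.integrableOn)]
    refine Finset.sum_congr rfl fun v hv => ?_
    rw [Finset.mem_filter, mem_words] at hv
    rw [setIntegral_congr_fun (g := fun _ => condProb P (-(n : ℤ)) v a)
      (measurableSet_block_eq _ _ v) (fun x hx => by
        replace hx : block x (-(n : ℤ)) n = v := hx
        simp only [hx]), setIntegral_const, setIntegral_indicator hmeas0, setIntegral_const]
    simp only [smul_eq_mul, mul_one]
    have h1 : (P : Measure (BiSeq D)).real {x | block x (-(n : ℤ)) n = v} =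
        blockProb P (-(n : ℤ)) v := by rw [blockProb, hv.1]
    rw [h1, blockProb_mul_condProb, blockProb]
    congr 1
    ext x
    have h2 := block_append_singleton_iff x (-(n : ℤ)) v a
    rw [hv.1] at h2
    simpa using h2
  · have h1 : Measurable[pastFiltration D n]
        fun x : BiSeq D => condProb P (-(n : ℤ)) (block x (-(n : ℤ)) n) a := by
      have h2 : Measurable[pastFiltration D n, ⊤] fun x : BiSeq D => block x (-(n : ℤ)) n :=
        fun A hA => ⟨A, hA, rfl⟩
      exact (measurable_from_top (f := fun w => condProb P (-(n : ℤ)) w a)).comp h2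
    exact h1.stronglyMeasurable.aestronglyMeasurable

/-- The largest conditional probability given longer and longer pasts converges. -/
theorem exists_tendsto_maxCondProb [NeZero D]
    (hP : MeasurePreserving shift (P : Measure (BiSeq D)) P) :
    ∃ G : BiSeq D → ℝ, Measurable G ∧ ∀ᵐ x ∂(P : Measure (BiSeq D)),
      Tendsto (fun n : ℕ => maxCondProb P (block x (-(n : ℤ)) n)) atTop (𝓝 (G x)) := by
  let φ : Fin D → BiSeq D → ℝ := fun a =>
    (P : Measure (BiSeq D))[{x : BiSeq D | x 0 = a}.indicator (fun _ => (1 : ℝ)) |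
        ⨆ n, pastFiltration D n]
  refine ⟨fun x => Finset.univ.sup' Finset.univ_nonempty fun a => φ a x, ?_, ?_⟩
  · have h : ∀ a, Measurable (φ a) := fun a =>
      (stronglyMeasurable_condExp.mono
        (iSup_le fun n => (pastFiltration D).le n)).measurable
    have h' := Finset.measurable_sup' (s := (Finset.univ : Finset (Fin D))) Finset.univ_nonempty
      fun a _ => h a
    convert h' using 1
    ext x
    rw [Finset.sup'_apply]
  · have h1 : ∀ᵐ x ∂(P : Measure (BiSeq D)), ∀ a, Tendsto
        (fun n : ℕ => condProb P 1 (block x (-(n : ℤ)) n) a) atTop (𝓝 (φ a x)) := by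
      rw [ae_all_iff]
      intro a
      have h2 : ∀ᵐ x ∂(P : Measure (BiSeq D)), ∀ n : ℕ,
          condProb P (-(n : ℤ)) (block x (-(n : ℤ)) n) a =
          ((P : Measure (BiSeq D))[{x : BiSeq D | x 0 = a}.indicator (fun _ => (1 : ℝ)) |
            pastFiltration D n]) x := ae_all_iff.2 fun n => condProb_ae_eq_condExp n a
      filter_upwards [h2, tendsto_ae_condExp (ℱ := pastFiltration D)
        ({x : BiSeq D | x 0 = a}.indicator fun _ => (1 : ℝ))] with x hx hlim
      refine hlim.congr fun n => ?_
      rw [← hx n, condProb_eq_of_stationary hP]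
    filter_upwards [h1] with x hx
    have h3 := Filter.Tendsto.finset_sup'_nhds_apply (s := (Finset.univ : Finset (Fin D)))
      Finset.univ_nonempty fun a _ => hx a
    refine h3.congr fun n => ?_
    rw [maxCondProb, Finset.sup'_univ_eq_ciSup]

end CondProb

/-! ### Averages of functions of the past along random orbits -/

-- A discrete layer-cake formula: the number of levels `1, ..., m` below `t` is `t`, capped at `m`,
-- up to an error of `1`. The closed levels are used for the limit, the open ones in
-- `min_le_sum_indicator_succ_lt` for the values along the orbit.
open Classical in
theorem sum_indicator_succ_le_le {t : ℝ} (ht : 0 ≤ t) (m : ℕ) :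
    ∑ j ∈ Finset.range m, (if ((j : ℝ) + 1) ≤ t then (1 : ℝ) else 0) ≤ t := by
  induction m with
  | zero => simpa
  | succ m ih =>
    rw [Finset.sum_range_succ]
    split_ifs with h
    · have h1 : ∑ j ∈ Finset.range m, (if ((j : ℝ) + 1) ≤ t then (1 : ℝ) else 0) ≤
          ∑ j ∈ Finset.range m, (1 : ℝ) :=
        Finset.sum_le_sum fun j _ => by split_ifs <;> norm_num
      simp only [Finset.sum_const, Finset.card_range, nsmul_eq_mul, mul_one] at h1
      linarith
    · linarith

open Classical in
theorem min_le_sum_indicator_succ_lt (t : ℝ) (m : ℕ) :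
    min (t - 1) m ≤ ∑ j ∈ Finset.range m, (if ((j : ℝ) + 1) < t then (1 : ℝ) else 0) := by
  induction m with
  | zero => simp
  | succ m ih =>
    rw [Finset.sum_range_succ]
    push_cast
    split_ifs with h
    · rw [min_eq_right (by linarith)] at ih
      exact (min_le_right _ _).trans (by linarith)
    · rw [min_eq_left (by linarith)] at ih
      exact (min_le_left _ _).trans (by linarith)

section Breiman

variable {s x : BiSeq D} {P : ProbabilityMeasure (BiSeq D)}

theorem ae_blockProb_pos (hP : MeasurePreserving shift (P : Measure (BiSeq D)) P) :
    ∀ᵐ y ∂(P : Measure (BiSeq D)), ∀ n : ℕ, 0 < blockProb P 1 (block y (1 - (n : ℤ)) n) := by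
  rw [ae_all_iff]
  intro n
  have h : ∀ w : List (Fin D), ∀ᵐ y ∂(P : Measure (BiSeq D)),
      blockProb P 1 w = 0 → w.length = n → block y (1 - (n : ℤ)) n ≠ w := by
    intro w
    by_cases hw : blockProb P 1 w = 0 ∧ w.length = n
    · have h0 : (P : Measure (BiSeq D)) {y | block y (1 - (n : ℤ)) n = w} = 0 := by
        rw [← measureReal_block_eq hP (1 - (n : ℤ)) n w hw.2] at hw
        exact (measureReal_eq_zero_iff).1 hw.1
      filter_upwards [measure_eq_zero_iff_ae_notMem.1 h0] with y hy _ _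
      exact hy
    · exact ae_of_all _ fun y h1 h2 => absurd ⟨h1, h2⟩ hw
  filter_upwards [ae_all_iff.2 h] with y hy
  exact lt_of_le_of_ne (blockProb_nonneg _ _ _) fun h0 => hy _ h0.symm (by simp) rfl

/-- The points that have a past of length at least `k` in `Z`. -/
def PastCylinder (Z : List (Fin D) → Prop) (k : ℕ) (p : List (Fin D) × List (Fin D)) : Prop :=
  Z p.1 ∧ k ≤ p.1.length ∧ p.2 = []

theorem ceIn_pastCylinder {Z : List (Fin D) → Prop} (hZ : CEIn s Z) (k : ℕ) :
    CEIn s (PastCylinder Z k) := by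
  refine .and (hZ.comp Computable.fst) (.of_primrecPred (.and ?_ ?_))
  · exact Primrec.nat_le.comp (Primrec.const k) (Primrec.list_length.comp Primrec.fst)
  · exact Primrec.eq.comp Primrec.snd (Primrec.const [])

theorem mem_cylUnion_pastCylinder {Z : List (Fin D) → Prop} {k : ℕ} {y : BiSeq D} :
    y ∈ cylUnion (PastCylinder Z k) ↔ ∃ n ≥ k, Z (block y (1 - (n : ℤ)) n) := by
  constructor
  · rintro ⟨⟨σ, τ⟩, ⟨hZ, hk, rfl⟩, hy⟩
    replace hy : block y (-(σ.length : ℤ) + 1) (σ.length + 0) = σ ++ [] := hy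
    refine ⟨σ.length, hk, ?_⟩
    rw [List.append_nil, add_zero, neg_add_eq_sub] at hy
    rwa [hy]
  · rintro ⟨n, hn, hZ⟩
    refine ⟨(block y (1 - (n : ℤ)) n, []), ⟨hZ, by simpa using hn, rfl⟩, ?_⟩
    show block y _ _ = _
    simp only [length_block, List.length_nil, add_zero, List.append_nil]
    rw [neg_add_eq_sub]

/-- If `h` of the past converges almost surely to `H` and lower bounds of `h` are enumerable,
then the averages of `h` along a random point are asymptotically at most the mean of `H`. -/
theorem IsOneRandomWith.eventually_sum_past_le (hx : IsOneRandomWith s P x)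
    (hs : IsRepresentation s P) (hP : StationaryErgodic P) {h : List (Fin D) → ℝ}
    (h0 : ∀ w, 0 ≤ h w) (h1 : ∀ w, h w ≤ 1)
    (hZ : ∀ j M : ℕ, 0 < M → ∃ Z : List (Fin D) → Prop, CEIn s Z ∧
      ∀ w, 0 < blockProb P 1 w → (Z w ↔ (j : ℝ) / M < h w))
    {H : BiSeq D → ℝ} (hH : Measurable H)
    (hlim : ∀ᵐ y ∂(P : Measure (BiSeq D)),
      Tendsto (fun n : ℕ => h (block y (-(n : ℤ)) n)) atTop (𝓝 (H y)))
    {ε : ℝ} (hε : 0 < ε) :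
    ∀ᶠ n : ℕ in atTop, ∑ i ∈ Finset.range n, h (block x 1 i) ≤
      ((∫ y, H y ∂(P : Measure (BiSeq D))) + ε) * n := by
  classical
  have hmp : MeasurePreserving shift (P : Measure (BiSeq D)) P := hP.toMeasurePreserving
  set μ : Measure (BiSeq D) := (P : Measure (BiSeq D)) with hμ
  -- The orbit point `shift^[i] x` carries `x_1^i` at the positions `1 - i, ..., 0`, whereas `H`
  -- belongs to pasts that end at `-1`; one shift reconciles them.
  let K : BiSeq D → ℝ := fun y => H (shift y)
  have hK : Measurable K := hH.comp hmp.measurable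
  have hKlim : ∀ᵐ y ∂μ, Tendsto (fun n : ℕ => h (block y (1 - (n : ℤ)) n)) atTop (𝓝 (K y)) := by
    filter_upwards [hmp.quasiMeasurePreserving.ae hlim] with y hy
    refine hy.congr fun n => ?_
    have := block_iterate_shift y 1 (-(n : ℤ)) n
    rw [Function.iterate_one] at this
    rw [this, Nat.cast_one, neg_add_eq_sub]
  have hK01 : ∀ᵐ y ∂μ, 0 ≤ K y ∧ K y ≤ 1 := by
    filter_upwards [hKlim] with y hy
    exact ⟨ge_of_tendsto' hy fun n => h0 _, le_of_tendsto' hy fun n => h1 _⟩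
  have hKint : Integrable K μ := by
    refine Integrable.of_bound hK.aestronglyMeasurable 1 ?_
    filter_upwards [hK01] with y hy
    rw [Real.norm_of_nonneg hy.1]
    exact hy.2
  have hKH : ∫ y, K y ∂μ = ∫ y, H y ∂μ := by
    conv_rhs => rw [← hmp.map_eq]
    rw [integral_map hmp.measurable.aemeasurable]
    exact hH.aestronglyMeasurable
  obtain ⟨M, hM⟩ := exists_nat_gt (3 / ε)
  have hM0' : (0 : ℝ) < M := lt_trans (by positivity) hM
  have hM0 : 0 < M := by exact_mod_cast hM0'
  have hMε : 1 / (M : ℝ) < ε / 3 := by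
    rw [div_lt_div_iff₀ hM0' (by norm_num)]
    rw [div_lt_iff₀ hε] at hM
    linarith
  choose Z hZce hZiff using fun j => hZ (j + 1) M hM0
  -- The length of the past grows along the orbit, so no single function is averaged. These sets
  -- take all lengths from `k` on at once: they are open and enumerable, and they decrease in `k` to
  -- an event on which the limit is almost surely at least `(j + 1) / M`.
  let O : ℕ → ℕ → Set (BiSeq D) := fun j k => cylUnion (PastCylinder (Z j) k)
  have hOm : ∀ j k, MeasurableSet (O j k) := fun j k => measurableSet_union_cylinder _
  have hOlim : ∀ j, Tendsto (fun k => μ.real (O j k)) atTop (𝓝 (μ.real (⋂ k, O j k))) := by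
    intro j
    have hanti : Antitone (O j) := by
      intro k k' hkk y hy
      obtain ⟨n, hn, hz⟩ := mem_cylUnion_pastCylinder.1 hy
      exact mem_cylUnion_pastCylinder.2 ⟨n, hkk.trans hn, hz⟩
    exact (ENNReal.tendsto_toReal (measure_ne_top _ _)).comp
      (tendsto_measure_iInter_atTop (fun k => (hOm j k).nullMeasurableSet) hanti
        ⟨0, measure_ne_top _ _⟩)
  let A : ℕ → Set (BiSeq D) := fun j => {y | (((j + 1 : ℕ) : ℝ)) / M ≤ K y}
  have hAm : ∀ j, MeasurableSet (A j) := fun j => measurableSet_le measurable_const hK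
  have hOA : ∀ j, μ.real (⋂ k, O j k) ≤ μ.real (A j) := by
    intro j
    refine ENNReal.toReal_mono (measure_ne_top _ _) (measure_mono_ae ?_)
    filter_upwards [hKlim, ae_blockProb_pos hmp] with y hy hpos hmem
    refine ge_of_tendsto_of_frequently hy (frequently_atTop.2 fun k => ?_)
    obtain ⟨n, hn, hz⟩ := mem_cylUnion_pastCylinder.1 (Set.mem_iInter.1 hmem k)
    exact ⟨n, hn, ((hZiff j _ (hpos n)).1 hz).le⟩
  have hsumA : ∑ j ∈ Finset.range M, μ.real (A j) ≤ M * ∫ y, K y ∂μ := by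
    have h2 : ∀ j, μ.real (A j) = ∫ y, (A j).indicator (fun _ => (1 : ℝ)) y ∂μ := by
      intro j
      rw [integral_indicator (hAm j)]
      simp
    simp only [h2]
    rw [← integral_finsetSum _ fun j _ => (integrable_const _).indicator (hAm j),
      ← integral_const_mul]
    refine integral_mono_ae (integrable_finsetSum _ fun j _ =>
      (integrable_const _).indicator (hAm j)) (hKint.const_mul _) ?_
    filter_upwards [hK01] with y hy
    have h3 := sum_indicator_succ_le_le (t := M * K y) (mul_nonneg hM0'.le hy.1) M
    refine le_trans (le_of_eq (Finset.sum_congr rfl fun j _ => ?_)) h3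
    simp only [Set.indicator, A, Set.mem_ofPred_eq]
    congr 1
    rw [div_le_iff₀ hM0', mul_comm]
    push_cast
    rfl
  obtain ⟨k, hk⟩ : ∃ k, ∀ j ∈ Finset.range M, μ.real (O j k) < μ.real (A j) + ε / 3 := by
    refine (((Finset.range M).eventually_all).2 fun j _ => ?_).exists (f := atTop)
    exact (hOlim j).eventually (eventually_lt_nhds (by linarith [hOA j]))
  have hfreq : ∀ᶠ n : ℕ in atTop, ∀ j ∈ Finset.range M,
      ∑ i ∈ Finset.range n, (O j k).indicator (fun _ => (1 : ℝ)) (shift^[i] x) ≤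
        (μ.real (A j) + ε / 3) * n :=
    ((Finset.range M).eventually_all).2 fun j hj =>
      hx.eventually_frequency_le hs hP (ceIn_pastCylinder (hZce j) k) (hk j hj)
  -- The first `k` times are bounded by `1`; afterwards the layer-cake formula with `M` levels has
  -- error `1 / M`.
  have hterm : ∀ i, h (block x 1 i) ≤ (if i < k then (1 : ℝ) else 0) + 1 / M +
      1 / M * ∑ j ∈ Finset.range M, (O j k).indicator (fun _ => (1 : ℝ)) (shift^[i] x) := by
    intro i
    have hind0 : ∀ j, 0 ≤ (O j k).indicator (fun _ => (1 : ℝ)) (shift^[i] x) :=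
      fun j => Set.indicator_nonneg (fun _ _ => zero_le_one) _
    have hS0 : 0 ≤ 1 / (M : ℝ) *
        ∑ j ∈ Finset.range M, (O j k).indicator (fun _ => (1 : ℝ)) (shift^[i] x) :=
      mul_nonneg (by positivity) (Finset.sum_nonneg fun j _ => hind0 j)
    split_ifs with hik
    · have := h1 (block x 1 i)
      have : 0 < 1 / (M : ℝ) := by positivity
      linarith
    · have h4 := min_le_sum_indicator_succ_lt (M * h (block x 1 i)) M
      rw [min_eq_left (by nlinarith [h1 (block x 1 i)])] at h4
      have h5 : ∑ j ∈ Finset.range M,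
          (if ((j : ℝ) + 1) < M * h (block x 1 i) then (1 : ℝ) else 0) ≤
          ∑ j ∈ Finset.range M, (O j k).indicator (fun _ => (1 : ℝ)) (shift^[i] x) := by
        refine Finset.sum_le_sum fun j _ => ?_
        split_ifs with hlt
        · have hmem : shift^[i] x ∈ O j k := by
            refine mem_cylUnion_pastCylinder.2 ⟨i, not_lt.1 hik, ?_⟩
            rw [block_iterate_shift, sub_add_cancel]
            refine (hZiff j _ (hx.blockProb_pos i)).2 ?_
            rw [div_lt_iff₀ hM0', mul_comm]
            push_cast
            linarith
          rw [Set.indicator_of_mem hmem]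
        · exact hind0 j
      have h6 : h (block x 1 i) - 1 / M ≤ 1 / M *
          ∑ j ∈ Finset.range M, (O j k).indicator (fun _ => (1 : ℝ)) (shift^[i] x) := by
        have h7 := mul_le_mul_of_nonneg_left (h4.trans h5) (show (0 : ℝ) ≤ 1 / M by positivity)
        have h8 : 1 / (M : ℝ) * (M * h (block x 1 i) - 1) = h (block x 1 i) - 1 / M := by
          field_simp
        linarith
      linarith
  have hlin : Tendsto (fun n : ℕ => (ε / 3) * (n : ℝ)) atTop atTop :=
    tendsto_natCast_atTop_atTop.const_mul_atTop (by linarith)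
  filter_upwards [hfreq, hlin.eventually_ge_atTop (k : ℝ)] with n hn hkn
  calc ∑ i ∈ Finset.range n, h (block x 1 i)
      ≤ ∑ i ∈ Finset.range n, ((if i < k then (1 : ℝ) else 0) + 1 / M +
        1 / M * ∑ j ∈ Finset.range M, (O j k).indicator (fun _ => (1 : ℝ)) (shift^[i] x)) :=
        Finset.sum_le_sum fun i _ => hterm i
    _ = ∑ i ∈ Finset.range n, (if i < k then (1 : ℝ) else 0) + n * (1 / M) +
        1 / M * ∑ j ∈ Finset.range M, ∑ i ∈ Finset.range n,
          (O j k).indicator (fun _ => (1 : ℝ)) (shift^[i] x) := by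
        rw [Finset.sum_add_distrib, Finset.sum_add_distrib, ← Finset.mul_sum, Finset.sum_comm]
        simp
    _ ≤ k + n * (1 / M) + 1 / M * ∑ j ∈ Finset.range M, (μ.real (A j) + ε / 3) * n := by
        gcongr with j hj
        · rw [Finset.sum_boole]
          have : ((Finset.range n).filter (· < k)) ⊆ Finset.range k := fun i hi =>
            Finset.mem_range.2 (Finset.mem_filter.1 hi).2
          have h9 := Finset.card_le_card this
          rw [Finset.card_range] at h9
          exact_mod_cast h9
        · exact hn j hj
    _ ≤ k + n * (ε / 3) + ((∫ y, K y ∂μ) + ε / 3) * n := by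
        have h10 : 1 / (M : ℝ) * ∑ j ∈ Finset.range M, (μ.real (A j) + ε / 3) * n =
            (1 / M * ∑ j ∈ Finset.range M, μ.real (A j) + ε / 3) * n := by
          rw [← Finset.sum_mul, Finset.sum_add_distrib]
          simp only [Finset.sum_const, Finset.card_range, nsmul_eq_mul]
          field_simp
        have h11 : 1 / (M : ℝ) * ∑ j ∈ Finset.range M, μ.real (A j) ≤ ∫ y, K y ∂μ := by
          rw [one_div_mul_eq_div, div_le_iff₀ hM0']
          linarith
        rw [h10]
        gcongr
    _ ≤ ((∫ y, H y ∂μ) + ε) * n := by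
        rw [hKH]
        linarith

end Breiman

/-! ### Averages of the largest conditional probability. -/

section MaxCondProb

variable {s x : BiSeq D} {P : ProbabilityMeasure (BiSeq D)}

theorem CEIn.forall_fin {α : Type*} [Primcodable α] {A : α × Fin D → Prop} (hA : CEIn s A) :
    CEIn s fun a => ∀ i, A (a, i) := by
  have h1 : CEIn s fun z : (α × ℕ) × Fin D => (z.2 : ℕ) = z.1.2 ∧ A (z.1.1, z.2) := by
    refine .and (.of_primrecPred ?_) ?_
    · exact Primrec.eq.comp (Primrec.fin_val.comp Primrec.snd) (Primrec.snd.comp Primrec.fst)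
    · exact hA.comp (f := fun z : (α × ℕ) × Fin D => (z.1.1, z.2))
        ((Primrec.fst.comp Primrec.fst).pair Primrec.snd).to_comp
  refine (h1.ex.forall_lt.comp (f := fun a : α => (a, D))
    (Primrec.id.pair (Primrec.const D)).to_comp).of_iff fun a => ?_
  constructor
  · intro h i
    obtain ⟨j, hj, hA⟩ := h i i.2
    obtain rfl : j = i := Fin.ext hj
    exact hA
  · exact fun h i hi => ⟨⟨i, hi⟩, rfl, h _⟩

theorem exists_eq_maxCondProb [NeZero D] (w : List (Fin D)) :
    ∃ a, condProb P 1 w a = maxCondProb P w := exists_eq_ciSup_of_finite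

theorem primrec_append_singleton :
    Primrec fun z : List (Fin D) × Fin D => z.1 ++ [z.2] :=
  Primrec.list_concat.comp Primrec.fst Primrec.snd

theorem exists_ceIn_lt_maxCondProb [NeZero D] (hs : IsRepresentation s P) (j : ℕ) {M : ℕ}
    (hM : 0 < M) :
    ∃ Z : List (Fin D) → Prop, CEIn s Z ∧
      ∀ w, 0 < blockProb P 1 w → (Z w ↔ (j : ℝ) / M < maxCondProb P w) := by
  have hM' : (0 : ℝ) < M := by exact_mod_cast hM
  refine ⟨fun w => ∃ a, (j : ℝ) * blockProb P 1 w < M * blockProb P 1 (w ++ [a]), ?_, ?_⟩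
  · exact CEIn.ex (A := fun z : List (Fin D) × Fin D =>
      (j : ℝ) * blockProb P 1 z.1 < M * blockProb P 1 (z.1 ++ [z.2]))
      (hs.ceIn_mul_lt_mul.comp (f := fun z : List (Fin D) × Fin D =>
        ((j, M), (z.1, z.1 ++ [z.2])))
        ((Primrec.const (j, M)).pair (Primrec.fst.pair primrec_append_singleton)).to_comp)
  · intro w hw
    have key : ∀ a, (j : ℝ) * blockProb P 1 w < M * blockProb P 1 (w ++ [a]) ↔
        (j : ℝ) / M < condProb P 1 w a := by
      intro a
      rw [condProb, div_lt_div_iff₀ hM' hw, mul_comm (blockProb P 1 (w ++ [a]))]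
    simp only [key]
    constructor
    · rintro ⟨a, ha⟩
      exact ha.trans_le (condProb_le_maxCondProb w a)
    · intro h
      obtain ⟨a, ha⟩ := exists_eq_maxCondProb (P := P) w
      exact ⟨a, by rwa [ha]⟩

/-- The condition says that all conditional probabilities lie below `(M - j) / M`, a conjunction
over finitely many letters. Truncated subtraction does no harm: for `j ≥ M` both sides are false. -/
theorem exists_ceIn_lt_one_sub_maxCondProb [NeZero D] (hs : IsRepresentation s P) (j : ℕ) {M : ℕ}
    (hM : 0 < M) :
    ∃ Z : List (Fin D) → Prop, CEIn s Z ∧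
      ∀ w, 0 < blockProb P 1 w → (Z w ↔ (j : ℝ) / M < 1 - maxCondProb P w) := by
  have hM' : (0 : ℝ) < M := by exact_mod_cast hM
  refine ⟨fun w => ∀ a, (M : ℝ) * blockProb P 1 (w ++ [a]) < ((M - j : ℕ) : ℝ) * blockProb P 1 w,
    ?_, ?_⟩
  · exact CEIn.forall_fin (A := fun z : List (Fin D) × Fin D =>
      (M : ℝ) * blockProb P 1 (z.1 ++ [z.2]) < ((M - j : ℕ) : ℝ) * blockProb P 1 z.1)
      (hs.ceIn_mul_lt_mul.comp (f := fun z : List (Fin D) × Fin D =>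
        ((M, M - j), (z.1 ++ [z.2], z.1)))
        ((Primrec.const (M, M - j)).pair (primrec_append_singleton.pair Primrec.fst)).to_comp)
  · intro w hw
    have key : ∀ a, (M : ℝ) * blockProb P 1 (w ++ [a]) < ((M - j : ℕ) : ℝ) * blockProb P 1 w ↔
        condProb P 1 w a < ((M - j : ℕ) : ℝ) / M := by
      intro a
      rw [condProb, div_lt_div_iff₀ hw hM', mul_comm (blockProb P 1 (w ++ [a]))]
    simp only [key]
    have hiff : (∀ a, condProb P 1 w a < ((M - j : ℕ) : ℝ) / M) ↔
        maxCondProb P w < ((M - j : ℕ) : ℝ) / M := by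
      obtain ⟨b, hb⟩ := exists_eq_maxCondProb (P := P) w
      exact ⟨fun h => hb ▸ h b, fun h a => (condProb_le_maxCondProb w a).trans_lt h⟩
    rw [hiff]
    rcases le_total j M with hj | hj
    · rw [Nat.cast_sub hj, sub_div, div_self hM'.ne']
      constructor <;> intro h <;> linarith
    · rw [Nat.sub_eq_zero_of_le hj]
      have h0 := maxCondProb_nonneg (P := P) w
      have h1 : (1 : ℝ) ≤ (j : ℝ) / M := by
        rw [one_le_div hM']; exact_mod_cast hj
      constructor
      · intro h
        rw [Nat.cast_zero, zero_div] at h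
        linarith
      · intro h
        linarith

/-- The averages of the largest conditional probability along a random point converge. -/
theorem IsOneRandomWith.tendsto_average_maxCondProb [NeZero D] (hx : IsOneRandomWith s P x)
    (hs : IsRepresentation s P) (hP : StationaryErgodic P) {G : BiSeq D → ℝ} (hG : Measurable G)
    (hlim : ∀ᵐ y ∂(P : Measure (BiSeq D)),
      Tendsto (fun n : ℕ => maxCondProb P (block y (-(n : ℤ)) n)) atTop (𝓝 (G y))) :
    Tendsto (fun n : ℕ => (1 / (n : ℝ)) * ∑ i ∈ Finset.range n, maxCondProb P (block x 1 i)) atTop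
      (𝓝 (∫ y, G y ∂(P : Measure (BiSeq D)))) := by
  have hGint : Integrable G (P : Measure (BiSeq D)) := by
    refine Integrable.of_bound hG.aestronglyMeasurable 1 ?_
    filter_upwards [hlim] with y hy
    rw [Real.norm_of_nonneg (ge_of_tendsto' hy fun n => maxCondProb_nonneg _)]
    exact le_of_tendsto' hy fun n => maxCondProb_le_one _
  rw [Metric.tendsto_nhds]
  intro ε hε
  -- The upper bound for the maximum and the upper bound for its difference from `1` together give
  -- the limit.
  have hup := hx.eventually_sum_past_le hs hP (h := maxCondProb P) maxCondProb_nonneg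
    maxCondProb_le_one (fun j M hM => exists_ceIn_lt_maxCondProb hs j hM) hG hlim (half_pos hε)
  have hlow := hx.eventually_sum_past_le hs hP (h := fun w => 1 - maxCondProb P w)
    (H := fun y => 1 - G y)
    (fun w => by linarith [maxCondProb_le_one (P := P) w])
    (fun w => by linarith [maxCondProb_nonneg (P := P) w])
    (fun j M hM => exists_ceIn_lt_one_sub_maxCondProb hs j hM) (measurable_const.sub hG)
    (hlim.mono fun y hy => hy.const_sub 1) (half_pos hε)
  rw [integral_sub (integrable_const 1) hGint] at hlow
  simp only [integral_const, probReal_univ, smul_eq_mul, mul_one] at hlow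
  filter_upwards [hup, hlow, eventually_gt_atTop 0] with n h1 h2 hn
  have hn' : (0 : ℝ) < n := by exact_mod_cast hn
  simp only [Finset.sum_sub_distrib, Finset.sum_const, Finset.card_range, nsmul_eq_mul,
    mul_one] at h2
  set S := ∑ i ∈ Finset.range n, maxCondProb P (block x 1 i)
  rw [Real.dist_eq, one_div_mul_eq_div, abs_lt]
  constructor
  · rw [lt_sub_iff_add_lt, lt_div_iff₀ hn']
    nlinarith
  · rw [sub_lt_iff_lt_add, div_lt_iff₀ hn']
    nlinarith

end MaxCondProb

/-! ### A law of large numbers for bounded martingale differences -/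

section Martingale

variable {s x : BiSeq D} {P : ProbabilityMeasure (BiSeq D)}

theorem sum_words_succ (n : ℕ) (F : List (Fin D) → ℝ) :
    ∑ v ∈ words D (n + 1), F v = ∑ w ∈ words D n, ∑ a, F (w ++ [a]) := by
  rw [← Finset.sum_product']
  refine (Finset.sum_bij (fun z _ => z.1 ++ [z.2]) ?_ ?_ ?_ fun _ _ => rfl).symm
  · rintro ⟨w, a⟩ hz
    simp at hz ⊢
    exact hz
  · rintro ⟨w, a⟩ - ⟨w', a'⟩ - h
    rw [List.append_singleton_inj] at h
    exact Prod.ext h.1 h.2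
  · intro v hv
    rw [mem_words] at hv
    rcases List.eq_nil_or_concat v with rfl | ⟨u, a, rfl⟩
    · simp at hv
    · refine ⟨(u, a), ?_, by simp⟩
      simpa using hv

theorem sum_blockProb_append (w : List (Fin D)) :
    ∑ a, blockProb P 1 (w ++ [a]) = blockProb P 1 w := by
  have h : {x : BiSeq D | block x 1 w.length = w} =
      ⋃ a ∈ (Finset.univ : Finset (Fin D)), {x | block x 1 (w ++ [a]).length = w ++ [a]} := by
    ext y
    simp only [Set.mem_iUnion, Set.mem_ofPred_eq, block_append_singleton_iff]
    simp
  rw [blockProb, h, measureReal_biUnion_finset]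
  · rfl
  · intro a _ b _ hab
    refine Set.disjoint_left.2 fun y hy hy' => hab ?_
    exact ((block_append_singleton_iff _ _ _ _).1 hy).2.symm.trans
      ((block_append_singleton_iff _ _ _ _).1 hy').2
  · exact fun a _ => measurableSet_block_eq _ _ _

/-- `d` summed along the reversed string. -/
def revSum (d : List (Fin D) → Fin D → ℝ) : List (Fin D) → ℝ
  | [] => 0
  | a :: r => revSum d r + d r.reverse a

/-- The sum of `d (w₁ ⋯ wᵢ) wᵢ₊₁` along a string `w`. -/
def strSum (d : List (Fin D) → Fin D → ℝ) (w : List (Fin D)) : ℝ := revSum d w.reverse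

/-- The product of `1 + t * d` along the reversed string. -/
def revProd (t : ℝ) (d : List (Fin D) → Fin D → ℝ) : List (Fin D) → ℝ
  | [] => 1
  | a :: r => revProd t d r * (1 + t * d r.reverse a)

variable {d : List (Fin D) → Fin D → ℝ}

@[simp] theorem strSum_nil : strSum d [] = 0 := rfl

@[simp] theorem strSum_append (w : List (Fin D)) (a : Fin D) :
    strSum d (w ++ [a]) = strSum d w + d w a := by
  simp [strSum, revSum]

theorem strSum_block (y : BiSeq D) (n : ℕ) :
    strSum d (block y 1 n) = ∑ i ∈ Finset.range n, d (block y 1 i) (y ((i : ℤ) + 1)) := by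
  induction n with
  | zero => rfl
  | succ n ih => rw [block_succ, strSum_append, ih, Finset.sum_range_succ, add_comm (1 : ℤ)]

/-- Apply `exp u ≤ 1 + u + u ^ 2` to `u = t - 2 * t ^ 2`. The range `1 / 5` ensures `(1 - 2 * t) ^ 2
≤ 2`, hence `u ^ 2 ≤ 2 * t ^ 2`. -/
theorem exp_sub_two_mul_sq_le {t : ℝ} (ht : |t| ≤ 1 / 5) :
    Real.exp (t - 2 * t ^ 2) ≤ 1 + t := by
  obtain ⟨h1, h2⟩ := abs_le.1 ht
  have h3 : |t - 2 * t ^ 2| ≤ 1 := by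
    rw [abs_le]; constructor <;> nlinarith
  have h4 := (abs_le.1 (Real.abs_exp_sub_one_sub_id_le h3)).2
  have h5 : (t - 2 * t ^ 2) ^ 2 ≤ 2 * t ^ 2 := by
    have : (t - 2 * t ^ 2) ^ 2 = t ^ 2 * (1 - 2 * t) ^ 2 := by ring
    rw [this]
    have h6 : (1 - 2 * t) ^ 2 ≤ 2 := by nlinarith
    nlinarith [sq_nonneg t]
  linarith

theorem exp_strSum_le_revProd (hd : ∀ w a, |d w a| ≤ 1) {t : ℝ} (ht0 : 0 ≤ t) (ht : t ≤ 1 / 5)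
    (w : List (Fin D)) :
    Real.exp (t * strSum d w - 2 * t ^ 2 * w.length) ≤ revProd t d w.reverse := by
  induction w using List.reverseRecOn with
  | nil => simp [revProd]
  | append_singleton w a ih =>
    have h1 : |t * d w a| ≤ 1 / 5 := by
      rw [abs_mul, abs_of_nonneg ht0]
      nlinarith [hd w a, abs_nonneg (d w a)]
    have h2 := exp_sub_two_mul_sq_le h1
    have h3 : d w a ^ 2 ≤ 1 := by
      have := hd w a
      rw [← sq_abs]
      nlinarith [abs_nonneg (d w a)]
    have h4 : Real.exp (t * d w a - 2 * t ^ 2) ≤ 1 + t * d w a := by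
      refine (Real.exp_le_exp.2 ?_).trans h2
      have : (t * d w a) ^ 2 ≤ t ^ 2 := by
        rw [mul_pow]; nlinarith [sq_nonneg t]
      linarith
    have h5 : revProd t d (w ++ [a]).reverse = revProd t d w.reverse * (1 + t * d w a) := by
      simp [revProd]
    rw [h5, strSum_append, List.length_append, List.length_singleton]
    have h6 : t * (strSum d w + d w a) - 2 * t ^ 2 * ((w.length + 1 : ℕ) : ℝ) =
        (t * strSum d w - 2 * t ^ 2 * w.length) + (t * d w a - 2 * t ^ 2) := by
      push_cast; ring
    rw [h6, Real.exp_add]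
    exact mul_le_mul ih h4 (Real.exp_pos _).le ((Real.exp_pos _).le.trans ih)

/-- The products form a nonnegative supermartingale that starts at `1`; nonnegativity comes from the
exponential lower bound. -/
theorem sum_blockProb_mul_revProd_le (hd : ∀ w a, |d w a| ≤ 1)
    (hmart : ∀ w, ∑ a, blockProb P 1 (w ++ [a]) * d w a ≤ 0) {t : ℝ} (ht0 : 0 ≤ t)
    (ht : t ≤ 1 / 5) (n : ℕ) :
    ∑ w ∈ words D n, blockProb P 1 w * revProd t d w.reverse ≤ 1 := by
  induction n with
  | zero =>
    have : words D 0 = {[]} := by ext w; simp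
    rw [this, Finset.sum_singleton]
    simpa [revProd] using blockProb_le_one P 1 []
  | succ n ih =>
    rw [sum_words_succ]
    refine le_trans (Finset.sum_le_sum fun w _ => ?_) ih
    have h0 : 0 ≤ revProd t d w.reverse :=
      (Real.exp_pos _).le.trans (exp_strSum_le_revProd hd ht0 ht w)
    have h1 : ∑ a, blockProb P 1 (w ++ [a]) * revProd t d (w ++ [a]).reverse =
        revProd t d w.reverse * (∑ a, blockProb P 1 (w ++ [a]) +
          t * ∑ a, blockProb P 1 (w ++ [a]) * d w a) := by
      rw [Finset.mul_sum, ← Finset.sum_add_distrib, Finset.mul_sum]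
      refine Finset.sum_congr rfl fun a _ => ?_
      simp [revProd]
      ring
    rw [h1, sum_blockProb_append, mul_comm (blockProb P 1 w)]
    refine mul_le_mul_of_nonneg_left ?_ h0
    have := mul_nonpos_of_nonneg_of_nonpos ht0 (hmart w)
    linarith

/-- Large deviations of sums of bounded supermartingale differences. -/
theorem exists_measureReal_strSum_ge_le (hd : ∀ w a, |d w a| ≤ 1)
    (hmart : ∀ w, ∑ a, blockProb P 1 (w ++ [a]) * d w a ≤ 0) {ε : ℝ} (hε : 0 < ε) :
    ∃ ρ : ℝ, 0 < ρ ∧ ρ < 1 ∧ ∀ n : ℕ, (P : Measure (BiSeq D)).real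
      {y | ε * n ≤ strSum d (block y 1 n)} ≤ ρ ^ n := by
  classical
  -- With `t ≤ ε / 4` the correction `2 * t ^ 2` uses at most half of `t * ε`; the bound `1 / 5` is
  -- the range of the exponential inequality. Markov's inequality then gives the rate `t * ε / 2`.
  set t := min (ε / 4) (1 / 5) with ht
  have ht0 : 0 < t := lt_min (by positivity) (by norm_num)
  have ht1 : t ≤ 1 / 5 := min_le_right _ _
  have ht2 : t ≤ ε / 4 := min_le_left _ _
  refine ⟨Real.exp (-(t * ε / 2)), Real.exp_pos _, Real.exp_lt_one_iff.2 (by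
    have : 0 < t * ε := by positivity
    linarith), fun n => ?_⟩
  rw [measureReal_block_mem P 1 n (fun w => ε * n ≤ strSum d w)]
  have hsum := sum_blockProb_mul_revProd_le hd hmart ht0.le ht1 n
  set c := Real.exp (t * ε / 2) ^ n with hc
  have hc0 : 0 < c := by positivity
  have h1 : c * ∑ v ∈ (words D n).filter (fun w => ε * n ≤ strSum d w),
      (P : Measure (BiSeq D)).real {y | block y 1 n = v} ≤ 1 := by
    refine le_trans ?_ hsum
    rw [Finset.mul_sum]
    refine le_trans (Finset.sum_le_sum fun v hv => ?_)
      (Finset.sum_le_sum_of_subset_of_nonneg (Finset.filter_subset _ _) fun v _ _ =>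
        mul_nonneg (blockProb_nonneg P 1 v)
          ((Real.exp_pos _).le.trans (exp_strSum_le_revProd hd ht0.le ht1 v)))
    rw [Finset.mem_filter, mem_words] at hv
    have h2 : (P : Measure (BiSeq D)).real {y | block y 1 n = v} = blockProb P 1 v := by
      rw [blockProb, hv.1]
    rw [h2, mul_comm]
    refine mul_le_mul_of_nonneg_left ?_ (blockProb_nonneg P 1 v)
    refine le_trans ?_ (exp_strSum_le_revProd hd ht0.le ht1 v)
    rw [hc, ← Real.exp_nat_mul, Real.exp_le_exp, hv.1]
    have hn0 : (0 : ℝ) ≤ n := Nat.cast_nonneg _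
    have h3 := mul_le_mul_of_nonneg_left hv.2 ht0.le
    have h4 : 2 * t ^ 2 ≤ t * ε / 2 := by nlinarith
    nlinarith
  rw [Real.exp_neg, inv_pow, ← hc, ← one_div, le_div_iff₀ hc0]
  linarith

/-- Along a random point an enumerable event that forces a large sum happens only finitely
often. -/
theorem IsOneRandomWith.eventually_not_of_strSum_ge (hx : IsOneRandomWith s P x)
    (hd : ∀ w a, |d w a| ≤ 1) (hmart : ∀ w, ∑ a, blockProb P 1 (w ++ [a]) * d w a ≤ 0)
    {ε : ℝ} (hε : 0 < ε) {Bad : List (Fin D) → Prop} (hBad : CEIn s Bad)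
    (hle : ∀ w, Bad w → ε * w.length ≤ strSum d w) :
    ∀ᶠ n : ℕ in atTop, ¬ Bad (block x 1 n) := by
  obtain ⟨ρ, hρ0, hρ1, hρ⟩ := exists_measureReal_strSum_ge_le (P := P) hd hmart hε
  -- Level `m` contains the bad strings of length at least `m`; the tail of the geometric series
  -- bounds its probability.
  have hV : CEIn s fun q : ℕ × (List (Fin D) × List (Fin D)) =>
      Bad q.2.2 ∧ (q.2.1 = [] ∧ q.1 ≤ q.2.2.length) := by
    have g1 : Primrec fun q : ℕ × (List (Fin D) × List (Fin D)) => q.2.1 :=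
      Primrec.fst.comp Primrec.snd
    have g2 : Primrec fun q : ℕ × (List (Fin D) × List (Fin D)) => q.2.2 :=
      Primrec.snd.comp Primrec.snd
    exact (hBad.comp g2.to_comp).and (.of_primrecPred
      ((Primrec.eq.comp g1 (Primrec.const [])).and
        (Primrec.nat_le.comp Primrec.fst (Primrec.list_length.comp g2))))
  obtain ⟨m, hm⟩ := hx.exists_notMem_of_le_geometric hV (C := (1 - ρ)⁻¹) hρ0.le hρ1 fun m => by
    have hsub : {y : BiSeq D | ∃ p : List (Fin D) × List (Fin D),
        (Bad p.2 ∧ (p.1 = [] ∧ m ≤ p.2.length)) ∧ y ∈ cylinder p.1 p.2} ⊆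
        ⋃ k : ℕ, {y | ε * ((m + k : ℕ) : ℝ) ≤ strSum d (block y 1 (m + k))} := by
      rintro y ⟨⟨_, τ⟩, ⟨hb, rfl, hlen⟩, hy⟩
      simp only [cylinder_nil_left] at hy hb hlen
      replace hy : block y 1 τ.length = τ := hy
      refine Set.mem_iUnion.2 ⟨τ.length - m, ?_⟩
      show ε * ((m + (τ.length - m) : ℕ) : ℝ) ≤ strSum d (block y 1 (m + (τ.length - m)))
      rw [show m + (τ.length - m) = τ.length by omega, hy]
      exact hle τ hb
    have hsummable : Summable fun k : ℕ => ρ ^ (m + k) := by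
      simp only [pow_add]
      exact (summable_geometric_of_lt_one hρ0.le hρ1).mul_left _
    have hmeas : (P : Measure (BiSeq D)) {y : BiSeq D | ∃ p : List (Fin D) × List (Fin D),
        (Bad p.2 ∧ (p.1 = [] ∧ m ≤ p.2.length)) ∧ y ∈ cylinder p.1 p.2} ≤
        ENNReal.ofReal (∑' k : ℕ, ρ ^ (m + k)) := by
      refine (measure_mono hsub).trans ((measure_iUnion_le _).trans ?_)
      rw [ENNReal.ofReal_tsum_of_nonneg (fun k => by positivity) hsummable]
      refine ENNReal.tsum_le_tsum fun k => ?_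
      rw [← ENNReal.ofReal_toReal (measure_ne_top (P : Measure (BiSeq D)) _)]
      exact ENNReal.ofReal_le_ofReal (hρ (m + k))
    have htsum : ∑' k : ℕ, ρ ^ (m + k) = (1 - ρ)⁻¹ * ρ ^ m := by
      simp only [pow_add]
      rw [tsum_mul_left, tsum_geometric_of_lt_one hρ0.le hρ1, mul_comm]
    rw [← htsum]
    exact ENNReal.toReal_le_of_le_ofReal (tsum_nonneg fun k => by positivity) hmeas
  filter_upwards [eventually_ge_atTop m] with n hn hbad
  refine hm ([], block x 1 n) ⟨hbad, rfl, by simpa using hn⟩ ?_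
  rw [cylinder_nil_left]
  simp

/-- The sums of bounded supermartingale differences along a random point grow slower than any
linear function, if lower bounds of the differences can be enumerated. -/
theorem IsOneRandomWith.eventually_strSum_le (hx : IsOneRandomWith s P x)
    (hd : ∀ w a, |d w a| ≤ 1) (hmart : ∀ w, ∑ a, blockProb P 1 (w ++ [a]) * d w a ≤ 0)
    (hstep : ∀ M : ℕ, 0 < M → ∃ S : (List (Fin D) × Fin D) × ℕ → Prop, CEIn s S ∧
      (∀ w a e, S ((w, a), e) → (e : ℝ) ≤ M * (2 + d w a)) ∧
      ∀ w a, 0 < blockProb P 1 w → ∃ e : ℕ, S ((w, a), e) ∧ M * (2 + d w a) - 1 ≤ e)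
    {ε : ℝ} (hε : 0 < ε) :
    ∀ᶠ n : ℕ in atTop, strSum d (block x 1 n) ≤ ε * n := by
  -- At scale `M` a sum above `ε * n` exceeds `3 * n`; rounding loses at most `n`, and the remaining
  -- `2 * n` is the threshold in `Bad`.
  obtain ⟨M, hM⟩ := exists_nat_gt (3 / ε)
  have hM0' : (0 : ℝ) < M := lt_trans (by positivity) hM
  have hM0 : 0 < M := by exact_mod_cast hM0'
  rw [div_lt_iff₀ hε] at hM
  obtain ⟨S, hS, hsound, hcompl⟩ := hstep M hM0
  -- The offset `2` makes every increment positive, so natural numbers suffice as lower bounds; it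
  -- adds `2 * M` per letter to the threshold.
  let Step : (List (Fin D) × ℕ) → (List (Fin D) × ℕ) → Prop := fun b c =>
    ∃ z : Fin D × ℕ, S ((b.1, z.1), z.2) ∧ c = (b.1 ++ [z.1], b.2 + z.2)
  have hStep : CEIn s fun q : Unit × ((List (Fin D) × ℕ) × (List (Fin D) × ℕ)) =>
      Step q.2.1 q.2.2 := by
    have gb : Primrec fun y : (Unit × ((List (Fin D) × ℕ) × (List (Fin D) × ℕ))) × (Fin D × ℕ) =>
      y.1.2.1 := Primrec.fst.comp (Primrec.snd.comp Primrec.fst)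
    have gc : Primrec fun y : (Unit × ((List (Fin D) × ℕ) × (List (Fin D) × ℕ))) × (Fin D × ℕ) =>
      y.1.2.2 := Primrec.snd.comp (Primrec.snd.comp Primrec.fst)
    have ga : Primrec fun y : (Unit × ((List (Fin D) × ℕ) × (List (Fin D) × ℕ))) × (Fin D × ℕ) =>
      y.2.1 := Primrec.fst.comp Primrec.snd
    have ge : Primrec fun y : (Unit × ((List (Fin D) × ℕ) × (List (Fin D) × ℕ))) × (Fin D × ℕ) =>
      y.2.2 := Primrec.snd.comp Primrec.snd
    have h1 : CEIn s fun y : (Unit × ((List (Fin D) × ℕ) × (List (Fin D) × ℕ))) × (Fin D × ℕ) =>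
        S ((y.1.2.1.1, y.2.1), y.2.2) :=
      hS.comp (f := fun y : (Unit × ((List (Fin D) × ℕ) × (List (Fin D) × ℕ))) × (Fin D × ℕ) =>
        ((y.1.2.1.1, y.2.1), y.2.2)) (((Primrec.fst.comp gb).pair ga).pair ge).to_comp
    have h2 : PrimrecPred
        fun y : (Unit × ((List (Fin D) × ℕ) × (List (Fin D) × ℕ))) × (Fin D × ℕ) =>
        y.1.2.2 = (y.1.2.1.1 ++ [y.2.1], y.1.2.1.2 + y.2.2) :=
      Primrec.eq.comp gc ((Primrec.list_concat.comp (Primrec.fst.comp gb) ga).pair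
        (Primrec.nat_add.comp (Primrec.snd.comp gb) ge))
    exact (h1.and (.of_primrecPred h2)).ex
  let Bad : List (Fin D) → Prop := fun w => ∃ e : ℕ,
    Relation.ReflTransGen Step ([], 0) (w, e) ∧ (2 * M + 2) * w.length ≤ e
  have hBad : CEIn s Bad := by
    have h1 : CEIn s fun z : List (Fin D) × ℕ => Relation.ReflTransGen Step ([], 0) z :=
      hStep.reflTransGen.comp (f := fun z : List (Fin D) × ℕ =>
        ((), ((([] : List (Fin D)), 0), z)))
        ((Primrec.const ()).pair ((Primrec.const ([], 0)).pair Primrec.id)).to_comp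
    have h2 : PrimrecPred fun z : List (Fin D) × ℕ => (2 * M + 2) * z.1.length ≤ z.2 :=
      Primrec.nat_le.comp (Primrec.nat_mul.comp (Primrec.const (2 * M + 2))
        (Primrec.list_length.comp Primrec.fst)) Primrec.snd
    exact (h1.and (.of_primrecPred h2)).ex
  have hle : ∀ w, Bad w → 2 / (M : ℝ) * w.length ≤ strSum d w := by
    rintro w ⟨e, hch, he⟩
    have inv : ∀ z : List (Fin D) × ℕ, Relation.ReflTransGen Step ([], 0) z →
        (z.2 : ℝ) ≤ M * (2 * z.1.length + strSum d z.1) := by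
      intro z hz
      induction hz with
      | refl => simp
      | tail _ hbc ih =>
        obtain ⟨⟨a, e⟩, hS, rfl⟩ := hbc
        have := hsound _ _ _ hS
        simp only [strSum_append, List.length_append, List.length_singleton]
        push_cast
        linarith
    have h1 := inv _ hch
    have h2 : ((2 * M + 2) * w.length : ℝ) ≤ e := by exact_mod_cast he
    simp only at h1
    rw [div_mul_eq_mul_div, div_le_iff₀ hM0']
    linarith
  filter_upwards [hx.eventually_not_of_strSum_ge hd hmart
    (show (0 : ℝ) < 2 / M by positivity) hBad hle] with n hn
  by_contra hcon
  refine hn ?_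
  have key : ∀ n : ℕ, ∃ e : ℕ, Relation.ReflTransGen Step ([], 0) (block x 1 n, e) ∧
      M * (2 * n + strSum d (block x 1 n)) - n ≤ (e : ℝ) := by
    intro n
    induction n with
    | zero => exact ⟨0, .refl, by simp⟩
    | succ n ih =>
      obtain ⟨e, he, he'⟩ := ih
      obtain ⟨e', hS, he''⟩ := hcompl (block x 1 n) (x (1 + n)) (hx.blockProb_pos n)
      refine ⟨e + e', he.tail ⟨(x (1 + n), e'), hS, by rw [block_succ]⟩, ?_⟩
      rw [block_succ, strSum_append]
      push_cast
      linarith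
  obtain ⟨e, he, he'⟩ := key n
  refine ⟨e, he, ?_⟩
  rw [length_block]
  have h3 : ((2 * M + 2) * n : ℝ) ≤ e := by
    have hn0 : (0 : ℝ) ≤ n := Nat.cast_nonneg _
    have h4 : M * (ε * n) ≤ M * strSum d (block x 1 n) :=
      mul_le_mul_of_nonneg_left (not_le.1 hcon).le hM0'.le
    nlinarith
  exact_mod_cast h3

end Martingale

/-! ### Prediction -/

section Prediction

variable {s x : BiSeq D} {P : ProbabilityMeasure (BiSeq D)} {f : List (Fin D) → Fin D}

/-- The success of the predictor `f` minus its conditional probability. -/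
noncomputable def excessHit (P : ProbabilityMeasure (BiSeq D)) (f : List (Fin D) → Fin D)
    (w : List (Fin D)) (a : Fin D) : ℝ :=
  (if a = f w then 1 else 0) - condProb P 1 w (f w)

theorem abs_excessHit_le (w : List (Fin D)) (a : Fin D) : |excessHit P f w a| ≤ 1 := by
  have h0 := condProb_nonneg (P := P) 1 w (f w)
  have h1 := condProb_le_one (P := P) 1 w (f w)
  rw [excessHit, abs_le]
  split_ifs <;> constructor <;> linarith

theorem sum_blockProb_mul_excessHit (w : List (Fin D)) :
    ∑ a, blockProb P 1 (w ++ [a]) * excessHit P f w a = 0 := by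
  simp only [excessHit, mul_sub, Finset.sum_sub_distrib, ← Finset.sum_mul, sum_blockProb_append]
  rw [blockProb_mul_condProb]
  simp

theorem computable_ite_eq_predictor (hf : Computable f) (m n : ℕ) :
    Computable fun q : (List (Fin D) × Fin D) × ℕ => if q.1.2 = f q.1.1 then m else n := by
  have h : Primrec fun z : Fin D × Fin D => if z.1 = z.2 then m else n :=
    Primrec.ite (Primrec.eq.comp Primrec.fst Primrec.snd) (Primrec.const m) (Primrec.const n)
  exact h.to_comp.comp ((Computable.snd.comp Computable.fst).pair
    (hf.comp (Computable.fst.comp Computable.fst)))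

theorem computable_append_predictor (hf : Computable f) :
    Computable fun q : (List (Fin D) × Fin D) × ℕ => q.1.1 ++ [f q.1.1] :=
  primrec_append_singleton.to_comp.comp ((Computable.fst.comp Computable.fst).pair
    (hf.comp (Computable.fst.comp Computable.fst)))

/-- After scaling, the quantity is `c - M * condProb P 1 w (f w)` with `c` equal to `3 * M` or `2 *
M`, so a lower bound `e` amounts to a comparison of two block probabilities. For `e > c` the
truncated difference is `0` and the comparison fails, as it should. -/
theorem exists_ceIn_le_excessHit (hs : IsRepresentation s P) (hf : Computable f) (M : ℕ)
    (hM : 0 < M) : ∃ S : (List (Fin D) × Fin D) × ℕ → Prop, CEIn s S ∧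
      (∀ w a e, S ((w, a), e) → (e : ℝ) ≤ M * (2 + excessHit P f w a)) ∧
      ∀ w a, 0 < blockProb P 1 w → ∃ e : ℕ, S ((w, a), e) ∧
        M * (2 + excessHit P f w a) - 1 ≤ e := by
  have hM' : (0 : ℝ) < M := by exact_mod_cast hM
  let c : (List (Fin D) × Fin D) × ℕ → ℕ := fun q => if q.1.2 = f q.1.1 then 3 * M else 2 * M
  have hc : Computable c := computable_ite_eq_predictor hf _ _
  have hval : ∀ w a e, M * (2 + excessHit P f w a) =
      c ((w, a), e) - M * condProb P 1 w (f w) := by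
    intro w a e
    simp only [c, excessHit]
    split_ifs <;> push_cast <;> ring
  refine ⟨fun q => (M : ℝ) * blockProb P 1 (q.1.1 ++ [f q.1.1]) <
    ((c q - q.2 : ℕ) : ℝ) * blockProb P 1 q.1.1, ?_, ?_, ?_⟩
  · exact hs.ceIn_mul_lt_mul.comp (f := fun q : (List (Fin D) × Fin D) × ℕ =>
      ((M, c q - q.2), (q.1.1 ++ [f q.1.1], q.1.1)))
      (((Computable.const M).pair (Primrec.nat_sub.to_comp.comp hc Computable.snd)).pair
        ((computable_append_predictor hf).pair (Computable.fst.comp Computable.fst)))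
  · intro w a e h
    replace h : (M : ℝ) * blockProb P 1 (w ++ [f w]) <
      ((c ((w, a), e) - e : ℕ) : ℝ) * blockProb P 1 w := h
    rw [← blockProb_mul_condProb, mul_left_comm, mul_comm _ (blockProb P 1 w)] at h
    have h' := lt_of_mul_lt_mul_left h (blockProb_nonneg P 1 w)
    have h0 : 0 ≤ M * condProb P 1 w (f w) := mul_nonneg hM'.le (condProb_nonneg 1 w _)
    have hlt : e < c ((w, a), e) := by
      have := h0.trans_lt h'
      rw [Nat.cast_pos] at this
      omega
    rw [Nat.cast_sub hlt.le] at h'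
    rw [hval w a e]
    linarith
  · intro w a hw
    have hpos : 0 < M * (2 + excessHit P f w a) :=
      mul_pos hM' (by linarith [(abs_le.1 (abs_excessHit_le (P := P) (f := f) w a)).1])
    obtain ⟨e, he, he'⟩ := exists_nat_lt_ge_sub_one hpos
    refine ⟨e, ?_, he'⟩
    show (M : ℝ) * blockProb P 1 (w ++ [f w]) <
      ((c ((w, a), e) - e : ℕ) : ℝ) * blockProb P 1 w
    rw [hval w a e] at he
    have h0 : 0 ≤ M * condProb P 1 w (f w) := mul_nonneg hM'.le (condProb_nonneg 1 w _)
    have hlt : e ≤ c ((w, a), e) := by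
      have : (e : ℝ) ≤ c ((w, a), e) := by linarith
      exact_mod_cast this
    rw [← blockProb_mul_condProb, mul_left_comm, mul_comm _ (blockProb P 1 w), Nat.cast_sub hlt]
    exact mul_lt_mul_of_pos_left (by linarith) hw

/-- Here the conditional probability enters with a plus sign. Values `e < c` are lower bounds
without any comparison; the separate alternative also covers words `w ++ [f w]` of probability zero.
-/
theorem exists_ceIn_le_neg_excessHit (hs : IsRepresentation s P) (hf : Computable f) (M : ℕ)
    (hM : 0 < M) : ∃ S : (List (Fin D) × Fin D) × ℕ → Prop, CEIn s S ∧
      (∀ w a e, S ((w, a), e) → (e : ℝ) ≤ M * (2 + -excessHit P f w a)) ∧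
      ∀ w a, 0 < blockProb P 1 w → ∃ e : ℕ, S ((w, a), e) ∧
        M * (2 + -excessHit P f w a) - 1 ≤ e := by
  have hM' : (0 : ℝ) < M := by exact_mod_cast hM
  let c : (List (Fin D) × Fin D) × ℕ → ℕ := fun q => if q.1.2 = f q.1.1 then M else 2 * M
  have hc : Computable c := computable_ite_eq_predictor hf _ _
  have hval : ∀ w a e, M * (2 + -excessHit P f w a) =
      c ((w, a), e) + M * condProb P 1 w (f w) := by
    intro w a e
    simp only [c, excessHit]
    split_ifs <;> push_cast <;> ring
  refine ⟨fun q => q.2 < c q ∨ ((q.2 - c q : ℕ) : ℝ) * blockProb P 1 q.1.1 <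
    (M : ℝ) * blockProb P 1 (q.1.1 ++ [f q.1.1]), ?_, ?_, ?_⟩
  · refine .or ?_ ?_
    · exact (CEIn.of_primrecPred (A := fun z : ℕ × ℕ => z.1 < z.2)
        (Primrec.nat_lt.comp Primrec.fst Primrec.snd)).comp
        (f := fun q : (List (Fin D) × Fin D) × ℕ => (q.2, c q)) (Computable.snd.pair hc)
    · exact hs.ceIn_mul_lt_mul.comp (f := fun q : (List (Fin D) × Fin D) × ℕ =>
        ((q.2 - c q, M), (q.1.1, q.1.1 ++ [f q.1.1])))
        (((Primrec.nat_sub.to_comp.comp Computable.snd hc).pair (Computable.const M)).pair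
          ((Computable.fst.comp Computable.fst).pair (computable_append_predictor hf)))
  · intro w a e h
    have h0 : 0 ≤ M * condProb P 1 w (f w) := mul_nonneg hM'.le (condProb_nonneg 1 w _)
    rw [hval w a e]
    rcases le_or_gt (c ((w, a), e)) e with hle | hlt
    · have h2 : ((e - c ((w, a), e) : ℕ) : ℝ) * blockProb P 1 w <
          (M : ℝ) * blockProb P 1 (w ++ [f w]) := by
        rcases h with h | h
        · exact absurd h (not_lt.2 hle)
        · exact h
      rw [← blockProb_mul_condProb, mul_left_comm, mul_comm _ (blockProb P 1 w)] at h2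
      have h' := lt_of_mul_lt_mul_left h2 (blockProb_nonneg P 1 w)
      rw [Nat.cast_sub hle] at h'
      linarith
    · have : (e : ℝ) ≤ c ((w, a), e) := by exact_mod_cast hlt.le
      linarith
  · intro w a hw
    have hpos : 0 < M * (2 + -excessHit P f w a) :=
      mul_pos hM' (by linarith [(abs_le.1 (abs_excessHit_le (P := P) (f := f) w a)).2])
    obtain ⟨e, he, he'⟩ := exists_nat_lt_ge_sub_one hpos
    refine ⟨e, ?_, he'⟩
    rw [hval w a e] at he
    rcases le_or_gt (c ((w, a), e)) e with hle | hlt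
    · right
      show ((e - c ((w, a), e) : ℕ) : ℝ) * blockProb P 1 w <
          (M : ℝ) * blockProb P 1 (w ++ [f w])
      rw [← blockProb_mul_condProb, mul_left_comm, mul_comm _ (blockProb P 1 w), Nat.cast_sub hle]
      exact mul_lt_mul_of_pos_left (by linarith) hw
    · exact .inl hlt

/-- Along a random point, a computable predictor succeeds as often as its conditional
probabilities predict. -/
theorem IsOneRandomWith.tendsto_average_excessHit (hx : IsOneRandomWith s P x)
    (hs : IsRepresentation s P) (hf : Computable f) :
    Tendsto (fun n : ℕ => (1 / (n : ℝ)) * ∑ i ∈ Finset.range n,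
      excessHit P f (block x 1 i) (x ((i : ℤ) + 1))) atTop (𝓝 0) := by
  rw [Metric.tendsto_nhds]
  intro ε hε
  have h1 := hx.eventually_strSum_le (d := excessHit P f) abs_excessHit_le
    (fun w => (sum_blockProb_mul_excessHit w).le) (exists_ceIn_le_excessHit hs hf) (half_pos hε)
  have h2 := hx.eventually_strSum_le (d := fun w a => -excessHit P f w a)
    (fun w a => by rw [abs_neg]; exact abs_excessHit_le w a)
    (fun w => by simp [mul_neg, sum_blockProb_mul_excessHit])
    (exists_ceIn_le_neg_excessHit hs hf) (half_pos hε)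
  filter_upwards [h1, h2, eventually_gt_atTop 0] with n h1 h2 hn
  have hn' : (0 : ℝ) < n := by exact_mod_cast hn
  rw [strSum_block] at h1 h2
  rw [Finset.sum_neg_distrib] at h2
  rw [Real.dist_eq, sub_zero, one_div_mul_eq_div, abs_div, abs_of_pos hn', div_lt_iff₀ hn', abs_lt]
  constructor <;> nlinarith

theorem le_argmax [NeZero D] (g : Fin D → ℝ) (b : Fin D) : g b ≤ g (argmax g) := by
  classical
  exact (Finset.mem_filter.1 (Finset.min'_mem (Finset.univ.filter fun a => ∀ b, g b ≤ g a) _)).2 b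

/-- Pass from `P` to `R` at the best letter, use that the predicted letter maximizes `R`, and pass
back to `P`; each passage costs at most the `ℓ¹` distance. The rule for ties plays no role. -/
theorem maxCondProb_le_inducedPredictor_add [NeZero D] (R : ProbabilityMeasure (BiSeq D))
    (w : List (Fin D)) :
    maxCondProb P w ≤ condProb P 1 w (inducedPredictor R w) +
      2 * ∑ a, |condProb R 1 w a - condProb P 1 w a| := by
  obtain ⟨b, hb⟩ := exists_eq_maxCondProb (P := P) w
  have key : ∀ a, |condProb R 1 w a - condProb P 1 w a| ≤
      ∑ a, |condProb R 1 w a - condProb P 1 w a| := fun a =>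
    Finset.single_le_sum (f := fun a => |condProb R 1 w a - condProb P 1 w a|)
      (fun _ _ => abs_nonneg _) (Finset.mem_univ a)
  have h1 := (abs_le.1 (key b)).1
  have h2 := (abs_le.1 (key (inducedPredictor R w))).2
  have h3 : condProb R 1 w b ≤ condProb R 1 w (inducedPredictor R w) := le_argmax _ b
  linarith

/-- Dominated convergence; stationarity moves the conditional probabilities to position `1`. -/
theorem isUnpredictabilityRate_of_tendsto [NeZero D] (hP : StationaryErgodic P)
    {G : BiSeq D → ℝ} (hlim : ∀ᵐ y ∂(P : Measure (BiSeq D)),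
      Tendsto (fun n : ℕ => maxCondProb P (block y (-(n : ℤ)) n)) atTop (𝓝 (G y))) :
    IsUnpredictabilityRate P (1 - ∫ y, G y ∂(P : Measure (BiSeq D))) := by
  have heq : ∀ (n : ℕ) (y : BiSeq D),
      (⨆ a, condProb P (-(n : ℤ)) (block y (-(n : ℤ)) n) a) =
        maxCondProb P (block y (-(n : ℤ)) n) := fun n y =>
    iSup_congr fun a => condProb_eq_of_stationary hP.toMeasurePreserving _ _ a
  have hInt : ∀ n : ℕ, Integrable (fun y => maxCondProb P (block y (-(n : ℤ)) n))
      (P : Measure (BiSeq D)) := fun n =>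
    Integrable.of_bound (measurable_comp_block _ _ _).aestronglyMeasurable 1
      (ae_of_all _ fun y => by
        rw [Real.norm_of_nonneg (maxCondProb_nonneg _)]; exact maxCondProb_le_one _)
  simp only [IsUnpredictabilityRate, heq]
  simp_rw [integral_sub (integrable_const (1 : ℝ)) (hInt _)]
  simp only [integral_const, probReal_univ, smul_eq_mul, mul_one]
  refine Tendsto.const_sub 1 ?_
  refine tendsto_integral_of_dominated_convergence (fun _ => 1)
    (fun n => (hInt n).aestronglyMeasurable) (integrable_const 1) (fun n => ae_of_all _ fun y => ?_)
    hlim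
  rw [Real.norm_of_nonneg (maxCondProb_nonneg _)]
  exact maxCondProb_le_one _

theorem IsOneUniversalForwardEstimator.isOneUniversalPredictor [NeZero D]
    {R : ProbabilityMeasure (BiSeq D)} (hR : IsOneUniversalForwardEstimator R)
    (hf : Computable (inducedPredictor R)) : IsOneUniversalPredictor (inducedPredictor R) := by
  refine ⟨hf, fun P hP => ?_⟩
  obtain ⟨G, hG, hlim⟩ := exists_tendsto_maxCondProb hP.toMeasurePreserving
  refine ⟨_, isUnpredictabilityRate_of_tendsto hP hlim, fun x hx => ?_⟩
  have herr := hR.2 P hP x hx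
  obtain ⟨s, hs, hx⟩ := hx
  have hmax := hx.tendsto_average_maxCondProb hs hP hG hlim
  have hhit := hx.tendsto_average_excessHit hs hf
  have hgap : Tendsto (fun n : ℕ => (1 / (n : ℝ)) * ∑ i ∈ Finset.range n,
      (maxCondProb P (block x 1 i) -
        condProb P 1 (block x 1 i) (inducedPredictor R (block x 1 i)))) atTop (𝓝 0) := by
    have herr2 := herr.const_mul 2
    rw [mul_zero] at herr2
    refine squeeze_zero (fun n => ?_) (fun n => ?_) herr2
    · exact mul_nonneg (by positivity) (Finset.sum_nonneg fun i _ =>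
        sub_nonneg.2 (condProb_le_maxCondProb _ _))
    · rw [mul_left_comm (2 : ℝ)]
      refine mul_le_mul_of_nonneg_left ?_ (by positivity)
      rw [Finset.mul_sum]
      refine Finset.sum_le_sum fun i _ => ?_
      linarith [maxCondProb_le_inducedPredictor_add (P := P) R (block x 1 i)]
  -- One minus the maximum, plus the gap, minus the excess hit: at each time this is the error
  -- indicator.
  have h := ((hmax.const_sub 1).add hgap).sub hhit
  rw [add_zero, sub_zero] at h
  refine h.congr' ?_
  filter_upwards [eventually_gt_atTop 0] with n hn
  have hn' : (n : ℝ) ≠ 0 := by exact_mod_cast hn.ne'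
  have h1 : (1 : ℝ) = (1 / (n : ℝ)) * ∑ i ∈ Finset.range n, (1 : ℝ) := by
    simp [hn']
  nth_rewrite 1 [h1]
  rw [← mul_sub, ← mul_add, ← mul_sub, ← Finset.sum_sub_distrib, ← Finset.sum_add_distrib,
    ← Finset.sum_sub_distrib]
  congr 1
  refine Finset.sum_congr rfl fun i _ => ?_
  simp only [excessHit]
  by_cases hi : x ((i : ℤ) + 1) = inducedPredictor R (block x 1 i)
  · simp [hi]
  · simp [hi]

end Prediction

end UniversalPrediction

theorem mainTheorem3 (D : ℕ) [NeZero D] (hD : 2 ≤ D)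
    (R : MeasureTheory.ProbabilityMeasure (UniversalPrediction.BiSeq D))
    (hR : UniversalPrediction.IsOneUniversalForwardEstimator R)
    (hf : Computable (UniversalPrediction.inducedPredictor R)) :
    UniversalPrediction.IsOneUniversalPredictor (UniversalPrediction.inducedPredictor R) :=
  hR.isOneUniversalPredictor hf
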